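/- **Model.** Let $0\le\zeta<1/2$, $L\ge 0$, $d\ge 1$, let $\sigma:\mathbb R\to[-1,1]$ be odd, monotone (non-decreasing) and $L$-Lipschitz, and let $w^*\in\mathbb R^d$ with $\|w^*\|\le 1$. A probability distribution $\mathcal D$ of pairs $(x,Y)\in\mathbb R^d\times\{\pm1\}$ *arises from a $\zeta$-misspecified GLM* with link $\sigma$ and direction $w^*$ if $\|x\|\le 1$ almost surely and, for some function $\eta:\mathbb R^d\to\mathbb R$ with $$-2\zeta\le \eta(x)\,\mathrm{sgn}\langle w^*,x\rangle\le 1-|\sigma(\langle w^*,x\rangle)|\quad\text{for all }x,$$ we have $\mathbb E[Y\mid x]=\sigma(\langle w^*,x\rangle)+\eta(x)$ (here $\mathrm{sgn}(0)=0$). The learner has access to i.i.d. samples from $\mathcal D$ and knows $L,\zeta$ but not $\sigma,w^*,\eta$. For $h:\mathbb R^d\to\{\pm1\}$ let $\mathrm{err}(h)=\Pr_{\mathcal D}[h(x)\ne Y]$. **Algorithm LearnMisspecGLM.** Parameters: natural numbers $a,b,k,r$ (absolute constants). Put $m=\lceil a((1+L)/\varepsilon)^a\log(2/\delta)\rceil$,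 $\upsilon=(\varepsilon/(b(1+L)))^b$, $\zeta'=2\zeta+\varepsilon$. Every *batch* consists of $m$ fresh samples; samples from a region are those samples of a batch that fall into it; $\widehat\mu,\widehat{\mathrm{err}}$ are empirical frequencies (with $0/0=0$). The algorithm keeps a partition of $\mathbb R^d$, a label in $\{\pm1\}$ for each region, and marks regions as live or frozen. Initially there is one live region, $\mathbb R^d$, with the label of smaller empirical error. It repeats the following for at most $\lceil r((1+L)/\varepsilon)^r\rceil$ rounds and then outputs the current labelled partition. 1. On a fresh batch, estimate the total mass of the live regions; if it is at most $\varepsilon$, stop and output the current labelled partition. On another batch find the live region $R$ of largest empirical mass; let $s_0$ be its label. 2. *Split.* On a fresh batch estimate $\widehat{\mathrm{err}}_R(s_0)$; let $s=-s_0$ if it exceeds $1/2$ and $s=s_0$ otherwise, with $\widehat{\mathrm{err}}_R(s)$ defined accordingly. Draw a batch $\widehat{\mathcal D}$ restricted to $R$. For each $\lambda\in\{0,\varepsilon/4,2\varepsilon/4,\dots\}\cap[0,1/2]$, run projected SGD on the unit ball, from $0$, with step size $1/\sqrt m$ and fresh samples from $R$, on the loss $w\mapsto\mathbb E[\mathrm{LeakyRelu}_\lambda(-Y\langle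 w,x\rangle)\mid x\in R]$, where $\mathrm{LeakyRelu}_\lambda(t)=\frac12t+(\frac12-\lambda)|t|$; let $w_\lambda$ be the normalized average iterate. Among all $\lambda$ and all thresholds $\tau>0$ of the form $\tau=|\langle w_\lambda,x\rangle|$, $x\in\widehat{\mathcal D}$, for which $A=\{|\langle w_\lambda,x\rangle|\ge\tau\}$ satisfies $9L\lambda\,\widehat\mu(A\mid R)\ge\varepsilon\zeta'$, choose one minimizing the empirical error of $\mathrm{sgn}\langle w_\lambda,\cdot\rangle$ on $A\cap R$; if there is none, freeze $R$ with label $s$. Otherwise let $R_t=R\cap\{t\langle w_\lambda,x\rangle\ge\tau\}$ for $t=\pm1$ and estimate $\widehat\mu(R_t\mid R)$ and $\widehat{\mathrm{err}}_{R_t}(t)$ on a fresh batch. If $kL\lambda\min_t\widehat\mu(R_t\mid R)\ge\varepsilon^2\zeta'$, let $t$ minimize $\widehat{\mathrm{err}}_{R_t}(t)$; otherwise let $t$ maximize $\widehat\mu(R_t\mid R)$. If $\widehat{\mathrm{err}}_{R_t}(t)\le\widehat{\mathrm{err}}_R(s)-\varepsilon$, replace $R$ by the live regions $R_t$, with label $t$,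 and $R\setminus R_t$, with label $s$; otherwise freeze $R$ with label $s$. 3. *Merge* (only after $R$ was split). On a fresh batch estimate the error of the current label on each live region; if there are two live regions with the same label whose estimates differ by at most $\upsilon$, merge one such pair. Regions are stored through the history of splits and merges, and membership is decided by replaying that history. The sample complexity is the number of samples drawn; the running time is the number of elementary steps (operations on reals, including square roots and comparisons, and on integers and memory cells, at unit cost; a vector operation in $\mathbb R^d$ costs $O(d)$). **Theorem.** There are absolute constants $a,b,k,r$ and $C$, a polynomial $p$ in three variables and a polynomial $q$ in one variable such that for all $d\ge 1$, $L\ge0$, $0\le\zeta<1/2$, $\varepsilon>0$ and $0<\delta<1$ the following holds with $N=p\big(L,\varepsilon^{-1},\max(\zeta,\varepsilon)^{-1}\big)\cdot\log(2/\delta)$. * On every sequence of samples, LearnMisspecGLM draws at most $N$ samples and runs in time at most $d\cdot q(N)$. * If $\mathcal D$ arises from a $\zeta$-misspecified GLM with link $\sigma$ and direction $w^*$ as above, then with probability at least $1-\delta$ over i.i.d. samples from $\mathcal D$ the (improper, piecewise-constant) classifier $h$ that is output satisfies $$\mathrm{err}(h)\le\frac{1-\mathbb E_{\mathcal D}\,\sigma(|\langle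 w^*,x\rangle|)}{2}+\zeta+C\varepsilon .$$ -/

import Mathlib

open MeasureTheory
open scoped NNReal

/-! ### The data model -/

/-- Points of the ambient space `ℝ^d` with its Euclidean norm. -/
abbrev Pt (d : ℕ) := EuclideanSpace ℝ (Fin d)

/-- A labelled example `(x, Y)`; `true` stands for the label `+1`, `false` for `-1`. -/
abbrev Example (d : ℕ) := Pt d × Bool

/-- The numerical value `±1` of a label. -/
noncomputable def lab (b : Bool) : ℝ := if b then 1 else -1

/-- A link function: odd, monotone, `L`-Lipschitz, with values in `[-1, 1]`. -/
structure IsLink (L : ℝ≥0) (σ : ℝ → ℝ) : Prop where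
  odd : Function.Odd σ
  mono : Monotone σ
  lipschitz : LipschitzWith L σ
  bound : ∀ t, |σ t| ≤ 1

/-- `D` arises from a `ζ`-misspecified GLM with link function `σ` and true direction `w`:
the marginal of `x` lives on the unit ball, and for some `ζ`-misspecification adversary `δ`
one has `E[Y | x] = σ(⟨w, x⟩) + δ(x)`.  Here `Real.sign 0 = 0`. -/
structure IsMisspecifiedGLM {d : ℕ} (ζ : ℝ) (σ : ℝ → ℝ) (w : Pt d)
    (D : Measure (Example d)) : Prop where
  support : ∀ᵐ z ∂D, ‖z.1‖ ≤ 1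
  model : ∃ δ : Pt d → ℝ,
    (∀ x, -2 * ζ ≤ δ x * Real.sign (inner ℝ w x) ∧
      δ x * Real.sign (inner ℝ w x) ≤ 1 - |σ (inner ℝ w x)|) ∧
    D[fun z => lab z.2 | MeasurableSpace.comap Prod.fst inferInstance]
      =ᵐ[D] fun z => σ (inner ℝ w z.1) + δ z.1

/-- The zero-one error `Pr_D[h(x) ≠ Y]`. -/
noncomputable def zeroOneErr {d : ℕ} (D : Measure (Example d)) (h : Pt d → Bool) : ℝ :=
  D.real {z | h z.1 ≠ z.2}

/-! ### Piecewise-constant classifiers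

A partition of `ℝ^d` is given by the history of its refinements and coarsenings (most recent
first).  Regions carry numerical names; initially the whole space is region `0`. -/

/-- One modification of a partition. `cut i w τ s j` moves the points of region `i` with
`s ⟨w, x⟩ ≥ τ` to the new region `j`; `merge i j` merges region `j` into region `i`. -/
inductive Step (d : ℕ) where
  | cut (i : ℕ) (w : Pt d) (τ : ℝ) (s : Bool) (j : ℕ)
  | merge (i j : ℕ)

/-- The name of the region that contains a point. -/
noncomputable def regionOf {d : ℕ} : List (Step d) → Pt d → ℕ
  | [], _ => 0
  | Step.cut i w τ s j :: p, x =>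
      if regionOf p x = i ∧ τ ≤ lab s * inner ℝ w x then j else regionOf p x
  | Step.merge i j :: p, x => if regionOf p x = j then i else regionOf p x

/-- A piecewise-constant classifier: a finite partition and a label for each region. -/
structure Classifier (d : ℕ) where
  steps : List (Step d)
  label : ℕ → Bool

/-- The hypothesis `ℝ^d → {±1}` that a classifier represents. -/
noncomputable def Classifier.predict {d : ℕ} (h : Classifier d) (x : Pt d) : Bool :=
  h.label (regionOf h.steps x)

/-- The partition behind a classifier has finitely many regions. -/
theorem finite_range_regionOf {d : ℕ} (p : List (Step d)) :
    (Set.range (regionOf p)).Finite := by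
  induction p with
  | nil => exact (Set.finite_singleton 0).subset (by rintro _ ⟨x, rfl⟩; simp [regionOf])
  | cons a p ih =>
    cases a with
    | cut i w τ s j =>
      refine (ih.insert j).subset ?_
      rintro _ ⟨x, rfl⟩
      simp only [regionOf]
      split_ifs
      · exact Set.mem_insert _ _
      · exact Set.mem_insert_of_mem _ ⟨x, rfl⟩
    | merge i j =>
      refine (ih.insert i).subset ?_
      rintro _ ⟨x, rfl⟩
      simp only [regionOf]
      split_ifs
      · exact Set.mem_insert _ _
      · exact Set.mem_insert_of_mem _ ⟨x, rfl⟩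

/-! ### Programs with sample access and a step count -/

/-- Programs that read a stream of examples.  The state holds the number of examples drawn so
far and the number of elementary steps made so far.  An elementary step is an arithmetic
operation, a square root or a comparison of reals, an operation on a natural number or a bit,
or an access to one cell of memory; one vector operation in `ℝ^d` costs a multiple of `d`. -/
abbrev Alg (d : ℕ) := ReaderT (ℕ → Example d) (StateM (ℕ × ℕ))

namespace Alg

variable {d : ℕ}

/-- Charge `n` elementary steps. -/
def tick (n : ℕ) : Alg d Unit := modify fun s => (s.1, s.2 + n)

/-- Draw the next example (and write it to memory: `d` coordinates and a label). -/
def drawOne : Alg d (Example d) := do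
  let ω ← read
  let s ← get
  set (s.1 + 1, s.2 + (d + 1))
  return ω s.1

/-- Draw `m` fresh examples. -/
def draw : ℕ → Alg d (List (Example d))
  | 0 => return []
  | m + 1 => do
    tick 1
    let z ← drawOne
    let zs ← draw m
    return z :: zs

/-- Keep the entries of a list that pass a test. -/
def keep {α : Type} (p : α → Alg d Bool) : List α → Alg d (List α)
  | [] => return []
  | a :: l => do
    tick 1
    let b ← p a
    let r ← keep p l
    return if b then a :: r else r

/-- Count the entries of a list that pass a test. -/
def count {α : Type} (p : α → Alg d Bool) : List α → Alg d ℕ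
  | [] => return 0
  | a :: l => do
    tick 1
    let b ← p a
    let n ← count p l
    return if b then n + 1 else n

/-- Apply a program to every entry of a list. -/
def each {α β : Type} (f : α → Alg d β) : List α → Alg d (List β)
  | [] => return []
  | a :: l => do
    tick 1
    let b ← f a
    let r ← each f l
    return b :: r

/-- The fraction of the entries of a list that pass a test (`0` for the empty list). -/
noncomputable def fraction {α : Type} (p : α → Alg d Bool) (l : List α) : Alg d ℝ := do
  let c ← count p l
  let n ← count (fun _ => pure true) l
  tick 1
  return (c : ℝ) / n

/-- The inner product of two vectors. -/
noncomputable def dot (x y : Pt d) : Alg d ℝ := do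
  tick (2 * d)
  return inner ℝ x y

/-- The vector `a x + y`. -/
noncomputable def axpy (a : ℝ) (x y : Pt d) : Alg d (Pt d) := do
  tick (2 * d)
  return a • x + y

/-- The Euclidean norm of a vector. -/
noncomputable def norm2 (x : Pt d) : Alg d ℝ := do
  tick (2 * d + 1)
  return ‖x‖

/-- The vector `x / r`. -/
noncomputable def divide (r : ℝ) (x : Pt d) : Alg d (Pt d) := do
  tick (d + 1)
  return r⁻¹ • x

/-- Membership oracle: the name of the region of a partition to which a point belongs. -/
noncomputable def locate : List (Step d) → Pt d → Alg d ℕ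
  | [], _ => return 0
  | Step.cut i w τ s j :: p, x => do
    let r ← locate p x
    let a ← dot w x
    tick 4
    return if r = i ∧ τ ≤ lab s * a then j else r
  | Step.merge i j :: p, x => do
    let r ← locate p x
    tick 2
    return if r = j then i else r

/-- Rejection sampling with a budget: draw `m` fresh examples and keep those whose point lies
in region `i`. -/
noncomputable def drawIn (p : List (Step d)) (i m : ℕ) : Alg d (List (Example d)) := do
  let S ← draw m
  keep (fun z => do
    let r ← locate p z.1
    tick 1
    return decide (r = i)) S

/-- The empirical error of the constant label `s` on a list of labels. -/
noncomputable def constErr (s : Bool) (S : List Bool) : Alg d ℝ :=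
  fraction (fun y => do
    tick 1
    return decide (y ≠ s)) S

end Alg

/-! ### The algorithm -/

/-- The absolute constants hidden in the `O(·)`s of the algorithm: for the size of the batches,
the coarseness of merging, the mass test of the splitting step, and the number of rounds. -/
structure Constants where
  cBatch : ℕ
  cMerge : ℕ
  cMass : ℕ
  cRounds : ℕ

/-- Input parameters: Lipschitz constant, misspecification, accuracy, failure probability. -/
structure Params where
  L : ℝ≥0
  ζ : ℝ
  ε : ℝ
  δ : ℝ

namespace Params

/-- The number of examples in each batch. -/
noncomputable def batch (P : Params) (K : Constants) : ℕ :=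
  ⌈(K.cBatch : ℝ) * ((1 + P.L) / P.ε) ^ K.cBatch * Real.log (2 / P.δ)⌉₊

/-- The coarseness `υ` of the merging step. -/
noncomputable def coarse (P : Params) (K : Constants) : ℝ :=
  (P.ε / (K.cMerge * (1 + P.L))) ^ K.cMerge

/-- The number of rounds after which the main loop is stopped. -/
noncomputable def rounds (P : Params) (K : Constants) : ℕ :=
  ⌈(K.cRounds : ℝ) * ((1 + P.L) / P.ε) ^ K.cRounds⌉₊

/-- The number of positive points `ε/4, 2ε/4, …` of the grid of leakage parameters in
`[0, 1/2]`. -/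
noncomputable def grid (P : Params) : ℕ := ⌊2 / P.ε⌋₊

/-- `ζ' = 2ζ + ε`. -/
noncomputable def slack (P : Params) : ℝ := 2 * P.ζ + P.ε

end Params

namespace Alg

variable {d : ℕ}

/-- Projection to the unit ball. -/
noncomputable def project (v : Pt d) : Alg d (Pt d) := do
  let r ← norm2 v
  tick 1
  if 1 < r then divide r v else return v

/-- Projected SGD with step size `ν`, from the iterate `w`, for the loss
`E LeakyRelu_lam(-Y ⟨w, x⟩)`, where `LeakyRelu_lam(t)` is `(1 - lam) t` for `t ≥ 0` and `lam t` for
`t < 0`.  The output is `acc` plus the sum of the iterates at which a gradient was taken. -/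
noncomputable def sgdLoop (lam ν : ℝ) : List (Example d) → Pt d → Pt d → Alg d (Pt d)
  | [], _, acc => return acc
  | z :: zs, w, acc => do
    let acc' ← axpy 1 w acc
    let a ← dot w z.1
    tick 8
    let slope := if 0 ≤ -(lab z.2 * a) then 1 - lam else lam
    let v ← axpy (ν * slope * lab z.2) z.1 w
    let w' ← project v
    sgdLoop lam ν zs w' acc'

/-- SGD from `0`.  The output is the average iterate (equivalently, the sum of the iterates),
normalized to have norm one unless it vanishes. -/
noncomputable def sgd (lam ν : ℝ) (S : List (Example d)) : Alg d (Pt d) := do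
  tick (2 * d)
  let v ← sgdLoop lam ν S 0 0
  let r ← norm2 v
  tick 1
  if r = 0 then return v else divide r v

/-- A candidate annulus `{x : |⟨w, x⟩| ≥ τ}`, with the leakage parameter from which it was obtained
and the empirical error of `sgn ⟨w, x⟩` on it. -/
structure Cand (d : ℕ) where
  w : Pt d
  τ : ℝ
  lam : ℝ
  err : ℝ

/-- Among the candidate thresholds in the given list of reals, and the candidate `best` found so
far, take the one with the smallest empirical error; thresholds have to be positive and leave
enough empirical mass in the annulus: at least `ε ζ' / (9 L lam)`.  `M` is the list of pairs
`(⟨w, x⟩, y)` for the examples `(x, y)` of the empirical distribution. -/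
noncomputable def scan (P : Params) (w : Pt d) (lam : ℝ) (M : List (ℝ × Bool)) :
    List ℝ → Option (Cand d) → Alg d (Option (Cand d))
  | [], best => return best
  | τ :: ts, best => do
    let A ← keep (fun a : ℝ × Bool => do
      tick 2
      return decide (τ ≤ |a.1|)) M
    let n ← count (fun _ => pure true) M
    let k ← count (fun _ => pure true) A
    let e ← fraction (fun a : ℝ × Bool => do
      tick 2
      return decide (lab a.2 * a.1 < 0)) A
    tick 15
    let ok : Bool := decide (0 < τ ∧ P.ε * P.slack ≤ 9 * P.L * lam * ((k : ℝ) / n))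
    let better : Bool := match best with
      | none => true
      | some c => decide (e < c.err)
    scan P w lam M ts (if ok && better then some ⟨w, τ, lam, e⟩ else best)

/-- The loop over the leakage parameters `lam = ε/4 * k` for `k < n` (in decreasing order).  `S` is
the empirical distribution, of examples in region `i`. -/
noncomputable def search (K : Constants) (P : Params) (p : List (Step d)) (i : ℕ)
    (S : List (Example d)) : ℕ → Option (Cand d) → Alg d (Option (Cand d))
  | 0, best => return best
  | k + 1, best => do
    tick 5
    let lam := P.ε / 4 * k
    let T ← drawIn p i (P.batch K)
    let w ← sgd lam (1 / Real.sqrt (P.batch K)) T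
    let M ← each (fun z : Example d => do
      let a ← dot w z.1
      return (a, z.2)) S
    let ts ← each (fun a : ℝ × Bool => do
      tick 1
      return |a.1|) M
    let best' ← scan P w lam M ts best
    search K P p i S k best'

/-- The splitting step for region `i` with label `s₀`.  The output is a label `s` together with
either `none` (freeze region `i`) or `some (w, τ, t)` (split off the part with `t ⟨w, x⟩ ≥ τ`,
with label `t`). -/
noncomputable def split (K : Constants) (P : Params) (p : List (Step d)) (i : ℕ) (s₀ : Bool) :
    Alg d (Bool × Option (Pt d × ℝ × Bool)) := do
  let S₁ ← drawIn p i (P.batch K)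
  let Y₁ ← each (fun z => pure z.2) S₁
  let e₀ ← constErr s₀ Y₁
  tick 3
  let s := if 1 / 2 < e₀ then !s₀ else s₀
  let e := if 1 / 2 < e₀ then 1 - e₀ else e₀
  let S₂ ← drawIn p i (P.batch K)
  let best ← search K P p i S₂ (P.grid + 1) none
  match best with
  | none => return (s, none)
  | some c => do
    let S₃ ← drawIn p i (P.batch K)
    let half := fun (t : Bool) (z : Example d) => (do
      let a ← dot c.w z.1
      tick 2
      return decide (c.τ ≤ lab t * a) : Alg d Bool)
    let H₁ ← keep (half true) S₃
    let H₂ ← keep (half false) S₃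
    let m₁ ← fraction (half true) S₃
    let m₂ ← fraction (half false) S₃
    let Y₂ ← each (fun z => pure z.2) H₁
    let Y₃ ← each (fun z => pure z.2) H₂
    let e₁ ← constErr true Y₂
    let e₂ ← constErr false Y₃
    tick 15
    let t : Bool :=
      if P.ε ^ 2 * P.slack ≤ K.cMass * P.L * c.lam * min m₁ m₂ then decide (e₁ ≤ e₂)
      else decide (m₂ ≤ m₁)
    if (if t then e₁ else e₂) ≤ e - P.ε then
      return (s, some (c.w, c.τ, t))
    else
      return (s, none)

/-- The current state of the algorithm: a classifier, the list of the names of the live regions,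
and the next unused name. -/
structure Hyp (d : ℕ) where
  cls : Classifier d
  live : List ℕ
  next : ℕ

/-- The first entry `b` of a list of triples (region, label, empirical error) with the same label
as `a` and an error within `υ` of that of `a`. -/
noncomputable def findMate (υ : ℝ) (a : ℕ × Bool × ℝ) :
    List (ℕ × Bool × ℝ) → Alg d (Option ℕ)
  | [] => return none
  | b :: l => do
    tick 6
    if b.2.1 = a.2.1 ∧ |a.2.2 - b.2.2| ≤ υ then return some b.1 else findMate υ a l

/-- A pair of regions in the list with the same label and errors within `υ`, if there is one. -/
noncomputable def findPair (υ : ℝ) : List (ℕ × Bool × ℝ) → Alg d (Option (ℕ × ℕ))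
  | [] => return none
  | a :: l => do
    tick 1
    let m ← findMate υ a l
    match m with
    | some j => return some (a.1, j)
    | none => findPair υ l

/-- The merging step: merge two live regions with the same label on which the empirical errors of
the classifier differ by at most `υ`, if there are any. -/
noncomputable def merge (K : Constants) (P : Params) (h : Hyp d) : Alg d (Hyp d) := do
  let S ← draw (P.batch K)
  let R ← each (fun z : Example d => do
    let r ← locate h.cls.steps z.1
    return (r, z.2)) S
  let E ← each (fun i : ℕ => do
    let A ← keep (fun a : ℕ × Bool => do
      tick 1
      return decide (a.1 = i)) R
    let Y ← each (fun a => pure a.2) A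
    tick 1
    let e ← constErr (h.cls.label i) Y
    return (i, h.cls.label i, e)) h.live
  let o ← findPair (P.coarse K) E
  match o with
  | none => return h
  | some (i, j) => do
    tick (h.live.length + 2)
    return { h with
      cls := { h.cls with steps := Step.merge i j :: h.cls.steps }
      live := h.live.erase j }

/-- The entry of a list with the largest second component (the first one in case of ties). -/
def largest : List (ℕ × ℕ) → Option (ℕ × ℕ) → Alg d (Option (ℕ × ℕ))
  | [], best => return best
  | a :: l, best => do
    tick 2
    match best with
    | none => largest l (some a)
    | some b => largest l (if b.2 < a.2 then some a else some b)

/-- The main loop, stopped after the given number of rounds. -/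
noncomputable def mainLoop (K : Constants) (P : Params) : ℕ → Hyp d → Alg d (Classifier d)
  | 0, h => return h.cls
  | n + 1, h => do
    let S ← draw (P.batch K)
    let μlive ← fraction (fun z : Example d => do
      let r ← locate h.cls.steps z.1
      tick h.live.length
      return decide (r ∈ h.live)) S
    tick 1
    if μlive ≤ P.ε then
      return h.cls
    else
      let S' ← draw (P.batch K)
      let R ← each (fun z : Example d => locate h.cls.steps z.1) S'
      let M ← each (fun i : ℕ => do
        let c ← count (fun r => do
          tick 1
          return decide (r = i)) R
        return (i, c)) h.live
      let o ← largest M none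
      match o with
      | none => return h.cls
      | some (i, _) => do
        tick 1
        let out ← split K P h.cls.steps i (h.cls.label i)
        match out with
        | (s, some (w, τ, t)) => do
          tick (d + 10)
          let h' ← merge K P
            { cls :=
                { steps := Step.cut i w τ t h.next :: h.cls.steps
                  label := Function.update (Function.update h.cls.label i s) h.next t }
              live := h.next :: h.live
              next := h.next + 1 }
          mainLoop K P n h'
        | (s, none) => do
          tick (h.live.length + 1)
          mainLoop K P n
            { h with
              cls := { h.cls with label := Function.update h.cls.label i s }
              live := h.live.erase i }

/-- The algorithm `LearnMisspecGLM`. -/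
noncomputable def learnMisspecGLM (K : Constants) (P : Params) : Alg d (Classifier d) := do
  -- computing the numerical parameters
  tick (K.cBatch + K.cMerge + K.cRounds + P.batch K + P.rounds K + P.grid + 20)
  let S ← draw (P.batch K)
  let Y ← each (fun z => pure z.2) S
  let e₁ ← constErr true Y
  let e₂ ← constErr false Y
  tick 3
  let s : Bool := decide (e₁ ≤ e₂)
  mainLoop K P (P.rounds K) { cls := { steps := [], label := fun _ => s }, live := [0], next := 1 }

end Alg

/-- The classifier that `LearnMisspecGLM` outputs on a stream of examples. -/
noncomputable def glmOutput {d : ℕ} (K : Constants) (P : Params) (ω : ℕ → Example d) :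
    Classifier d :=
  (Alg.learnMisspecGLM K P ω (0, 0)).1

/-- The number of examples that `LearnMisspecGLM` draws from a stream of examples. -/
noncomputable def glmSamples {d : ℕ} (K : Constants) (P : Params) (ω : ℕ → Example d) : ℕ :=
  (Alg.learnMisspecGLM K P ω (0, 0)).2.1

/-- The number of elementary steps of `LearnMisspecGLM` on a stream of examples. -/
noncomputable def glmTime {d : ℕ} (K : Constants) (P : Params) (ω : ℕ → Example d) : ℕ :=
  (Alg.learnMisspecGLM K P ω (0, 0)).2.2

/-!
The algorithm makes progress as long as its current label is far from optimal on some live region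
of noticeable mass, and the amount of possible progress is bounded.

*Freezing is safe.*  Let `R` be a region on which the allowed error, the average of
`(1 - σ |⟨w*, x⟩|) / 2 + ζ`, is smaller than the error of the best constant by a multiple of `ε`.  As
`σ` is Lipschitz, the average margin `|⟨w*, x⟩|` on `R` is then at least `ζ' / L`.  For a leakage
parameter `λ` slightly above the allowed error, the leaky loss of `w*` is the average of the margin
times a quantity that decreases with the margin and is negative on average; so it is at most a
multiple of `-ε ζ' / L`, by Chebyshev's association inequality
(`IsMisspecifiedGLM.integral_leaky_le`).  The regret bound `sgd_regret` and concentration give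
a direction `w` with a comparable loss (`RoundGood.regionLoss_roundDir_le`).  The leaky loss of `w`
is an average over the thresholds `τ` of the number of errors of `sgn ⟨w, ·⟩` minus `λ` times the
number of examples in `{|⟨w, x⟩| ≥ τ}`; so some threshold gives an annulus which is not too light and
on which the error is at most `λ` (`exists_threshold`, `RoundGood.exists_admissible`).  One of its two
sides inherits the error, and the algorithm splits it off instead of freezing `R`
(`RoundGood.sideErr_chosenSide_le`, `RoundGood.freeze_le`).

*Termination.*  The potential is the sum over the live regions of the mass times the variance of
the label.  A split lowers it by the mass of the part split off times the square of the difference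
of the errors; a merge of regions with errors within `υ` raises it by a multiple of `υ ^ 2`, which is
smaller; freezing removes a region that carries a good part of the live mass, as merging keeps
the number of live regions bounded (`length_le_of_separated`).  So potential plus live mass decreases
by a fixed amount in every round (`Invariant.step`), and the live mass becomes negligible before the
rounds are used up (`GoodRun.zeroOneErr_le`).

*Probability.*  The queries are adaptive, so each estimate is controlled for all sequences of
discrete decisions at once (`trace`, `prob_not_goodRun_le`): with the decisions prescribed, the
partition is a measurable function of the past examples, and `azuma_stream` applies.  The thresholds
come from the same batch on which candidates are compared; as each depends on one example of it
besides the past, leaving that example out restores independence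
(`prob_not_accurate_le_of_dependsOn_one`).  The number of sequences is exponential in the number of
rounds times the logarithm of the batch size, which the batch size dominates (`pow_mul_exp_le`).

*Cost.*  `Alg.Eval` records the value, the samples and the steps of a program, so the same
induction over the rounds (`Alg.Eval.mainLoop`) serves both the cost bounds and the error bound.
-/

/-! ### Values, samples and steps of programs -/

namespace Alg

variable {d : ℕ} {α β : Type}

/-- `Eval f ω n a n' T`: started after `n` examples of the stream `ω` have been read, the program
`f` returns `a`, has read `n'` examples in total when it stops, and makes at most `T` steps. -/
def Eval (f : Alg d α) (ω : ℕ → Example d) (n : ℕ) (a : α) (n' T : ℕ) : Prop :=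
  ∀ t, ∃ t', t' ≤ T ∧ f ω (n, t) = (a, (n', t + t'))

variable {ω : ℕ → Example d} {n n₁ n₂ : ℕ} {a : α} {b : β}

theorem Eval.mono {f : Alg d α} {T T' : ℕ} (h : Eval f ω n a n₁ T) (hT : T ≤ T') :
    Eval f ω n a n₁ T' := fun t => by
  obtain ⟨t', h1, h2⟩ := h t
  exact ⟨t', h1.trans hT, h2⟩

theorem Eval.bind {f : Alg d α} {g : α → Alg d β} {T₁ T₂ : ℕ} (hf : Eval f ω n a n₁ T₁)
    (hg : Eval (g a) ω n₁ b n₂ T₂) : Eval (f >>= g) ω n b n₂ (T₁ + T₂) := fun t => by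
  obtain ⟨t₁, h1, h2⟩ := hf t
  obtain ⟨t₂, h3, h4⟩ := hg (t + t₁)
  refine ⟨t₁ + t₂, by omega, ?_⟩
  change g (f ω (n, t)).1 ω (f ω (n, t)).2 = _
  rw [h2, h4, add_assoc]

theorem Eval.ret (a : α) : Eval (pure a : Alg d α) ω n a n 0 := fun _ => ⟨0, le_rfl, rfl⟩

theorem Eval.tick (k : ℕ) : Eval (Alg.tick k : Alg d Unit) ω n () n k := fun _ => ⟨k, le_rfl, rfl⟩

theorem Eval.tick_ret (k : ℕ) (a : α) :
    Eval (Alg.tick k >>= fun _ => pure a : Alg d α) ω n a n k :=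
  fun _ => ⟨k, le_rfl, rfl⟩

theorem Eval.drawOne : Eval (Alg.drawOne : Alg d _) ω n (ω n) (n + 1) (d + 1) :=
  fun _ => ⟨d + 1, le_rfl, rfl⟩

/-- The `m` examples of the stream `ω` from position `n` on. -/
def batch (ω : ℕ → Example d) (n m : ℕ) : List (Example d) := (List.range m).map fun j => ω (n + j)

@[simp] theorem length_batch (ω : ℕ → Example d) (n m : ℕ) : (batch ω n m).length = m := by
  simp [batch]

theorem Eval.draw (m : ℕ) : ∀ n, Eval (Alg.draw m : Alg d _) ω n (batch ω n m) (n + m)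
    (m * (d + 2)) := by
  induction m with
  | zero => intro n; exact (Eval.ret []).mono (Nat.zero_le _)
  | succ m ih =>
    intro n
    have h := ((Eval.tick (d := d) (ω := ω) (n := n) 1).bind
      (g := fun _ => (do let z ← Alg.drawOne; let zs ← Alg.draw m; return z :: zs : Alg d _))
      (Eval.drawOne.bind ((ih (n + 1)).bind (Eval.ret (ω n :: batch ω (n + 1) m))))).mono
      (T' := (m + 1) * (d + 2)) (by ring_nf; omega)
    have e : batch ω n (m + 1) = ω n :: batch ω (n + 1) m := by
      simp only [batch, List.range_succ_eq_map, List.map_cons, List.map_map, add_zero]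
      congr 2
      funext j
      simp [add_assoc, add_comm 1 j]
    rw [e, show n + (m + 1) = n + 1 + m by ring]
    exact h

theorem Eval.keep {p : α → Alg d Bool} {q : α → Bool} {c : ℕ} : ∀ {l : List α},
    (∀ a ∈ l, Eval (p a) ω n (q a) n c) → Eval (Alg.keep p l) ω n (l.filter q) n
      (l.length * (c + 1))
  | [], _ => (Eval.ret []).mono (Nat.zero_le _)
  | a :: l, h => by
    have h1 := h a (by simp)
    have h2 := Eval.keep (l := l) fun x hx => h x (by simp [hx])
    refine Eval.mono ((Eval.tick 1).bind (h1.bind (h2.bind (?_ : Eval _ ω n _ n 0))))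
      (by simp only [List.length_cons]; ring_nf; omega)
    rw [List.filter_cons]
    exact Eval.ret _

theorem Eval.count {p : α → Alg d Bool} {q : α → Bool} {c : ℕ} : ∀ {l : List α},
    (∀ a ∈ l, Eval (p a) ω n (q a) n c) → Eval (Alg.count p l) ω n (l.countP q) n
      (l.length * (c + 1))
  | [], _ => (Eval.ret 0).mono (Nat.zero_le _)
  | a :: l, h => by
    have h1 := h a (by simp)
    have h2 := Eval.count (l := l) fun x hx => h x (by simp [hx])
    refine Eval.mono ((Eval.tick 1).bind (h1.bind (h2.bind (?_ : Eval _ ω n _ n 0))))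
      (by simp only [List.length_cons]; ring_nf; omega)
    rw [List.countP_cons]
    have : (List.countP q l + if q a = true then 1 else 0)
        = if q a = true then List.countP q l + 1 else List.countP q l := by split_ifs <;> rfl
    rw [this]
    exact Eval.ret _

theorem Eval.each {f : α → Alg d β} {g : α → β} {c : ℕ} : ∀ {l : List α},
    (∀ a ∈ l, Eval (f a) ω n (g a) n c) → Eval (Alg.each f l) ω n (l.map g) n
      (l.length * (c + 1))
  | [], _ => (Eval.ret []).mono (Nat.zero_le _)
  | a :: l, h => by
    have h1 := h a (by simp)
    have h2 := Eval.each (l := l) fun x hx => h x (by simp [hx])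
    refine Eval.mono ((Eval.tick 1).bind (h1.bind (h2.bind (?_ : Eval _ ω n _ n 0))))
      (by simp only [List.length_cons]; ring_nf; omega)
    exact Eval.ret _

theorem Eval.length (l : List α) :
    Eval (Alg.count (fun _ => pure true) l : Alg d ℕ) ω n l.length n l.length := by
  have := Eval.count (d := d) (ω := ω) (n := n) (p := fun _ : α => pure true) (q := fun _ => true)
    (c := 0) (l := l) fun a _ => Eval.ret true
  simpa using this

theorem Eval.fraction {p : α → Alg d Bool} {q : α → Bool} {c : ℕ} {l : List α}
    (h : ∀ a ∈ l, Eval (p a) ω n (q a) n c) :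
    Eval (Alg.fraction p l) ω n ((l.countP q : ℝ) / l.length) n (l.length * (c + 2) + 1) :=
  ((Eval.count h).bind ((Eval.length l).bind (Eval.tick_ret 1 _))).mono
    (by ring_nf; omega)

theorem Eval.dot (x y : Pt d) : Eval (Alg.dot x y) ω n (inner ℝ x y) n (2 * d) :=
  Eval.tick_ret _ _

theorem Eval.axpy (a : ℝ) (x y : Pt d) : Eval (Alg.axpy a x y) ω n (a • x + y) n (2 * d) :=
  Eval.tick_ret _ _

theorem Eval.norm2 (x : Pt d) : Eval (Alg.norm2 x) ω n ‖x‖ n (2 * d + 1) :=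
  Eval.tick_ret _ _

theorem Eval.divide (r : ℝ) (x : Pt d) : Eval (Alg.divide r x) ω n (r⁻¹ • x) n (d + 1) :=
  Eval.tick_ret _ _

theorem Eval.locate : ∀ (p : List (Step d)) (x : Pt d),
    Eval (Alg.locate p x) ω n (regionOf p x) n (p.length * (2 * d + 4))
  | [], _ => (Eval.ret _).mono (Nat.zero_le _)
  | Step.cut i w τ s j :: p, x =>
    ((Eval.locate p x).bind ((Eval.dot w x).bind (Eval.tick_ret 4 _))).mono
      (by simp only [List.length_cons]; ring_nf; omega)
  | Step.merge i j :: p, x =>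
    ((Eval.locate p x).bind (Eval.tick_ret 2 _)).mono
      (by simp only [List.length_cons]; ring_nf; omega)

/-- The examples of a batch that fall into a region. -/
noncomputable def batchIn (ω : ℕ → Example d) (p : List (Step d)) (i n m : ℕ) :
    List (Example d) :=
  (batch ω n m).filter fun z => decide (regionOf p z.1 = i)

theorem length_batchIn_le (ω : ℕ → Example d) (p : List (Step d)) (i n m : ℕ) :
    (batchIn ω p i n m).length ≤ m :=
  (List.length_filter_le _ _).trans (by simp)

theorem Eval.drawIn (p : List (Step d)) (i m : ℕ) :
    Eval (Alg.drawIn p i m) ω n (batchIn ω p i n m) (n + m)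
      (m * (p.length * (2 * d + 4) + d + 4)) :=
  ((Eval.draw m n).bind (Eval.keep fun z _ =>
    (Eval.locate p z.1).bind (Eval.tick_ret 1 _))).mono
    (by simp only [length_batch]; ring_nf; omega)

/-- The fraction of the labels in a list that differ from `s`. -/
noncomputable def errFrac (s : Bool) (Y : List Bool) : ℝ :=
  (Y.countP fun y => decide (y ≠ s) : ℝ) / Y.length

theorem Eval.constErr (s : Bool) (Y : List Bool) :
    Eval (Alg.constErr s Y : Alg d ℝ) ω n (errFrac s Y) n (Y.length * 3 + 1) :=
  Eval.fraction fun _ _ => Eval.tick_ret 1 _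

/-- The projection of a vector to the unit ball. -/
noncomputable def clip (v : Pt d) : Pt d := if 1 < ‖v‖ then ‖v‖⁻¹ • v else v

theorem Eval.project (v : Pt d) : Eval (Alg.project v) ω n (clip v) n (3 * d + 3) := by
  refine ((Eval.norm2 v).bind ((Eval.tick 1).bind (?_ : Eval _ ω n _ n (d + 1)))).mono
    (by omega)
  unfold clip
  split_ifs
  · exact Eval.divide _ _
  · exact (Eval.ret _).mono (Nat.zero_le _)

/-- One step of projected SGD on a pair (iterate, sum of the earlier iterates). -/
noncomputable def sgdStep (lam ν : ℝ) (s : Pt d × Pt d) (z : Example d) : Pt d × Pt d :=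
  (clip ((ν * (if 0 ≤ -(lab z.2 * inner ℝ s.1 z.1) then 1 - lam else lam) * lab z.2) • z.1 + s.1),
    (1 : ℝ) • s.1 + s.2)

theorem Eval.sgdLoop (lam ν : ℝ) : ∀ (S : List (Example d)) (w acc : Pt d),
    Eval (Alg.sgdLoop lam ν S w acc) ω n (S.foldl (sgdStep lam ν) (w, acc)).2 n
      (S.length * (9 * d + 11))
  | [], _, _ => (Eval.ret _).mono (Nat.zero_le _)
  | z :: zs, w, acc =>
    ((Eval.axpy 1 w acc).bind ((Eval.dot w z.1).bind ((Eval.tick 8).bind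
      ((Eval.axpy _ z.1 w).bind (Eval.bind (g := fun w' => Alg.sgdLoop lam ν zs w' _)
        (Eval.project _) (Eval.sgdLoop lam ν zs _ _)))))).mono
      (by simp only [List.length_cons]; ring_nf; omega)

/-- The direction found by SGD: the normalized sum of the iterates (or zero). -/
noncomputable def sgdDir (lam ν : ℝ) (S : List (Example d)) : Pt d :=
  ‖(S.foldl (sgdStep lam ν) (0, 0)).2‖⁻¹ • (S.foldl (sgdStep lam ν) (0, 0)).2

theorem Eval.sgd (lam ν : ℝ) (S : List (Example d)) :
    Eval (Alg.sgd lam ν S) ω n (sgdDir lam ν S) n (S.length * (9 * d + 11) + 5 * d + 3) := by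
  refine ((Eval.tick (2 * d)).bind ((Eval.sgdLoop lam ν S 0 0).bind ((Eval.norm2 _).bind
    ((Eval.tick 1).bind (?_ : Eval _ ω n _ n (d + 1)))))).mono (by omega)
  unfold sgdDir
  split_ifs with h
  · rw [h, norm_eq_zero.1 h]
    simpa using (Eval.ret (0 : Pt d)).mono (Nat.zero_le _)
  · exact Eval.divide _ _

/-- The projected examples in the annulus of threshold `τ`. -/
noncomputable def annulus (M : List (ℝ × Bool)) (τ : ℝ) : List (ℝ × Bool) :=
  M.filter fun a => decide (τ ≤ |a.1|)

/-- The empirical error of the sign on the annulus of threshold `τ`. -/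
noncomputable def annulusErr (M : List (ℝ × Bool)) (τ : ℝ) : ℝ :=
  ((annulus M τ).countP fun a => decide (lab a.2 * a.1 < 0) : ℝ) / (annulus M τ).length

/-- The test that a threshold has to pass. -/
def Admissible (P : Params) (lam : ℝ) (M : List (ℝ × Bool)) (τ : ℝ) : Prop :=
  0 < τ ∧ P.ε * P.slack ≤ 9 * P.L * lam * (((annulus M τ).length : ℝ) / M.length)

/-- `c` is a candidate obtained from the direction `w`, the leakage parameter `lam` and the
projected examples `M`. -/
def IsCand (P : Params) (w : Pt d) (lam : ℝ) (M : List (ℝ × Bool)) (ts : List ℝ) (c : Cand d) :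
    Prop :=
  ∃ τ ∈ ts, Admissible P lam M τ ∧ c = ⟨w, τ, lam, annulusErr M τ⟩

open Classical in
/-- The candidate that survives the comparison of `best` with the threshold `τ`. -/
noncomputable def improve (P : Params) (w : Pt d) (lam : ℝ) (M : List (ℝ × Bool)) (τ : ℝ)
    (best : Option (Cand d)) : Option (Cand d) :=
  if Admissible P lam M τ ∧ ∀ c, best = some c → annulusErr M τ < c.err then
    some ⟨w, τ, lam, annulusErr M τ⟩ else best

theorem Eval.scan_cons (P : Params) (w : Pt d) (lam : ℝ) (M : List (ℝ × Bool)) (τ : ℝ)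
    (ts : List ℝ) (best v : Option (Cand d)) {T : ℕ}
    (hv : Eval (Alg.scan P w lam M ts (improve P w lam M τ best)) ω n v n T) :
    Eval (Alg.scan P w lam M (τ :: ts) best) ω n v n (M.length * 9 + 16 + T) := by
  have hA : (annulus M τ).length ≤ M.length := List.length_filter_le _ _
  have key : ∀ b' : Option (Cand d), b' = improve P w lam M τ best →
      Eval (Alg.tick 15 >>= fun _ => Alg.scan P w lam M ts b') ω n v n (15 + T) := by
    rintro _ rfl
    exact (Eval.tick 15).bind hv
  have h1 : Eval (Alg.keep (fun a : ℝ × Bool => do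
      Alg.tick 2
      return decide (τ ≤ |a.1|)) M : Alg d _) ω n (annulus M τ) n (M.length * 3) :=
    Eval.keep fun a _ => Eval.tick_ret 2 _
  have h2 : Eval (Alg.fraction (fun a : ℝ × Bool => do
      Alg.tick 2
      return decide (lab a.2 * a.1 < 0)) (annulus M τ) : Alg d _) ω n (annulusErr M τ) n
      ((annulus M τ).length * 4 + 1) :=
    Eval.fraction fun a _ => Eval.tick_ret 2 _
  rw [Alg.scan]
  refine Eval.mono (h1.bind ((Eval.length M).bind ((Eval.length _).bind (h2.bind
    (key _ ?_))))) (by omega)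
  have hadm : Admissible P lam M τ ↔ (0 < τ ∧ P.ε * P.slack ≤
      9 * P.L * lam * (((annulus M τ).length : ℝ) / M.length)) := Iff.rfl
  cases best with
  | none => simp [improve, hadm]
  | some c => simp [improve, hadm]

/-- The scan returns the better of the candidate `best` and the best admissible threshold. -/
theorem Eval.scan (P : Params) (w : Pt d) (lam : ℝ) (M : List (ℝ × Bool)) :
    ∀ (ts : List ℝ) (best : Option (Cand d)), ∃ v,
      Eval (Alg.scan P w lam M ts best) ω n v n (ts.length * (M.length * 9 + 16)) ∧
      (∀ c, v = some c → best = some c ∨ IsCand P w lam M ts c) ∧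
      (∀ c, best = some c → ∃ c', v = some c' ∧ c'.err ≤ c.err) ∧
      ∀ τ ∈ ts, Admissible P lam M τ → ∃ c', v = some c' ∧ c'.err ≤ annulusErr M τ
  | [], best => ⟨best, (Eval.ret _).mono (Nat.zero_le _), fun _ h => Or.inl h,
      fun c h => ⟨c, h, le_rfl⟩, by simp⟩
  | τ :: ts, best => by
    obtain ⟨v, hv, h1, h2, h3⟩ := Eval.scan P w lam M ts (improve P w lam M τ best)
    have key : ∃ c, improve P w lam M τ best = some c ∧
        (∀ c', best = some c' → c.err ≤ c'.err) ∧
        (Admissible P lam M τ → c.err ≤ annulusErr M τ) ∨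
        improve P w lam M τ best = none ∧ best = none ∧ ¬ Admissible P lam M τ := by
      unfold improve
      split_ifs with h
      · exact ⟨_, Or.inl ⟨rfl, fun c' hc' => (h.2 c' hc').le, fun _ => le_rfl⟩⟩
      · cases best with
        | none => exact ⟨⟨w, τ, lam, 0⟩, Or.inr ⟨rfl, rfl, fun ha => h ⟨ha, by simp⟩⟩⟩
        | some c =>
          refine ⟨c, Or.inl ⟨rfl, fun c' hc' => by rw [Option.some.inj hc'], fun ha => ?_⟩⟩
          by_contra hlt
          exact h ⟨ha, fun c' hc' => by rw [← Option.some.inj hc']; exact not_le.1 hlt⟩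
    refine ⟨v, ?_, ?_, ?_, ?_⟩
    · refine (Eval.scan_cons P w lam M τ ts best v hv).mono ?_
      simp only [List.length_cons]
      ring_nf
      omega
    · intro c hc
      rcases h1 c hc with h | ⟨τ', h', h''⟩
      · unfold improve at h
        split_ifs at h with hif
        · exact Or.inr ⟨τ, by simp, hif.1, (Option.some.inj h).symm⟩
        · exact Or.inl h
      · exact Or.inr ⟨τ', by simp [h'], h''⟩
    · intro c hc
      obtain ⟨c₀, ⟨h4, h5, -⟩ | ⟨-, h4, -⟩⟩ := key
      · obtain ⟨c', h6, h7⟩ := h2 c₀ h4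
        exact ⟨c', h6, h7.trans (h5 c hc)⟩
      · simp [hc] at h4
    · intro τ' hτ' hadm
      rcases List.mem_cons.1 hτ' with rfl | hmem
      · obtain ⟨c₀, ⟨h4, -, h5⟩ | ⟨-, -, h4⟩⟩ := key
        · obtain ⟨c', h6, h7⟩ := h2 c₀ h4
          exact ⟨c', h6, h7.trans (h5 hadm)⟩
        · exact absurd hadm h4
      · exact h3 τ' hmem hadm

/-- The projections to a direction `w` of the examples in a list. -/
noncomputable def proj (w : Pt d) (S : List (Example d)) : List (ℝ × Bool) :=
  S.map fun z => (inner ℝ w z.1, z.2)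

/-- The absolute values of the projections to a direction `w`. -/
noncomputable def absProj (w : Pt d) (S : List (Example d)) : List ℝ :=
  (proj w S).map fun a => |a.1|

/-- The direction found by SGD with the examples of the batch at position `n` that fall into
region `i`. -/
noncomputable def dirAt (K : Constants) (P : Params) (ω : ℕ → Example d) (p : List (Step d))
    (i : ℕ) (lam : ℝ) (n : ℕ) : Pt d :=
  sgdDir lam (1 / Real.sqrt (P.batch K)) (batchIn ω p i n (P.batch K))

/-- The search returns a candidate whose empirical error is minimal among all admissible thresholds for
all directions, if there is one.  The batches of SGD are used in decreasing order of the
leakage parameter. -/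
theorem Eval.search (K : Constants) (P : Params) (p : List (Step d)) (i : ℕ)
    (S : List (Example d)) (hS : S.length ≤ P.batch K) : ∀ (g n : ℕ) (best : Option (Cand d)), ∃ v,
      Eval (Alg.search K P p i S g best) ω n v (n + g * P.batch K)
        (g * (P.batch K * (p.length * (2 * d + 4) + 12 * d + 50 + P.batch K * 9) + 5 * d + 8)) ∧
      (∀ c, v = some c → best = some c ∨ ∃ k < g,
        let w := dirAt K P ω p i (P.ε / 4 * k) (n + (g - 1 - k) * P.batch K)
        IsCand P w (P.ε / 4 * k) (proj w S) (absProj w S) c) ∧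
      (∀ c, best = some c → ∃ c', v = some c' ∧ c'.err ≤ c.err) ∧
      ∀ k < g, let w := dirAt K P ω p i (P.ε / 4 * k) (n + (g - 1 - k) * P.batch K)
        ∀ τ ∈ absProj w S, Admissible P (P.ε / 4 * k) (proj w S) τ →
          ∃ c', v = some c' ∧ c'.err ≤ annulusErr (proj w S) τ
  | 0, n, best => ⟨best, by
      rw [zero_mul, zero_mul]; exact Eval.ret best, fun _ h => Or.inl h,
      fun c h => ⟨c, h, le_rfl⟩, by simp⟩
  | g + 1, n, best => by
    set m := P.batch K with hm
    set w := dirAt K P ω p i (P.ε / 4 * g) n with hw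
    obtain ⟨b', hb', h1, h2, h3⟩ := Eval.scan (ω := ω) (n := n + m) P w (P.ε / 4 * g) (proj w S)
      (absProj w S) best
    obtain ⟨v, hv, h4, h5, h6⟩ := Eval.search K P p i S hS g (n + m) b'
    have hlen : (batchIn ω p i n m).length ≤ m := length_batchIn_le _ _ _ _ _
    have hshift : ∀ k < g, n + m + (g - 1 - k) * m = n + (g + 1 - 1 - k) * m := by
      intro k hk
      have : g + 1 - 1 - k = (g - 1 - k) + 1 := by omega
      rw [this]; ring
    refine ⟨v, ?_, ?_, ?_, ?_⟩
    · have hE : Eval (Alg.search K P p i S (g + 1) best) ω n v (n + m + g * m) _ :=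
        ((Eval.tick 5).bind ((Eval.drawIn p i m).bind ((Eval.sgd _ _ _).bind
        ((Eval.each (c := 2 * d) (g := fun z : Example d => ((inner ℝ w z.1 : ℝ), z.2))
          fun z _ => Eval.bind (g := fun a => pure (a, z.2)) (Eval.dot _ _) (Eval.ret _)).bind
        ((Eval.each (c := 1) (g := fun a : ℝ × Bool => |a.1|) fun a _ =>
          Eval.tick_ret 1 _).bind (hb'.bind hv))))))
      rw [show n + (g + 1) * m = n + m + g * m by ring]
      refine hE.mono ?_
      simp only [absProj, proj, List.length_map]
      have e1 : (batchIn ω p i n m).length * (9 * d + 11) ≤ m * (9 * d + 11) :=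
        Nat.mul_le_mul_right _ hlen
      have e2 : S.length * (2 * d + 1) ≤ m * (2 * d + 1) := Nat.mul_le_mul_right _ hS
      have e3 : S.length * (S.length * 9 + 16) ≤ m * (m * 9 + 16) := by gcongr
      rw [Nat.add_mul g 1]
      generalize g * (m * (p.length * (2 * d + 4) + 12 * d + 50 + m * 9) + 5 * d + 8) = X
      ring_nf at e1 e2 e3 ⊢
      omega
    · intro c hc
      rcases h4 c hc with h | ⟨k, hk, h⟩
      · rcases h1 c h with h | h
        · exact Or.inl h
        · refine Or.inr ⟨g, Nat.lt_succ_self g, ?_⟩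
          simpa [← hw] using h
      · refine Or.inr ⟨k, by omega, ?_⟩
        rw [hshift k hk] at h
        exact h
    · intro c hc
      obtain ⟨c', h7, h8⟩ := h2 c hc
      obtain ⟨c'', h9, h10⟩ := h5 c' h7
      exact ⟨c'', h9, h10.trans h8⟩
    · intro k hk
      rcases Nat.lt_succ_iff_lt_or_eq.1 hk with hlt | rfl
      · rw [← hshift k hlt]
        exact h6 k hlt
      · have : n + (k + 1 - 1 - k) * m = n := by simp
        rw [this]
        intro w' τ hτ hadm
        obtain ⟨c', h7, h8⟩ := h3 τ hτ hadm
        obtain ⟨c'', h9, h10⟩ := h5 c' h7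
        exact ⟨c'', h9, h10.trans h8⟩

end Alg

namespace Alg

variable {d : ℕ} {α β : Type} {ω : ℕ → Example d} {n : ℕ}

/-! ### The splitting step -/

/-- The examples of a list on the side `t` of the annulus given by `w` and `τ`. -/
noncomputable def side (S : List (Example d)) (w : Pt d) (τ : ℝ) (t : Bool) : List (Example d) :=
  S.filter fun z => decide (τ ≤ lab t * inner ℝ w z.1)

/-- The fraction of the examples of a list on the side `t` of an annulus. -/
noncomputable def sideMass (S : List (Example d)) (w : Pt d) (τ : ℝ) (t : Bool) : ℝ :=
  (S.countP fun z => decide (τ ≤ lab t * inner ℝ w z.1) : ℝ) / S.length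

/-- The error of the label `t` on the examples of a list on the side `t` of an annulus. -/
noncomputable def sideErr (S : List (Example d)) (w : Pt d) (τ : ℝ) (t : Bool) : ℝ :=
  errFrac t ((side S w τ t).map fun z => z.2)

/-- The side of an annulus that the algorithm tries to split off. -/
noncomputable def chosenSide (K : Constants) (P : Params) (S : List (Example d)) (w : Pt d)
    (τ lam : ℝ) : Bool :=
  if P.ε ^ 2 * P.slack ≤ K.cMass * P.L * lam * min (sideMass S w τ true) (sideMass S w τ false)
  then decide (sideErr S w τ true ≤ sideErr S w τ false)
  else decide (sideMass S w τ false ≤ sideMass S w τ true)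

/-- The position of the batch that SGD reads for the `k`-th leakage parameter, if the splitting
step starts at position `n`. -/
noncomputable def sgdPos (K : Constants) (P : Params) (n k : ℕ) : ℕ :=
  n + 2 * P.batch K + (P.grid - k) * P.batch K

/-- The direction that SGD finds for the `k`-th leakage parameter, if the splitting step starts at
position `n`. -/
noncomputable def sgdOut (K : Constants) (P : Params) (ω : ℕ → Example d) (p : List (Step d))
    (i n k : ℕ) : Pt d :=
  dirAt K P ω p i (P.ε / 4 * k) (sgdPos K P n k)

/-- The examples that determine the thresholds, if the splitting step starts at position `n`. -/
noncomputable def scanList (K : Constants) (P : Params) (ω : ℕ → Example d) (p : List (Step d))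
    (i n : ℕ) : List (Example d) :=
  batchIn ω p i (n + P.batch K) (P.batch K)

/-- The examples that estimate the two sides, if the splitting step starts at position `n`. -/
noncomputable def sideList (K : Constants) (P : Params) (ω : ℕ → Example d) (p : List (Step d))
    (i n : ℕ) : List (Example d) :=
  batchIn ω p i (n + (P.grid + 3) * P.batch K) (P.batch K)

/-- What the splitting step does when it starts at position `n`: `e` is the estimated
error of its label, and `n'` is the final position. -/
def SplitOutcome (K : Constants) (P : Params) (ω : ℕ → Example d) (p : List (Step d)) (i n : ℕ)
    (e : ℝ) (out : Option (Pt d × ℝ × Bool)) (n' : ℕ) : Prop :=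
  (out = none ∧ n' = n + (P.grid + 3) * P.batch K ∧
    ∀ k < P.grid + 1, ∀ τ ∈ absProj (sgdOut K P ω p i n k) (scanList K P ω p i n),
      ¬ Admissible P (P.ε / 4 * k) (proj (sgdOut K P ω p i n k) (scanList K P ω p i n)) τ) ∨
  ∃ k₀ < P.grid + 1, ∃ c : Cand d,
    IsCand P (sgdOut K P ω p i n k₀) (P.ε / 4 * k₀)
      (proj (sgdOut K P ω p i n k₀) (scanList K P ω p i n))
      (absProj (sgdOut K P ω p i n k₀) (scanList K P ω p i n)) c ∧
    (∀ k < P.grid + 1, ∀ τ ∈ absProj (sgdOut K P ω p i n k) (scanList K P ω p i n),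
      Admissible P (P.ε / 4 * k) (proj (sgdOut K P ω p i n k) (scanList K P ω p i n)) τ →
      c.err ≤ annulusErr (proj (sgdOut K P ω p i n k) (scanList K P ω p i n)) τ) ∧
    n' = n + (P.grid + 4) * P.batch K ∧
    let t := chosenSide K P (sideList K P ω p i n) c.w c.τ c.lam
    (sideErr (sideList K P ω p i n) c.w c.τ t ≤ e - P.ε ∧ out = some (c.w, c.τ, t) ∨
      ¬ sideErr (sideList K P ω p i n) c.w c.τ t ≤ e - P.ε ∧ out = none)

/-- The part of the splitting step that follows the search for a candidate. -/
noncomputable def splitTail (K : Constants) (P : Params) (p : List (Step d)) (i : ℕ) (s : Bool)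
    (e : ℝ) : Option (Cand d) → Alg d (Bool × Option (Pt d × ℝ × Bool))
  | none => return (s, none)
  | some c => do
    let S₃ ← drawIn p i (P.batch K)
    let half := fun (t : Bool) (z : Example d) => (do
      let a ← dot c.w z.1
      tick 2
      return decide (c.τ ≤ lab t * a) : Alg d Bool)
    let H₁ ← keep (half true) S₃
    let H₂ ← keep (half false) S₃
    let m₁ ← fraction (half true) S₃
    let m₂ ← fraction (half false) S₃
    let Y₂ ← each (fun z => pure z.2) H₁
    let Y₃ ← each (fun z => pure z.2) H₂
    let e₁ ← constErr true Y₂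
    let e₂ ← constErr false Y₃
    tick 15
    let t : Bool :=
      if P.ε ^ 2 * P.slack ≤ K.cMass * P.L * c.lam * min m₁ m₂ then decide (e₁ ≤ e₂)
      else decide (m₂ ≤ m₁)
    if (if t then e₁ else e₂) ≤ e - P.ε then
      return (s, some (c.w, c.τ, t))
    else
      return (s, none)

theorem split_eq (K : Constants) (P : Params) (p : List (Step d)) (i : ℕ) (s₀ : Bool) :
    Alg.split K P p i s₀ = (do
      let S₁ ← drawIn p i (P.batch K)
      let Y₁ ← each (fun z => pure z.2) S₁
      let e₀ ← constErr s₀ Y₁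
      tick 3
      let S₂ ← drawIn p i (P.batch K)
      let best ← search K P p i S₂ (P.grid + 1) none
      splitTail K P p i (if 1 / 2 < e₀ then !s₀ else s₀) (if 1 / 2 < e₀ then 1 - e₀ else e₀) best :
        Alg d _) := by
  rfl

theorem split_cost (m Λ d g T : ℕ)
    (hT : T ≤ m * (Λ * (2 * d + 4) + d + 4) + 2 * (m * (2 * d + 3)) + 2 * (m * (2 * d + 4) + 1) +
      2 * m + 2 * (m * 3 + 1) + 15) :
    m * (Λ * (2 * d + 4) + d + 4) + (m + (m * 3 + 1 + (3 + (m * (Λ * (2 * d + 4) + d + 4) +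
      ((g + 1) * (m * (Λ * (2 * d + 4) + 12 * d + 50 + m * 9) + 5 * d + 8) + T))))) ≤
    (g + 4) * (m * (Λ * (2 * d + 4) + 12 * d + 80 + m * 9) + 5 * d + 40) := by
  obtain ⟨Q, hQ⟩ : ∃ Q, Q = Λ * (2 * d + 4) := ⟨_, rfl⟩
  rw [← hQ] at hT ⊢
  zify at hT ⊢
  have h1 : (0 : ℤ) ≤ (g : ℤ) * m := by positivity
  have h2 : (0 : ℤ) ≤ (m : ℤ) * Q := by positivity
  have h3 : (0 : ℤ) ≤ (m : ℤ) * d := by positivity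
  have h4 : (0 : ℤ) ≤ (m : ℤ) * m := by positivity
  have h5 : (0 : ℤ) ≤ (g : ℤ) := by positivity
  have h6 : (0 : ℤ) ≤ (m : ℤ) := by positivity
  have h7 : (0 : ℤ) ≤ (d : ℤ) := by positivity
  linarith

theorem Eval.split (K : Constants) (P : Params) (p : List (Step d)) (i : ℕ) (s₀ : Bool) {Λ : ℕ}
    (hp : p.length ≤ Λ) : ∃ s e out n',
      Eval (Alg.split K P p i s₀) ω n (s, out) n'
        ((P.grid + 4) * (P.batch K * (Λ * (2 * d + 4) + 12 * d + 80 + P.batch K * 9) + 5 * d + 40)) ∧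
      SplitOutcome K P ω p i n e out n' ∧ e ≤ 1 / 2 ∧
      (e = errFrac s ((batchIn ω p i n (P.batch K)).map fun z => z.2) ∨
        e = 1 - errFrac (!s) ((batchIn ω p i n (P.batch K)).map fun z => z.2)) := by
  set m := P.batch K with hm
  set Y := (batchIn ω p i n m).map fun z => z.2 with hY
  set e₀ := errFrac s₀ Y with he₀
  set s := if 1 / 2 < e₀ then !s₀ else s₀ with hs
  set e := if 1 / 2 < e₀ then 1 - e₀ else e₀ with he
  set S₂ := scanList K P ω p i n with hS₂
  set S₃ := sideList K P ω p i n with hS₃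
  have len : ∀ n', (batchIn ω p i n' m).length ≤ m := fun n' => length_batchIn_le _ _ _ _ _
  obtain ⟨v, hv, h1, -, h3⟩ := Eval.search (ω := ω) K P p i S₂ (len _) (P.grid + 1)
    (n + m + m) none
  have hpos : ∀ k : ℕ, n + m + m + (P.grid + 1 - 1 - k) * m = sgdPos K P n k := by
    intro k; simp only [sgdPos, ← hm, Nat.add_sub_cancel]; ring
  have hdir : ∀ k : ℕ, dirAt K P ω p i (P.ε / 4 * k) (n + m + m + (P.grid + 1 - 1 - k) * m) =
      sgdOut K P ω p i n k := fun k => by rw [hpos]; rfl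
  simp only [← hm, hdir] at h1 h3
  have d1 : Eval (Alg.drawIn p i m) ω n (batchIn ω p i n m) (n + m)
      (m * (Λ * (2 * d + 4) + d + 4)) := (Eval.drawIn p i m).mono (by gcongr)
  have d2 : Eval (Alg.each (fun z : Example d => pure z.2) (batchIn ω p i n m) : Alg d _) ω (n + m)
      Y (n + m) m :=
    (Eval.each (c := 0) fun z _ => Eval.ret z.2).mono (by simpa using len n)
  have d3 : Eval (Alg.constErr s₀ Y : Alg d ℝ) ω (n + m) e₀ (n + m) (m * 3 + 1) :=
    (Eval.constErr s₀ Y).mono (by have := len n; simp only [hY, List.length_map]; omega)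
  have d4 : Eval (Alg.drawIn p i m) ω (n + m) S₂ (n + m + m)
      (m * (Λ * (2 * d + 4) + d + 4)) := (Eval.drawIn p i m).mono (by gcongr)
  have d5 : Eval (Alg.search K P p i S₂ (P.grid + 1) none) ω (n + m + m) v
      (n + (P.grid + 3) * m)
      ((P.grid + 1) * (m * (Λ * (2 * d + 4) + 12 * d + 50 + m * 9) + 5 * d + 8)) := by
    rw [show n + (P.grid + 3) * m = n + m + m + (P.grid + 1) * m by ring]
    exact hv.mono (by gcongr)
  have hE : ∀ (out : Option (Pt d × ℝ × Bool)) (n' T : ℕ),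
      Eval (splitTail K P p i s e v) ω (n + (P.grid + 3) * m)
        (s, out) n' T →
      T ≤ m * (Λ * (2 * d + 4) + d + 4) + 2 * (m * (2 * d + 3)) + 2 * (m * (2 * d + 4) + 1) + 2 * m +
        2 * (m * 3 + 1) + 15 →
      Eval (Alg.split K P p i s₀) ω n (s, out) n'
        ((P.grid + 4) * (m * (Λ * (2 * d + 4) + 12 * d + 80 + m * 9) + 5 * d + 40)) := by
    intro out n' T h hT
    rw [split_eq]
    refine Eval.mono (d1.bind (d2.bind (d3.bind ((Eval.tick 3).bind (d4.bind (d5.bind h)))))) ?_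
    exact split_cost m Λ d P.grid T hT
  have hes : e ≤ 1 / 2 ∧ (e = errFrac s Y ∨ e = 1 - errFrac (!s) Y) := by
    rw [he, hs]
    split_ifs with h
    · exact ⟨by linarith, Or.inr (by rw [he₀, Bool.not_not])⟩
    · exact ⟨not_lt.1 h, Or.inl he₀⟩
  cases hvv : v with
  | none =>
    refine ⟨s, e, none, _, hE none _ 0 (by rw [hvv]; exact Eval.ret _) (Nat.zero_le _), Or.inl
      ⟨rfl, rfl, fun k hk τ hτ hadm => ?_⟩, hes⟩
    obtain ⟨c', h4, -⟩ := h3 k hk τ hτ hadm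
    simp [hvv] at h4
  | some c =>
    have hhalf : ∀ (t : Bool) (z : Example d), Eval (do
          let a ← Alg.dot c.w z.1
          Alg.tick 2
          return decide (c.τ ≤ lab t * a) : Alg d Bool) ω (n + (P.grid + 4) * m)
          (decide (c.τ ≤ lab t * inner ℝ c.w z.1)) (n + (P.grid + 4) * m) (2 * d + 2) :=
      fun t z => (Eval.dot c.w z.1).bind (Eval.tick_ret 2 _)
    have lenS : S₃.length ≤ m := len _
    have f0 : Eval (Alg.drawIn p i m) ω (n + (P.grid + 3) * m) S₃ (n + (P.grid + 4) * m)
        (m * (Λ * (2 * d + 4) + d + 4)) := by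
      rw [show n + (P.grid + 4) * m = n + (P.grid + 3) * m + m by ring]
      exact (Eval.drawIn p i m).mono (by gcongr)
    have f1 : ∀ t, Eval (Alg.keep (fun z => (do
          let a ← Alg.dot c.w z.1
          Alg.tick 2
          return decide (c.τ ≤ lab t * a) : Alg d Bool)) S₃) ω (n + (P.grid + 4) * m)
          (side S₃ c.w c.τ t) (n + (P.grid + 4) * m) (m * (2 * d + 3)) := fun t =>
      (Eval.keep fun z _ => hhalf t z).mono (Nat.mul_le_mul_right _ lenS)
    have f2 : ∀ t, Eval (Alg.fraction (fun z => (do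
          let a ← Alg.dot c.w z.1
          Alg.tick 2
          return decide (c.τ ≤ lab t * a) : Alg d Bool)) S₃) ω (n + (P.grid + 4) * m)
          (sideMass S₃ c.w c.τ t) (n + (P.grid + 4) * m) (m * (2 * d + 4) + 1) := fun t =>
      (Eval.fraction fun z _ => hhalf t z).mono
        (Nat.add_le_add_right (Nat.mul_le_mul_right _ lenS) 1)
    have lside : ∀ t, (side S₃ c.w c.τ t).length ≤ m := fun t =>
      (List.length_filter_le _ _).trans lenS
    have f3 : ∀ t, Eval (Alg.each (fun z : Example d => pure z.2) (side S₃ c.w c.τ t) : Alg d _) ω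
        (n + (P.grid + 4) * m) ((side S₃ c.w c.τ t).map fun z => z.2)
        (n + (P.grid + 4) * m) m := fun t =>
      (Eval.each (c := 0) fun z _ => Eval.ret z.2).mono (by simpa using lside t)
    have f4 : ∀ t, Eval (Alg.constErr t ((side S₃ c.w c.τ t).map fun z => z.2) : Alg d ℝ) ω
        (n + (P.grid + 4) * m) (sideErr S₃ c.w c.τ t) (n + (P.grid + 4) * m) (m * 3 + 1) :=
      fun t => (Eval.constErr t _).mono
        (by have := lside t; simp only [List.length_map]; omega)
    have f5 : ∃ out, Eval (if (if chosenSide K P S₃ c.w c.τ c.lam then sideErr S₃ c.w c.τ true else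
          sideErr S₃ c.w c.τ false) ≤ e - P.ε then
            return (s, some (c.w, c.τ, chosenSide K P S₃ c.w c.τ c.lam))
          else
            return (s, none) : Alg d (Bool × Option (Pt d × ℝ × Bool))) ω
          (n + (P.grid + 4) * m) (s, out) (n + (P.grid + 4) * m) 0 ∧
        (sideErr S₃ c.w c.τ (chosenSide K P S₃ c.w c.τ c.lam) ≤ e - P.ε ∧
          out = some (c.w, c.τ, chosenSide K P S₃ c.w c.τ c.lam) ∨
        ¬ sideErr S₃ c.w c.τ (chosenSide K P S₃ c.w c.τ c.lam) ≤ e - P.ε ∧ out = none) := by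
      have : (if chosenSide K P S₃ c.w c.τ c.lam then sideErr S₃ c.w c.τ true else
          sideErr S₃ c.w c.τ false) = sideErr S₃ c.w c.τ (chosenSide K P S₃ c.w c.τ c.lam) := by
        cases chosenSide K P S₃ c.w c.τ c.lam <;> simp
      rw [this]
      split_ifs with h
      · exact ⟨_, Eval.ret _, Or.inl ⟨h, rfl⟩⟩
      · exact ⟨_, Eval.ret _, Or.inr ⟨h, rfl⟩⟩
    obtain ⟨out, hout, hcase⟩ := f5
    have h6 : Eval (splitTail K P p i s e (some c)) ω (n + (P.grid + 3) * m) (s, out)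
        (n + (P.grid + 4) * m) _ :=
      f0.bind ((f1 true).bind ((f1 false).bind ((f2 true).bind ((f2 false).bind
        ((f3 true).bind ((f3 false).bind ((f4 true).bind ((f4 false).bind
          ((Eval.tick 15).bind hout)))))))))
    refine ⟨s, e, out, n + (P.grid + 4) * m, hE out _ _ (by rw [hvv]; exact h6) (by omega),
      Or.inr ?_, hes⟩
    rcases h1 c hvv with h | ⟨k, hk, h⟩
    · simp at h
    · refine ⟨k, hk, c, h, fun k' hk' τ hτ hadm => ?_, rfl, hcase⟩
      obtain ⟨c', h7, h8⟩ := h3 k' hk' τ hτ hadm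
      rw [hvv] at h7
      rwa [Option.some.inj h7]

/-! ### The merging step -/

/-- The estimated error of the label of region `i`, on the batch at position `n`. -/
noncomputable def liveErr (K : Constants) (P : Params) (ω : ℕ → Example d) (h : Classifier d)
    (n i : ℕ) : ℝ :=
  errFrac (h.label i) ((((batch ω n (P.batch K)).map fun z => (regionOf h.steps z.1, z.2)).filter
    fun a => decide (a.1 = i)).map fun a => a.2)

theorem Eval.findMate (υ : ℝ) (a : ℕ × Bool × ℝ) : ∀ l : List (ℕ × Bool × ℝ), ∃ o,
    Eval (Alg.findMate υ a l : Alg d _) ω n o n (l.length * 6) ∧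
    ((o = none ∧ ∀ b ∈ l, ¬ (b.2.1 = a.2.1 ∧ |a.2.2 - b.2.2| ≤ υ)) ∨
      ∃ b ∈ l, o = some b.1 ∧ b.2.1 = a.2.1 ∧ |a.2.2 - b.2.2| ≤ υ)
  | [] => ⟨none, (Eval.ret _).mono (Nat.zero_le _), Or.inl ⟨rfl, by simp⟩⟩
  | b :: l => by
    obtain ⟨o, h1, h2⟩ := Eval.findMate υ a l
    by_cases hb : b.2.1 = a.2.1 ∧ |a.2.2 - b.2.2| ≤ υ
    · refine ⟨some b.1, ?_, Or.inr ⟨b, by simp, rfl, hb⟩⟩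
      have h3 : Eval (if b.2.1 = a.2.1 ∧ |a.2.2 - b.2.2| ≤ υ then return some b.1 else
          Alg.findMate υ a l : Alg d _) ω n (some b.1) n 0 := by
        rw [if_pos hb]; exact Eval.ret _
      exact ((Eval.tick 6).bind h3).mono (by simp only [List.length_cons]; omega)
    · have h3 : Eval (if b.2.1 = a.2.1 ∧ |a.2.2 - b.2.2| ≤ υ then return some b.1 else
          Alg.findMate υ a l : Alg d _) ω n o n (l.length * 6) := by
        rw [if_neg hb]; exact h1
      refine ⟨o, ((Eval.tick 6).bind h3).mono (by simp only [List.length_cons]; omega), ?_⟩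
      rcases h2 with ⟨h4, h5⟩ | ⟨b', h4, h5⟩
      · refine Or.inl ⟨h4, fun b' hb' => ?_⟩
        rcases List.mem_cons.1 hb' with rfl | hb'
        · exact hb
        · exact h5 b' hb'
      · exact Or.inr ⟨b', by simp [h4], h5⟩

theorem Eval.findPair (υ : ℝ) : ∀ l : List (ℕ × Bool × ℝ), ∃ o,
    Eval (Alg.findPair υ l : Alg d _) ω n o n (l.length * (l.length * 6 + 1)) ∧
    ((o = none ∧ l.Pairwise fun a b => ¬ (b.2.1 = a.2.1 ∧ |a.2.2 - b.2.2| ≤ υ)) ∨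
      ∃ a b, [a, b].Sublist l ∧ o = some (a.1, b.1) ∧ b.2.1 = a.2.1 ∧ |a.2.2 - b.2.2| ≤ υ)
  | [] => ⟨none, (Eval.ret _).mono (Nat.zero_le _), Or.inl ⟨rfl, by simp⟩⟩
  | a :: l => by
    obtain ⟨o, h1, h2⟩ := Eval.findMate (ω := ω) (n := n) υ a l
    obtain ⟨o', h3, h4⟩ := Eval.findPair υ l
    rcases h2 with ⟨rfl, h5⟩ | ⟨b, hb, rfl, h5⟩
    · refine ⟨o', ((Eval.tick 1).bind (h1.bind h3)).mono ?_, ?_⟩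
      · simp only [List.length_cons]; ring_nf; omega
      · rcases h4 with ⟨rfl, h6⟩ | ⟨a', b', h6, h7⟩
        · exact Or.inl ⟨rfl, List.pairwise_cons.2 ⟨h5, h6⟩⟩
        · exact Or.inr ⟨a', b', h6.trans (List.sublist_cons_self _ _), h7⟩
    · refine ⟨some (a.1, b.1), ((Eval.tick 1).bind (h1.bind (?_ : Eval _ ω n _ n 0))).mono ?_,
        Or.inr ⟨a, b, ?_, rfl, h5⟩⟩
      · exact Eval.ret _
      · simp only [List.length_cons]; ring_nf; omega
      · exact List.Sublist.cons_cons a (List.singleton_sublist.2 hb)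

/-- What the merging step does when it starts at position `n`. -/
def MergeOutcome (K : Constants) (P : Params) (ω : ℕ → Example d) (h : Hyp d) (n : ℕ)
    (h' : Hyp d) : Prop :=
  (h' = h ∧ h.live.Pairwise fun i j => ¬ (h.cls.label j = h.cls.label i ∧
    |liveErr K P ω h.cls n i - liveErr K P ω h.cls n j| ≤ P.coarse K)) ∨
  ∃ i j, [i, j].Sublist h.live ∧ h.cls.label j = h.cls.label i ∧
    |liveErr K P ω h.cls n i - liveErr K P ω h.cls n j| ≤ P.coarse K ∧
    h' = { h with
      cls := { h.cls with steps := Step.merge i j :: h.cls.steps }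
      live := h.live.erase j }

theorem Eval.merge (K : Constants) (P : Params) (h : Hyp d) {Λ : ℕ} (hp : h.cls.steps.length ≤ Λ)
    (hl : h.live.length ≤ Λ) : ∃ h', Eval (Alg.merge K P h) ω n h' (n + P.batch K)
      (P.batch K * (Λ * (2 * d + 4) + d + 3) + Λ * (P.batch K * 6 + Λ * 6 + 5) + 2) ∧
      MergeOutcome K P ω h n h' := by
  set m := P.batch K with hm
  set E : List (ℕ × Bool × ℝ) :=
    h.live.map fun i => (i, h.cls.label i, liveErr K P ω h.cls n i) with hEdef
  obtain ⟨o, h1, h2⟩ := Eval.findPair (d := d) (ω := ω) (n := n + m) (P.coarse K) E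
  have d1 : Eval (Alg.draw m : Alg d _) ω n (batch ω n m) (n + m) (m * (d + 2)) := Eval.draw m n
  have d2 : Eval (Alg.each (fun z : Example d => do
      let r ← Alg.locate h.cls.steps z.1
      return (r, z.2)) (batch ω n m)) ω (n + m)
      ((batch ω n m).map fun z => (regionOf h.cls.steps z.1, z.2)) (n + m)
      (m * (Λ * (2 * d + 4) + 1)) :=
    (Eval.each (c := h.cls.steps.length * (2 * d + 4))
      fun z _ => Eval.bind (g := fun r => pure (r, z.2)) (Eval.locate h.cls.steps z.1)
        (Eval.ret _)).mono (by rw [length_batch]; gcongr)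
  set R := (batch ω n m).map fun z => (regionOf h.cls.steps z.1, z.2) with hR
  have hRl : R.length = m := by simp [hR]
  have hfl : ∀ i : ℕ, (R.filter fun a => decide (a.1 = i)).length ≤ m := fun i =>
    (List.length_filter_le _ _).trans hRl.le
  have d3 : Eval (Alg.each (fun i : ℕ => do
    let A ← Alg.keep (fun a : ℕ × Bool => do
      Alg.tick 1
      return decide (a.1 = i)) R
    let Y ← Alg.each (fun a => pure a.2) A
    Alg.tick 1
    let e ← Alg.constErr (h.cls.label i) Y
    return (i, h.cls.label i, e)) h.live : Alg d _) ω (n + m) E (n + m)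
      (Λ * (m * 6 + 3)) := by
    refine (Eval.each (c := m * 6 + 2) fun i _ => ?_).mono (by gcongr)
    refine Eval.mono ((Eval.keep (c := 1) (q := fun a : ℕ × Bool => decide (a.1 = i))
      fun a _ => Eval.tick_ret 1 _).bind ((Eval.each (c := 0) (g := fun a : ℕ × Bool => a.2)
      fun a _ => Eval.ret a.2).bind ((Eval.tick 1).bind ((Eval.constErr (h.cls.label i) _).bind
        (Eval.ret _))))) ?_
    have := hfl i
    simp only [List.length_map]
    omega
  have d4 : Eval (Alg.findPair (P.coarse K) E : Alg d _) ω (n + m) o (n + m)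
      (Λ * (Λ * 6 + 1)) := h1.mono (by
    have : E.length ≤ Λ := by simpa [hEdef] using hl
    gcongr)
  have fin : ∀ h', Eval (match o with
      | none => return h
      | some (i, j) => do
        Alg.tick (h.live.length + 2)
        return { h with
          cls := { h.cls with steps := Step.merge i j :: h.cls.steps }
          live := h.live.erase j } : Alg d (Hyp d)) ω (n + m) h' (n + m) (Λ + 2) →
      Eval (Alg.merge K P h) ω n h' (n + m)
        (m * (Λ * (2 * d + 4) + d + 3) + Λ * (m * 6 + Λ * 6 + 5) + 2) := fun h' hh => by
    refine Eval.mono (d1.bind (d2.bind (d3.bind (d4.bind hh)))) ?_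
    ring_nf
    omega
  rcases h2 with ⟨rfl, h3⟩ | ⟨a, b, hab, rfl, h4, h5⟩
  · refine ⟨h, fin h ((Eval.ret _).mono (Nat.zero_le _)), Or.inl ⟨rfl, ?_⟩⟩
    rw [hEdef, List.pairwise_map] at h3
    exact h3
  · obtain ⟨l, hl1, hl2⟩ := List.sublist_map_iff.1 hab
    obtain ⟨i, l, rfl⟩ : ∃ i l', l = i :: l' := List.exists_cons_of_ne_nil (by
      rintro rfl; simp at hl2)
    obtain ⟨j, l, rfl⟩ : ∃ i l', l = i :: l' := List.exists_cons_of_ne_nil (by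
      rintro rfl; simp at hl2)
    have : l = [] := by simpa using congrArg List.length hl2
    subst this
    simp only [List.map_cons, List.map_nil, List.cons.injEq, and_true] at hl2
    obtain ⟨rfl, rfl⟩ := hl2
    refine ⟨_, fin _ ((Eval.tick_ret _ _).mono (by omega)), Or.inr ⟨i, j, hl1, h4, h5, rfl⟩⟩

/-! ### The main loop -/

theorem Eval.largest : ∀ (l : List (ℕ × ℕ)) (best : Option (ℕ × ℕ)), ∃ v,
    Eval (Alg.largest l best : Alg d _) ω n v n (l.length * 2) ∧
    (v = none → l = [] ∧ best = none) ∧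
    ∀ a, v = some a → (a ∈ l ∨ best = some a) ∧ (∀ b ∈ l, b.2 ≤ a.2) ∧
      ∀ b, best = some b → b.2 ≤ a.2
  | [], best => ⟨best, (Eval.ret _).mono (Nat.zero_le _), fun h => ⟨rfl, h⟩,
      fun a h => ⟨Or.inr h, by simp, fun b hb => by rw [h] at hb; rw [Option.some.inj hb]⟩⟩
  | a :: l, none => by
    obtain ⟨v, h1, h2, h3⟩ := Eval.largest l (some a)
    refine ⟨v, ((Eval.tick 2).bind h1).mono (by simp only [List.length_cons]; omega), fun h => ?_,
      fun b hb => ?_⟩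
    · simp at h2; exact absurd h h2
    · obtain ⟨h4, h5, h6⟩ := h3 b hb
      refine ⟨Or.inl ?_, ?_, by simp⟩
      · rcases h4 with h4 | h4
        · simp [h4]
        · simp [Option.some.inj h4]
      · intro b' hb'
        rcases List.mem_cons.1 hb' with rfl | hb'
        · exact h6 _ rfl
        · exact h5 _ hb'
  | a :: l, some c => by
    obtain ⟨v, h1, h2, h3⟩ := Eval.largest l (if c.2 < a.2 then some a else some c)
    refine ⟨v, ((Eval.tick 2).bind h1).mono (by simp only [List.length_cons]; omega), fun h => ?_,
      fun b hb => ?_⟩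
    · have := (h2 h).2
      split_ifs at this
    · obtain ⟨h4, h5, h6⟩ := h3 b hb
      by_cases hca : c.2 < a.2
      · rw [if_pos hca] at h4 h6
        have h7 := h6 a rfl
        refine ⟨Or.inl ?_, ?_, ?_⟩
        · rcases h4 with h4 | h4
          · simp [h4]
          · simp [Option.some.inj h4]
        · intro b' hb'
          rcases List.mem_cons.1 hb' with rfl | hb'
          · exact h7
          · exact h5 _ hb'
        · intro b' hb'
          rw [← Option.some.inj hb']
          omega
      · rw [if_neg hca] at h4 h6
        have h7 := h6 c rfl
        refine ⟨?_, ?_, ?_⟩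
        · rcases h4 with h4 | h4
          · exact Or.inl (by simp [h4])
          · exact Or.inr h4
        · intro b' hb'
          rcases List.mem_cons.1 hb' with rfl | hb'
          · omega
          · exact h5 _ hb'
        · intro b' hb'
          rw [← Option.some.inj hb']
          exact h7

/-- The estimated mass of the live regions, on the batch at position `n`. -/
noncomputable def liveMass (K : Constants) (P : Params) (ω : ℕ → Example d) (h : Hyp d) (n : ℕ) :
    ℝ :=
  ((batch ω n (P.batch K)).countP fun z => decide (regionOf h.cls.steps z.1 ∈ h.live) : ℝ) /
    (batch ω n (P.batch K)).length

/-- The number of examples of the batch at position `n` that fall into region `i`. -/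
noncomputable def regionCount (K : Constants) (P : Params) (ω : ℕ → Example d) (h : Hyp d)
    (n i : ℕ) : ℕ :=
  ((batch ω n (P.batch K)).map fun z => regionOf h.cls.steps z.1).countP fun r => decide (r = i)

/-- The state after region `i` of `h` has been split. -/
def Hyp.splitOff (h : Hyp d) (i : ℕ) (s : Bool) (w : Pt d) (τ : ℝ) (t : Bool) : Hyp d where
  cls :=
    { steps := Step.cut i w τ t h.next :: h.cls.steps
      label := Function.update (Function.update h.cls.label i s) h.next t }
  live := h.next :: h.live
  next := h.next + 1

/-- The state after region `i` of `h` has been frozen. -/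
def Hyp.freeze (h : Hyp d) (i : ℕ) (s : Bool) : Hyp d :=
  { h with
    cls := { h.cls with label := Function.update h.cls.label i s }
    live := h.live.erase i }

/-- One round of the main loop that starts at position `n` with the state `h` and ends at position
`n'` with the state `h'`. -/
def RoundOutcome (K : Constants) (P : Params) (ω : ℕ → Example d) (h : Hyp d) (n : ℕ)
    (h' : Hyp d) (n' : ℕ) : Prop :=
  P.ε < liveMass K P ω h n ∧ ∃ i ∈ h.live,
    (∀ j ∈ h.live, regionCount K P ω h (n + P.batch K) j ≤
      regionCount K P ω h (n + P.batch K) i) ∧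
    ∃ s e out n₁, SplitOutcome K P ω h.cls.steps i (n + 2 * P.batch K) e out n₁ ∧ e ≤ 1 / 2 ∧
      (e = errFrac s ((batchIn ω h.cls.steps i (n + 2 * P.batch K) (P.batch K)).map
          fun z => z.2) ∨
        e = 1 - errFrac (!s) ((batchIn ω h.cls.steps i (n + 2 * P.batch K) (P.batch K)).map
          fun z => z.2)) ∧
      ((out = none ∧ h' = h.freeze i s ∧ n' = n₁) ∨
        ∃ w τ t, out = some (w, τ, t) ∧ MergeOutcome K P ω (h.splitOff i s w τ t) n₁ h' ∧
          n' = n₁ + P.batch K)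

/-- A bound for the number of steps of one round. -/
noncomputable def roundCost (d : ℕ) (K : Constants) (P : Params) (Λ : ℕ) : ℕ :=
  (P.grid + 10) * (P.batch K * (Λ * (2 * d + 20) + 12 * d + 80 + P.batch K * 9) + 12 * d + 60) +
    (Λ + 3) * (Λ * 6 + 20)

/-- The part of a round that follows the choice of a live region. -/
noncomputable def roundTail (K : Constants) (P : Params) (r : ℕ) (h : Hyp d) :
    Option (ℕ × ℕ) → Alg d (Classifier d)
  | none => return h.cls
  | some (i, _) => do
    tick 1
    let out ← Alg.split K P h.cls.steps i (h.cls.label i)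
    match out with
    | (s, some (w, τ, t)) => do
      tick (d + 10)
      let h' ← Alg.merge K P (h.splitOff i s w τ t)
      Alg.mainLoop K P r h'
    | (s, none) => do
      tick (h.live.length + 1)
      Alg.mainLoop K P r (h.freeze i s)

/-- The part of a round that follows the test of the mass of the live regions. -/
noncomputable def roundBody (K : Constants) (P : Params) (r : ℕ) (h : Hyp d) :
    Alg d (Classifier d) := do
  let S' ← draw (P.batch K)
  let R ← each (fun z : Example d => locate h.cls.steps z.1) S'
  let M ← each (fun i : ℕ => do
    let c ← count (fun r => do
      tick 1
      return decide (r = i)) R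
    return (i, c)) h.live
  let o ← largest M none
  roundTail K P r h o

theorem mainLoop_eq (K : Constants) (P : Params) (r : ℕ) (h : Hyp d) :
    Alg.mainLoop K P (r + 1) h = (do
      let S ← draw (P.batch K)
      let μlive ← fraction (fun z : Example d => do
        let r ← locate h.cls.steps z.1
        tick h.live.length
        return decide (r ∈ h.live)) S
      tick 1
      if μlive ≤ P.ε then
        return h.cls
      else
        roundBody K P r h : Alg d _) := by
  rfl

theorem round_cost (m Λ d g : ℕ) : m * (d + 2) + (m * (Λ * (2 * d + 5) + 2) + 1) + 1 + m * (d + 2) +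
    m * (Λ * (2 * d + 4) + 1) + Λ * (m * 2 + 1) + Λ * 2 + 1 +
    ((g + 4) * (m * (Λ * (2 * d + 4) + 12 * d + 80 + m * 9) + 5 * d + 40)) +
    (d + 10) + Λ + 1 + (m * (Λ * (2 * d + 4) + d + 3) + Λ * (m * 6 + Λ * 6 + 5) + 2) ≤
    (g + 10) * (m * (Λ * (2 * d + 20) + 12 * d + 80 + m * 9) + 12 * d + 60) +
      (Λ + 3) * (Λ * 6 + 20) := by
  zify
  have h1 : (0 : ℤ) ≤ (g : ℤ) * m * Λ := by positivity
  have h2 : (0 : ℤ) ≤ (m : ℤ) * Λ * d := by positivity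
  have h3 : (0 : ℤ) ≤ (m : ℤ) * d := by positivity
  have h4 : (0 : ℤ) ≤ (m : ℤ) * m := by positivity
  have h5 : (0 : ℤ) ≤ (g : ℤ) * d := by positivity
  have h6 : (0 : ℤ) ≤ (m : ℤ) * Λ := by positivity
  have h7 : (0 : ℤ) ≤ (Λ : ℤ) * Λ := by positivity
  have h8 : (0 : ℤ) ≤ (g : ℤ) := by positivity
  have h9 : (0 : ℤ) ≤ (m : ℤ) := by positivity
  have h10 : (0 : ℤ) ≤ (d : ℤ) := by positivity
  have h11 : (0 : ℤ) ≤ (Λ : ℤ) := by positivity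
  linarith

/-- A run of the main loop either stops at the beginning of its first round, because the live regions
have little estimated mass or there are none, or it completes a round and goes on from there. -/
theorem Eval.mainLoop_succ (K : Constants) (P : Params) (r : ℕ) (h : Hyp d) {Λ : ℕ}
    (hp : h.cls.steps.length + 1 ≤ Λ) (hl : h.live.length + 1 ≤ Λ) :
    (∃ T ≤ roundCost d K P Λ, ∃ n' ≤ n + 2 * P.batch K,
      Eval (Alg.mainLoop K P (r + 1) h) ω n h.cls n' T ∧
        (liveMass K P ω h n ≤ P.ε ∨ h.live = [])) ∨
    ∃ h' n', RoundOutcome K P ω h n h' n' ∧ ∀ v n'' T,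
      Eval (Alg.mainLoop K P r h') ω n' v n'' T →
      Eval (Alg.mainLoop K P (r + 1) h) ω n v n'' (roundCost d K P Λ + T) := by
  set m := P.batch K with hm
  have hp' : h.cls.steps.length ≤ Λ := by omega
  have hl' : h.live.length ≤ Λ := by omega
  have d1 : Eval (Alg.draw m : Alg d _) ω n (batch ω n m) (n + m) (m * (d + 2)) := Eval.draw m n
  have d2 : Eval (Alg.fraction (fun z : Example d => do
      let r ← Alg.locate h.cls.steps z.1
      Alg.tick h.live.length
      return decide (r ∈ h.live)) (batch ω n m)) ω (n + m) (liveMass K P ω h n) (n + m)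
      (m * (Λ * (2 * d + 5) + 2) + 1) :=
    (Eval.fraction (c := Λ * (2 * d + 5)) fun z _ => Eval.mono
      ((Eval.locate h.cls.steps z.1).bind (Eval.tick_ret h.live.length _)) (by
        calc h.cls.steps.length * (2 * d + 4) + h.live.length ≤ Λ * (2 * d + 4) + Λ := by gcongr
          _ = Λ * (2 * d + 5) := by ring)).mono (by rw [length_batch])
  have hcost : ∀ A, A ≤ m * (d + 2) + (m * (Λ * (2 * d + 5) + 2) + 1) + 1 + m * (d + 2) +
      m * (Λ * (2 * d + 4) + 1) + Λ * (m * 2 + 1) + Λ * 2 + 1 +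
      ((P.grid + 4) * (m * (Λ * (2 * d + 4) + 12 * d + 80 + m * 9) + 5 * d + 40)) +
      (d + 10) + Λ + 1 + (m * (Λ * (2 * d + 4) + d + 3) + Λ * (m * 6 + Λ * 6 + 5) + 2) →
      A ≤ roundCost d K P Λ := by
    intro A hA
    refine hA.trans ?_
    exact round_cost m Λ d P.grid
  by_cases hμ : liveMass K P ω h n ≤ P.ε
  · refine Or.inl ⟨m * (d + 2) + (m * (Λ * (2 * d + 5) + 2) + 1 + (1 + 0)), hcost _ ?_, n + m,
      by omega, ?_, Or.inl hμ⟩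
    rotate_left
    · rw [mainLoop_eq]
      refine d1.bind (d2.bind ((Eval.tick 1).bind (?_ : Eval _ ω (n + m) _ (n + m) 0)))
      rw [if_pos hμ]
      exact Eval.ret _
    · omega
  have d3 : Eval (Alg.draw m : Alg d _) ω (n + m) (batch ω (n + m) m) (n + 2 * m) (m * (d + 2)) := by
    rw [show n + 2 * m = n + m + m by ring]
    exact Eval.draw m _
  have d4 : Eval (Alg.each (fun z : Example d => Alg.locate h.cls.steps z.1) (batch ω (n + m) m)) ω
      (n + 2 * m) ((batch ω (n + m) m).map fun z => regionOf h.cls.steps z.1) (n + 2 * m)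
      (m * (Λ * (2 * d + 4) + 1)) :=
    (Eval.each fun z _ => Eval.locate h.cls.steps z.1).mono (by rw [length_batch]; gcongr)
  have d5 : Eval (Alg.each (fun i : ℕ => do
        let c ← Alg.count (fun r => do
          Alg.tick 1
          return decide (r = i)) ((batch ω (n + m) m).map fun z => regionOf h.cls.steps z.1)
        return (i, c)) h.live : Alg d _) ω (n + 2 * m)
      (h.live.map fun i => (i, regionCount K P ω h (n + m) i)) (n + 2 * m) (Λ * (m * 2 + 1)) :=
    (Eval.each (c := m * 2) fun i _ => Eval.mono (Eval.bind (g := fun c => pure (i, c))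
      (Eval.count (c := 1) (q := fun r => decide (r = i)) fun r _ => Eval.tick_ret 1 _)
      (Eval.ret _)) (by simp)).mono (by gcongr)
  obtain ⟨o, h1, h2, h3⟩ := Eval.largest (d := d) (ω := ω) (n := n + 2 * m)
    (h.live.map fun i => (i, regionCount K P ω h (n + m) i)) none
  have d6 := h1.mono (T' := Λ * 2) (by rw [List.length_map]; omega)
  have pre : ∀ v n'' T, Eval (roundTail K P r h o) ω (n + 2 * m) v n'' T →
      Eval (Alg.mainLoop K P (r + 1) h) ω n v n'' (m * (d + 2) + (m * (Λ * (2 * d + 5) + 2) + 1 +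
        (1 + (m * (d + 2) + (m * (Λ * (2 * d + 4) + 1) + (Λ * (m * 2 + 1) + (Λ * 2 + T))))))) := by
    intro v n'' T hT
    rw [mainLoop_eq]
    refine d1.bind (d2.bind ((Eval.tick 1).bind (?_ : Eval _ ω (n + m) _ n'' _)))
    rw [if_neg hμ]
    exact d3.bind (d4.bind (d5.bind (d6.bind hT)))
  cases ho : o with
  | none =>
    refine Or.inl ⟨_, hcost _ ?_, n + 2 * m, le_rfl, pre h.cls (n + 2 * m) 0 ?_, Or.inr ?_⟩
    · omega
    · rw [ho]; exact Eval.ret _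
    · simpa using (h2 ho).1
  | some a =>
    obtain ⟨i, c⟩ := a
    obtain ⟨h4, h5, -⟩ := h3 _ ho
    simp only [List.mem_map, Prod.mk.injEq, reduceCtorEq, or_false] at h4
    obtain ⟨i', hi', rfl, rfl⟩ := h4
    obtain ⟨s, e, out, n₁, g1, g2, g3, g4⟩ := Eval.split (ω := ω) (n := n + 2 * m) K P
      h.cls.steps i' (h.cls.label i') hp'
    simp only [← hm] at g1
    cases hout : out with
    | none =>
      refine Or.inr ⟨h.freeze i' s, n₁, ⟨not_le.1 hμ, i', hi', fun j hj => ?_, s, e, out, n₁, g2,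
        g3, g4, Or.inl ⟨hout, rfl, rfl⟩⟩, fun v n'' T hT => ?_⟩
      · exact h5 (j, _) (List.mem_map_of_mem hj)
      · rw [hout] at g1
        refine (pre v n'' _ (by
          rw [ho]
          exact (Eval.tick 1).bind (g1.bind ((Eval.tick (h.live.length + 1)).bind hT)))).mono ?_
        have := hcost _ le_rfl
        omega
    | some x =>
      obtain ⟨w, τ, t⟩ := x
      obtain ⟨h', q1, q2⟩ := Eval.merge (ω := ω) (n := n₁) K P (h.splitOff i' s w τ t)
        (Λ := Λ) (by simpa [Hyp.splitOff] using hp) (by simpa [Hyp.splitOff] using hl)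
      simp only [← hm] at q1
      refine Or.inr ⟨h', n₁ + m, ⟨not_le.1 hμ, i', hi', fun j hj => ?_, s, e, out, n₁, g2,
        g3, g4, Or.inr ⟨w, τ, t, hout, q2, rfl⟩⟩, fun v n'' T hT => ?_⟩
      · exact h5 (j, _) (List.mem_map_of_mem hj)
      · rw [hout] at g1
        refine (pre v n'' _ (by
          rw [ho]
          exact (Eval.tick 1).bind (g1.bind ((Eval.tick (d + 10)).bind (q1.bind hT))))).mono ?_
        have := hcost _ le_rfl
        omega

end Alg

/-! ### Concentration along a stream of independent draws -/

section Concentration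

variable {Z : Type*} [MeasurableSpace Z] (D : Measure Z) [IsProbabilityMeasure D]

/-- Redrawing one coordinate of an i.i.d. stream does not change its law. -/
theorem map_update_infinitePi (j : ℕ) :
    ((Measure.infinitePi fun _ : ℕ => D).prod D).map (fun p => Function.update p.1 j p.2) =
      Measure.infinitePi fun _ : ℕ => D := by
  have hmeas : Measurable fun p : (ℕ → Z) × Z => Function.update p.1 j p.2 := by
    rw [measurable_pi_iff]
    intro i
    by_cases h : i = j
    · subst h; simpa using measurable_snd
    · simp only [Function.update_of_ne h]; fun_prop
  refine Measure.eq_infinitePi _ fun s t ht => ?_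
  have hms : MeasurableSet (Set.pi (s : Set ℕ) t) :=
    MeasurableSet.pi s.countable_toSet fun i _ => ht i
  rw [Measure.map_apply hmeas hms]
  by_cases hj : j ∈ s
  · have : (fun p : (ℕ → Z) × Z => Function.update p.1 j p.2) ⁻¹' Set.pi (s : Set ℕ) t =
        (Set.pi ((s.erase j : Finset ℕ) : Set ℕ) t) ×ˢ t j := by
      ext p
      simp only [Set.mem_preimage, Set.mem_pi, Set.mem_prod, Finset.mem_coe, Finset.mem_erase]
      constructor
      · intro h
        refine ⟨fun i hi => ?_, ?_⟩
        · simpa [hi.1] using h i hi.2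
        · simpa using h j hj
      · rintro ⟨h1, h2⟩ i hi
        by_cases hij : i = j
        · subst hij; simpa using h2
        · simpa [hij] using h1 i ⟨hij, hi⟩
    rw [this, Measure.prod_prod, Measure.infinitePi_pi _ fun i _ => ht i, mul_comm,
      Finset.mul_prod_erase s (fun i => D (t i)) hj]
  · have : (fun p : (ℕ → Z) × Z => Function.update p.1 j p.2) ⁻¹' Set.pi (s : Set ℕ) t =
        (Set.pi (s : Set ℕ) t) ×ˢ Set.univ := by
      ext p
      simp only [Set.mem_preimage, Set.mem_pi, Set.mem_prod, Finset.mem_coe, Set.mem_univ, and_true]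
      refine forall₂_congr fun i hi => ?_
      have : i ≠ j := fun h => hj (h ▸ hi)
      simp [this]
    rw [this, Measure.prod_prod, Measure.infinitePi_pi _ fun i _ => ht i, measure_univ, mul_one]

theorem measurable_update_stream (j : ℕ) :
    Measurable fun p : (ℕ → Z) × Z => Function.update p.1 j p.2 := by
  rw [measurable_pi_iff]
  intro i
  by_cases h : i = j
  · subst h; simpa using measurable_snd
  · simp only [Function.update_of_ne h]; fun_prop

/-- Expectations may be computed by redrawing one coordinate. -/
theorem lintegral_resample (j : ℕ) {Φ : (ℕ → Z) → ENNReal} (hΦ : Measurable Φ) :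
    ∫⁻ ω, Φ ω ∂(Measure.infinitePi fun _ : ℕ => D) =
      ∫⁻ ω, ∫⁻ z, Φ (Function.update ω j z) ∂D ∂(Measure.infinitePi fun _ : ℕ => D) := by
  conv_lhs => rw [← map_update_infinitePi D j]
  rw [lintegral_map hΦ (measurable_update_stream j), lintegral_prod]
  exact (hΦ.comp (measurable_update_stream j)).aemeasurable

/-- Hoeffding's lemma, for a random variable with values in `[-1, 1]`. -/
theorem lintegral_exp_centered_le {f : Z → ℝ} (hf : Measurable f) (hb : ∀ᵐ z ∂D, |f z| ≤ 1)
    (s : ℝ) : ∫⁻ z, ENNReal.ofReal (Real.exp (s * (f z - ∫ y, f y ∂D))) ∂D ≤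
      ENNReal.ofReal (Real.exp (s ^ 2 / 2)) := by
  have h := ProbabilityTheory.hasSubgaussianMGF_of_mem_Icc (μ := D) (a := -1) (b := 1)
    hf.aemeasurable (hb.mono fun z hz => abs_le.1 hz)
  rw [← ofReal_integral_eq_lintegral_ofReal (h.integrable_exp_mul s)
    (Filter.Eventually.of_forall fun z => (Real.exp_pos _).le)]
  refine ENNReal.ofReal_le_ofReal ((h.mgf_le s).trans (Real.exp_le_exp.2 ?_))
  have : (((‖(1 : ℝ) - -1‖₊ / 2) ^ 2 : ℝ≥0) : ℝ) = 1 := by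
    push_cast
    norm_num
  rw [this, one_mul]

/-- **Azuma's inequality** along the coordinates `pos 0, pos 1, …` of an i.i.d. stream: the function
`g i` that is evaluated at the coordinate `pos i` may depend on all coordinates but `pos i`,
`pos (i + 1)`, …. -/
theorem azuma_stream (pos : ℕ → ℕ) (n : ℕ) (g : ℕ → (ℕ → Z) → Z → ℝ)
    (hpos : ∀ i < n, ∀ i' < n, pos i = pos i' → i = i')
    (hg : ∀ i < n, Measurable (Function.uncurry (g i)))
    (hb : ∀ i < n, ∀ ω, ∀ᵐ z ∂D, |g i ω z| ≤ 1)
    (hinv : ∀ i < n, ∀ i' < n, i ≤ i' → ∀ ω z, g i (Function.update ω (pos i') z) = g i ω)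
    {t : ℝ} (ht : 0 < t) :
    (Measure.infinitePi fun _ : ℕ => D)
      {ω | n * t ≤ ∑ i ∈ Finset.range n, (g i ω (ω (pos i)) - ∫ z, g i ω z ∂D)} ≤
      ENNReal.ofReal (Real.exp (-(n * t ^ 2 / 2))) := by
  set μ := Measure.infinitePi fun _ : ℕ => D with hμ
  set X : ℕ → (ℕ → Z) → ℝ := fun i ω => g i ω (ω (pos i)) - ∫ z, g i ω z ∂D with hX
  have hXm : ∀ i < n, Measurable (X i) := fun i hi => by
    refine Measurable.sub ?_ ?_
    · exact (hg i hi).comp (measurable_id.prodMk (measurable_pi_apply (pos i)))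
    · exact ((hg i hi).stronglyMeasurable.integral_prod_right (ν := D)).measurable
  -- exponential moments, integrating out the coordinates from the last one to the first one
  have mgf : ∀ k ≤ n, ∀ s : ℝ, ∫⁻ ω, ENNReal.ofReal (Real.exp (s * ∑ i ∈ Finset.range k, X i ω)) ∂μ ≤
      ENNReal.ofReal (Real.exp (k * (s ^ 2 / 2))) := by
    intro k
    induction k with
    | zero => intro _ s; simp
    | succ k ih =>
      intro hk s
      have hkn : k < n := hk
      have hSm : Measurable fun ω => ENNReal.ofReal
          (Real.exp (s * ∑ i ∈ Finset.range (k + 1), X i ω)) := by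
        refine ENNReal.measurable_ofReal.comp (Real.measurable_exp.comp ?_)
        refine (Finset.measurable_sum _ fun i hi => hXm i ?_).const_mul s
        have := Finset.mem_range.1 hi
        omega
      rw [lintegral_resample D (pos k) hSm]
      have hinner : ∀ ω, ∫⁻ z, ENNReal.ofReal (Real.exp
          (s * ∑ i ∈ Finset.range (k + 1), X i (Function.update ω (pos k) z))) ∂D ≤
          ENNReal.ofReal (Real.exp (s ^ 2 / 2)) *
            ENNReal.ofReal (Real.exp (s * ∑ i ∈ Finset.range k, X i ω)) := by
        intro ω
        have h1 : ∀ z, ∑ i ∈ Finset.range (k + 1), X i (Function.update ω (pos k) z) =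
            ∑ i ∈ Finset.range k, X i ω + (g k ω z - ∫ y, g k ω y ∂D) := by
          intro z
          rw [Finset.sum_range_succ]
          congr 1
          · refine Finset.sum_congr rfl fun i hi => ?_
            have hik := Finset.mem_range.1 hi
            have hne : pos i ≠ pos k := fun h => by
              have := hpos i (by omega) k hkn h
              omega
            simp only [hX, hinv i (by omega) k hkn hik.le, Function.update_of_ne hne]
          · simp only [hX, hinv k hkn k hkn le_rfl, Function.update_self]
        simp_rw [h1, mul_add, Real.exp_add, ENNReal.ofReal_mul (Real.exp_pos _).le]
        rw [lintegral_const_mul', mul_comm]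
        · gcongr
          exact lintegral_exp_centered_le D ((hg k hkn).comp measurable_prodMk_left) (hb k hkn ω) s
        · exact ENNReal.ofReal_ne_top
      calc _ ≤ ∫⁻ ω, ENNReal.ofReal (Real.exp (s ^ 2 / 2)) *
            ENNReal.ofReal (Real.exp (s * ∑ i ∈ Finset.range k, X i ω)) ∂μ :=
          lintegral_mono hinner
        _ = ENNReal.ofReal (Real.exp (s ^ 2 / 2)) *
            ∫⁻ ω, ENNReal.ofReal (Real.exp (s * ∑ i ∈ Finset.range k, X i ω)) ∂μ :=
          lintegral_const_mul' _ _ ENNReal.ofReal_ne_top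
        _ ≤ ENNReal.ofReal (Real.exp (s ^ 2 / 2)) *
            ENNReal.ofReal (Real.exp (k * (s ^ 2 / 2))) := by
          gcongr
          exact ih hkn.le s
        _ = _ := by
          rw [← ENNReal.ofReal_mul (Real.exp_pos _).le, ← Real.exp_add]
          push_cast
          ring_nf
  have hm : Measurable fun ω => ENNReal.ofReal (Real.exp (t * ∑ i ∈ Finset.range n, X i ω)) :=
    ENNReal.measurable_ofReal.comp (Real.measurable_exp.comp
      ((Finset.measurable_sum _ fun i hi => hXm i (Finset.mem_range.1 hi)).const_mul t))
  -- Markov's inequality for the exponential, at the optimal exponent `t`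
  have hsub : {ω | n * t ≤ ∑ i ∈ Finset.range n, X i ω} ⊆
      {ω | ENNReal.ofReal (Real.exp (n * t ^ 2)) ≤
        ENNReal.ofReal (Real.exp (t * ∑ i ∈ Finset.range n, X i ω))} := by
    intro ω hω
    refine ENNReal.ofReal_le_ofReal (Real.exp_le_exp.2 ?_)
    have : t * (n * t) ≤ t * ∑ i ∈ Finset.range n, X i ω := mul_le_mul_of_nonneg_left hω ht.le
    linarith [this, show t * (n * t) = n * t ^ 2 by ring]
  refine (measure_mono hsub).trans ((meas_ge_le_lintegral_div hm.aemeasurable ?_ ?_).trans ?_)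
  · simp [Real.exp_pos]
  · exact ENNReal.ofReal_ne_top
  · rw [ENNReal.div_le_iff (by simp [Real.exp_pos]) ENNReal.ofReal_ne_top,
      ← ENNReal.ofReal_mul (Real.exp_pos _).le, ← Real.exp_add]
    refine (mgf n le_rfl t).trans_eq ?_
    ring_nf

/-- Hoeffding's inequality for the coordinates `pos 0, pos 1, …` of an i.i.d. stream and a function
`g` that may depend on the other coordinates. -/
theorem hoeffding_stream (pos : ℕ → ℕ) (n : ℕ) (g : (ℕ → Z) → Z → ℝ)
    (hpos : ∀ i < n, ∀ i' < n, pos i = pos i' → i = i')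
    (hg : Measurable (Function.uncurry g))
    (hb : ∀ ω, ∀ᵐ z ∂D, |g ω z| ≤ 1)
    (hinv : ∀ i < n, ∀ ω z, g (Function.update ω (pos i) z) = g ω) {t : ℝ} (ht : 0 < t) :
    (Measure.infinitePi fun _ : ℕ => D)
      {ω | ¬ |∑ i ∈ Finset.range n, g ω (ω (pos i)) - n * ∫ z, g ω z ∂D| ≤ n * t} ≤
      2 * ENNReal.ofReal (Real.exp (-(n * t ^ 2 / 2))) := by
  have h1 := azuma_stream D pos n (fun _ => g) hpos (fun _ _ => hg) (fun _ _ => hb)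
    (fun i _ i' hi' _ => hinv i' hi') ht
  have h2 := azuma_stream D pos n (fun _ ω z => -g ω z) hpos (fun _ _ => hg.neg)
    (fun _ _ ω => by simpa using hb ω)
    (fun i _ i' hi' _ ω z => by simp only [hinv i' hi']) ht
  refine (measure_mono ?_).trans ((measure_union_le _ _).trans
    ((add_le_add h1 h2).trans_eq (two_mul _).symm))
  intro ω hω
  simp only [Set.mem_ofPred_eq, not_le, lt_abs] at hω
  simp only [Finset.sum_sub_distrib, integral_neg, Finset.sum_neg_distrib, Finset.sum_const,
    Finset.card_range, nsmul_eq_mul, Set.mem_union, Set.mem_ofPred_eq]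
  rcases hω with h | h
  · left; linarith
  · right; linarith

end Concentration

variable {d : ℕ}

theorem abs_lab (b : Bool) : |lab b| = 1 := by cases b <;> simp [lab]

theorem measurable_lab : Measurable lab := measurable_of_finite _

/-! ### The leaky loss -/

/-- The loss `LeakyRelu_lam (-Y ⟨w, x⟩)`. -/
noncomputable def leaky (lam : ℝ) (w : Pt d) (z : Example d) : ℝ :=
  (1 / 2 - lam) * |inner ℝ w z.1| - 1 / 2 * (lab z.2 * inner ℝ w z.1)

theorem leaky_eq_ite (lam : ℝ) (w : Pt d) (z : Example d) :
    leaky lam w z =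
      ((if lab z.2 * inner ℝ w z.1 < 0 then 1 else 0) - lam) * |inner ℝ w z.1| := by
  have h : |lab z.2 * inner ℝ w z.1| = |inner ℝ w z.1| := by rw [abs_mul, abs_lab, one_mul]
  unfold leaky
  rw [← h]
  split_ifs with hlt
  · rw [abs_of_neg hlt]; ring
  · rw [abs_of_nonneg (not_lt.1 hlt)]; ring

theorem leaky_smul (lam : ℝ) {c : ℝ} (hc : 0 ≤ c) (w : Pt d) (z : Example d) :
    leaky lam (c • w) z = c * leaky lam w z := by
  simp only [leaky, real_inner_smul_left, abs_mul, abs_of_nonneg hc]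
  ring

theorem leaky_add_le {lam : ℝ} (h : lam ≤ 1 / 2) (w w' : Pt d) (z : Example d) :
    leaky lam (w + w') z ≤ leaky lam w z + leaky lam w' z := by
  simp only [leaky, inner_add_left]
  have := mul_le_mul_of_nonneg_left (abs_add_le (inner ℝ w z.1) (inner ℝ w' z.1))
    (show 0 ≤ 1 / 2 - lam by linarith)
  linarith

theorem leaky_zero (lam : ℝ) (z : Example d) : leaky lam 0 z = 0 := by simp [leaky]

theorem abs_leaky_le {lam : ℝ} (h0 : 0 ≤ lam) (h : lam ≤ 1 / 2) {w : Pt d} (hw : ‖w‖ ≤ 1)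
    {z : Example d} (hz : ‖z.1‖ ≤ 1) : |leaky lam w z| ≤ 1 := by
  have h1 : |inner ℝ w z.1| ≤ 1 :=
    (abs_real_inner_le_norm _ _).trans (mul_le_one₀ hw (norm_nonneg _) hz)
  rw [leaky_eq_ite, abs_mul, abs_abs]
  refine mul_le_one₀ ?_ (abs_nonneg _) h1
  rw [abs_le]
  split_ifs <;> constructor <;> linarith

theorem measurable_leaky (lam : ℝ) :
    Measurable fun p : Pt d × Example d => leaky lam p.1 p.2 := by
  have h : Measurable fun p : Pt d × Example d => (inner ℝ p.1 p.2.1 : ℝ) :=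
    measurable_fst.inner measurable_snd.fst
  have h2 : Measurable fun p : Pt d × Example d => lab p.2.2 :=
    measurable_lab.comp measurable_snd.snd
  unfold leaky
  exact ((h.abs).const_mul _).sub ((h2.mul h).const_mul _)

/-- The slope of the leaky loss at a given iterate is a subgradient. -/
theorem leaky_sub_le {lam : ℝ} (h : lam ≤ 1 / 2) (w u : Pt d) (z : Example d) :
    leaky lam w z - leaky lam u z ≤
      (if 0 ≤ -(lab z.2 * inner ℝ w z.1) then 1 - lam else lam) * lab z.2 *
        inner ℝ (u - w) z.1 := by
  have hu : |lab z.2 * inner ℝ u z.1| = |inner ℝ u z.1| := by rw [abs_mul, abs_lab, one_mul]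
  have hw : |lab z.2 * inner ℝ w z.1| = |inner ℝ w z.1| := by rw [abs_mul, abs_lab, one_mul]
  rw [inner_sub_left]
  unfold leaky
  rw [← hu, ← hw]
  have h1 := le_abs_self (lab z.2 * inner ℝ u z.1)
  have h2 := neg_abs_le (lab z.2 * inner ℝ u z.1)
  split_ifs with hs
  · rw [abs_of_nonpos (by linarith : lab z.2 * inner ℝ w z.1 ≤ 0)]
    nlinarith
  · rw [abs_of_pos (by linarith : 0 < lab z.2 * inner ℝ w z.1)]
    nlinarith

/-! ### Projected SGD -/

theorem norm_clip_le (v : Pt d) : ‖Alg.clip v‖ ≤ 1 := by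
  unfold Alg.clip
  split_ifs with h
  · rw [norm_smul, norm_inv, norm_norm, inv_mul_cancel₀ (by linarith)]
  · exact not_lt.1 h

theorem norm_clip_sub_le (v : Pt d) {u : Pt d} (hu : ‖u‖ ≤ 1) :
    ‖Alg.clip v - u‖ ^ 2 ≤ ‖v - u‖ ^ 2 := by
  unfold Alg.clip
  split_ifs with h
  · have hv : 0 < ‖v‖ := by linarith
    rw [norm_sub_sq_real, norm_sub_sq_real, norm_smul, norm_inv, norm_norm,
      inv_mul_cancel₀ hv.ne', real_inner_smul_left]
    have h1 : inner ℝ v u ≤ ‖v‖ :=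
      (real_inner_le_norm v u).trans (mul_le_of_le_one_right hv.le hu)
    have h2 : ‖v‖⁻¹ * inner ℝ v u ≤ 1 := by
      rw [inv_mul_le_iff₀ hv]; linarith
    have h3 : inner ℝ v u = ‖v‖ * (‖v‖⁻¹ * inner ℝ v u) := by
      rw [← mul_assoc, mul_inv_cancel₀ hv.ne', one_mul]
    set c := ‖v‖⁻¹ * inner ℝ v u
    rw [h3]
    nlinarith [mul_nonneg (sub_nonneg.2 h.le) (sub_nonneg.2 h2)]
  · exact le_rfl

/-- The state (iterate, sum of the earlier iterates) of SGD after it has read the first `k` terms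
of a sequence of examples, where the examples that fail the test `q` are skipped. -/
noncomputable def sgdState (q : Example d → Bool) (lam ν : ℝ) (z : ℕ → Example d) :
    ℕ → Pt d × Pt d
  | 0 => (0, 0)
  | k + 1 => if q (z k) then Alg.sgdStep lam ν (sgdState q lam ν z k) (z k)
    else sgdState q lam ν z k

theorem foldl_sgdStep (q : Example d → Bool) (lam ν : ℝ) (z : ℕ → Example d) (m : ℕ) :
    (((List.range m).map z).filter q).foldl (Alg.sgdStep lam ν) (0, 0) = sgdState q lam ν z m := by
  induction m with
  | zero => rfl
  | succ m ih =>
    rw [List.range_succ, List.map_append, List.filter_append, List.foldl_append, ih]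
    simp only [List.map_cons, List.map_nil, sgdState, List.filter_cons, List.filter_nil]
    split_ifs <;> rfl

theorem norm_sgdState_le (q : Example d → Bool) (lam ν : ℝ) (z : ℕ → Example d) (k : ℕ) :
    ‖(sgdState q lam ν z k).1‖ ≤ 1 := by
  induction k with
  | zero => simp [sgdState]
  | succ k ih =>
    rw [sgdState]
    split_ifs
    · exact norm_clip_le _
    · exact ih

theorem sgdState_snd (q : Example d → Bool) (lam ν : ℝ) (z : ℕ → Example d) (k : ℕ) :
    (sgdState q lam ν z k).2 =
      ∑ j ∈ Finset.range k, if q (z j) then (sgdState q lam ν z j).1 else 0 := by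
  induction k with
  | zero => simp [sgdState]
  | succ k ih =>
    rw [Finset.sum_range_succ, ← ih]
    conv_lhs => rw [sgdState]
    split_ifs
    · simp [Alg.sgdStep, add_comm]
    · simp

/-- The regret bound of projected online gradient descent. -/
theorem sgd_regret {q : Example d → Bool} {lam ν : ℝ} (h0 : 0 ≤ lam) (h : lam ≤ 1 / 2)
    (hν : 0 ≤ ν) {z : ℕ → Example d} {u : Pt d} (hu : ‖u‖ ≤ 1) (m : ℕ)
    (hz : ∀ k < m, ‖(z k).1‖ ≤ 1) :
    2 * ν * ∑ k ∈ Finset.range m, (if q (z k) then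
      leaky lam (sgdState q lam ν z k).1 (z k) - leaky lam u (z k) else 0) +
      ‖(sgdState q lam ν z m).1 - u‖ ^ 2 ≤ 1 + ν ^ 2 * m := by
  induction m with
  | zero =>
    have := pow_le_one₀ (n := 2) (norm_nonneg u) hu
    simpa [sgdState] using this
  | succ m ih =>
    have ih := ih fun k hk => hz k (by omega)
    rw [Finset.sum_range_succ]
    push_cast
    conv_lhs => rw [sgdState]
    split_ifs with hq
    · set w := (sgdState q lam ν z m).1 with hw
      have h1 := leaky_sub_le h w u (z m)
      set s : ℝ := if 0 ≤ -(lab (z m).2 * inner ℝ w (z m).1) then 1 - lam else lam with hs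
      have hs0 : 0 ≤ s := by rw [hs]; split_ifs <;> linarith
      have hs1 : s ≤ 1 := by rw [hs]; split_ifs <;> linarith
      have h2 : ‖(Alg.sgdStep lam ν (sgdState q lam ν z m) (z m)).1 - u‖ ^ 2 ≤
          ‖(ν * s * lab (z m).2) • (z m).1 + w - u‖ ^ 2 := norm_clip_sub_le _ hu
      have h3 : ‖(ν * s * lab (z m).2) • (z m).1 + w - u‖ ^ 2 ≤
          ‖w - u‖ ^ 2 - 2 * ν * (s * lab (z m).2 * inner ℝ (u - w) (z m).1) + ν ^ 2 := by
        rw [add_sub_assoc, norm_add_sq_real, real_inner_smul_left, norm_smul,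
          show w - u = -(u - w) by abel, inner_neg_right, real_inner_comm, norm_neg]
        have h4 : (‖ν * s * lab (z m).2‖ * ‖(z m).1‖) ^ 2 ≤ ν ^ 2 := by
          refine pow_le_pow_left₀ (by positivity) ?_ 2
          rw [norm_mul, norm_mul, Real.norm_eq_abs (lab _), abs_lab, Real.norm_of_nonneg hν,
            Real.norm_of_nonneg hs0, mul_one, mul_assoc]
          exact mul_le_of_le_one_right hν (mul_le_one₀ hs1 (norm_nonneg _) (hz m (by omega)))
        linarith
      have h5 : 2 * ν * (leaky lam w (z m) - leaky lam u (z m)) ≤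
          2 * ν * (s * lab (z m).2 * inner ℝ (u - w) (z m).1) :=
        mul_le_mul_of_nonneg_left h1 (by linarith)
      linarith
    · have : 0 ≤ ν ^ 2 := sq_nonneg ν
      linarith

/-! ### Thresholds -/

/-- A weighted sum of absolute values is an average of the weighted numbers of the terms above a
threshold; so if the sum is negative, the number is negative for some threshold. -/
theorem exists_threshold {lam κ : ℝ} (hκ : 0 < κ) (M : List (ℝ × Bool))
    (hM : ∀ a ∈ M, |a.1| ≤ 1)
    (hsum : (M.map fun a => ((if lab a.2 * a.1 < 0 then 1 else 0) - lam) * |a.1|).sum ≤ -(2 * κ)) :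
    ∃ τ ∈ M.map fun a => |a.1|, 0 < τ ∧
      ((Alg.annulus M τ).countP fun a => decide (lab a.2 * a.1 < 0) : ℝ) -
        lam * (Alg.annulus M τ).length ≤ -κ := by
  set c : ℝ × Bool → ℝ := fun a => (if lab a.2 * a.1 < 0 then 1 else 0) - lam with hc
  set g : ℝ → ℝ := fun t => (M.map fun a => if t ≤ |a.1| then c a else 0).sum with hg
  have hcount : ∀ τ, ((Alg.annulus M τ).countP fun a => decide (lab a.2 * a.1 < 0) : ℝ) -
      lam * (Alg.annulus M τ).length = g τ := by
    intro τ
    simp only [hg, Alg.annulus]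
    clear hsum hM hg g
    induction M with
    | nil => simp
    | cons a M ih =>
      rw [List.map_cons, List.sum_cons, ← ih, List.filter_cons]
      by_cases ha : τ ≤ |a.1|
      · simp only [ha, decide_true, if_true, List.countP_cons, List.length_cons, hc]
        by_cases hb : lab a.2 * a.1 < 0
        · simp only [hb, decide_true, if_true]; push_cast; ring
        · simp only [hb, decide_false, if_false, Bool.false_eq_true]; push_cast; ring
      · simp [ha]
  -- `g` is constant between consecutive values of `|a.1|`, so it exceeds `-κ` everywhere, and its
  -- integral over `(0, 1]` is the given sum
  by_contra! hcon
  have hlow : ∀ t, 0 < t → -κ ≤ g t := by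
    intro t ht
    by_cases hex : ∃ a ∈ M, t ≤ |a.1|
    · obtain ⟨a₀, ha₀, hmin⟩ := Finset.exists_min_image
        (M.toFinset.filter fun a => t ≤ |a.1|) (fun a => |a.1|) (by
          obtain ⟨a, ha, hta⟩ := hex
          exact ⟨a, by simp [ha, hta]⟩)
      simp only [Finset.mem_filter, List.mem_toFinset] at ha₀ hmin
      have h1 : g t = g |a₀.1| := by
        simp only [hg]
        congr 1
        refine List.map_congr_left fun a ha => ?_
        by_cases hta : t ≤ |a.1|
        · rw [if_pos hta, if_pos (hmin a ⟨ha, hta⟩)]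
        · rw [if_neg hta, if_neg fun h => hta (ha₀.2.trans h)]
      rw [h1, ← hcount]
      exact (hcon _ (List.mem_map_of_mem ha₀.1) (ht.trans_le ha₀.2)).le
    · push Not at hex
      have : g t = 0 := by
        refine List.sum_eq_zero fun x hx => ?_
        obtain ⟨a, ha, rfl⟩ := List.mem_map.1 hx
        exact if_neg (not_le.2 (hex a ha))
      linarith
  have hint : IntegrableOn g (Set.Ioc 0 1) ∧ ∫ t in Set.Ioc (0 : ℝ) 1, g t =
      (M.map fun a => c a * |a.1|).sum := by
    simp only [hg]
    clear hlow hcon hcount hsum hg g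
    induction M with
    | nil => simp
    | cons a M ih =>
      obtain ⟨ih1, ih2⟩ := ih fun b hb => hM b (by simp [hb])
      have ha := hM a (by simp)
      have e : (fun t : ℝ => if t ≤ |a.1| then c a else 0) =
          (Set.Iic |a.1|).indicator fun _ => c a := by
        funext t; simp [Set.indicator_apply]
      have i1 : IntegrableOn (fun t : ℝ => if t ≤ |a.1| then c a else 0) (Set.Ioc 0 1) := by
        rw [e]
        exact (integrableOn_const (by simp)).indicator measurableSet_Iic
      simp only [List.map_cons, List.sum_cons]
      refine ⟨i1.add ih1, ?_⟩
      rw [integral_add i1 ih1, ih2, e, setIntegral_indicator measurableSet_Iic]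
      congr 1
      have : Set.Ioc (0 : ℝ) 1 ∩ Set.Iic |a.1| = Set.Ioc 0 |a.1| := by
        ext t
        simp only [Set.mem_inter_iff, Set.mem_Ioc, Set.mem_Iic]
        constructor
        · rintro ⟨⟨h1, h2⟩, h3⟩; exact ⟨h1, h3⟩
        · rintro ⟨h1, h2⟩; exact ⟨⟨h1, h2.trans ha⟩, h2⟩
      rw [this, setIntegral_const, Measure.real, Real.volume_Ioc, ENNReal.toReal_ofReal (by simp)]
      simp [mul_comm]
  have h1 : ∫ _ in Set.Ioc (0 : ℝ) 1, -κ ≤ ∫ t in Set.Ioc (0 : ℝ) 1, g t :=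
    setIntegral_mono_on (integrableOn_const (by simp)) hint.1 measurableSet_Ioc
      fun t ht => hlow t ht.1
  rw [hint.2, setIntegral_const] at h1
  simp at h1
  linarith

/-! ### The leaky loss of the true direction -/

/-- Chebyshev's association inequality for an antitone function of a nonnegative variable. -/
theorem integral_antitone_mul_le {Z : Type*} [MeasurableSpace Z] {ν : Measure Z}
    [IsFiniteMeasure ν] {u : Z → ℝ} {h : ℝ → ℝ} (hh : Antitone h) (hu : Integrable u ν)
    (hhu : Integrable (fun z => h (u z)) ν) (hmul : Integrable (fun z => h (u z) * u z) ν)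
    (hν : 0 < ν.real Set.univ) :
    ν.real Set.univ * ∫ z, h (u z) * u z ∂ν ≤ (∫ z, h (u z) ∂ν) * ∫ z, u z ∂ν := by
  set m := ν.real Set.univ with hm
  set c := (∫ z, u z ∂ν) / m with hc
  have hcm : m * c = ∫ z, u z ∂ν := by rw [hc]; field_simp
  -- compare `u` with its mean `c`: the two factors have opposite signs
  have h1 : ∀ z, (h (u z) - h c) * (u z - c) ≤ 0 := fun z => by
    rcases le_total (u z) c with hz | hz
    · exact mul_nonpos_of_nonneg_of_nonpos (sub_nonneg.2 (hh hz)) (sub_nonpos.2 hz)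
    · exact mul_nonpos_of_nonpos_of_nonneg (sub_nonpos.2 (hh hz)) (sub_nonneg.2 hz)
  have h2 : ∫ z, (h (u z) - h c) * (u z - c) ∂ν ≤ 0 := integral_nonpos h1
  have h3 : ∫ z, (h (u z) - h c) * (u z - c) ∂ν =
      ∫ z, h (u z) * u z ∂ν - c * ∫ z, h (u z) ∂ν - h c * ∫ z, u z ∂ν + h c * (m * c) := by
    have e : (fun z => (h (u z) - h c) * (u z - c)) =
        fun z => h (u z) * u z - c * h (u z) - h c * u z + h c * c := by funext z; ring
    rw [e, integral_add, integral_sub, integral_sub, integral_const_mul, integral_const_mul,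
      integral_const]
    · simp only [smul_eq_mul, ← hm]; ring
    · exact hmul
    · exact hhu.const_mul c
    · exact hmul.sub (hhu.const_mul c)
    · exact hu.const_mul _
    · exact (hmul.sub (hhu.const_mul c)).sub (hu.const_mul _)
    · exact integrable_const _
  rw [h3, hcm] at h2
  have h4 : ∫ z, h (u z) * u z ∂ν ≤ c * ∫ z, h (u z) ∂ν := by linarith
  calc m * ∫ z, h (u z) * u z ∂ν ≤ m * (c * ∫ z, h (u z) ∂ν) :=
        mul_le_mul_of_nonneg_left h4 hν.le
    _ = _ := by rw [← mul_assoc, hcm, mul_comm]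

/-- The largest Bayes-like error `(1 - σ |⟨w, x⟩|) / 2 + ζ` at a point. -/
noncomputable def optErr (σ : ℝ → ℝ) (ζ : ℝ) (w : Pt d) (z : Example d) : ℝ :=
  (1 - σ |inner ℝ w z.1|) / 2 + ζ

theorem IsMisspecifiedGLM.abs_inner_le {ζ : ℝ} {σ : ℝ → ℝ} {w : Pt d}
    {D : Measure (Example d)} (hw : ‖w‖ ≤ 1) (h : IsMisspecifiedGLM ζ σ w D) :
    ∀ᵐ z ∂D, |inner ℝ w z.1| ≤ 1 :=
  h.support.mono fun _ hz =>
    (abs_real_inner_le_norm _ _).trans (mul_le_one₀ hw (norm_nonneg _) hz)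

section GLM

variable {ζ : ℝ} {σ : ℝ → ℝ} {L : ℝ≥0} {w : Pt d} {D : Measure (Example d)}
  [IsProbabilityMeasure D]

theorem measurable_abs_inner (w : Pt d) : Measurable fun z : Example d => |inner ℝ w z.1| :=
  (measurable_const.inner measurable_fst).abs

theorem IsLink.abs_sub_le (hσ : IsLink L σ) (t : ℝ) (ht : 0 ≤ t) : σ t ≤ L * t := by
  have h0 : σ 0 = 0 := by
    have := hσ.odd 0
    rw [neg_zero] at this
    linarith
  have := hσ.lipschitz.dist_le_mul t 0
  rw [h0, Real.dist_eq, Real.dist_eq, sub_zero, sub_zero, abs_of_nonneg ht] at this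
  exact (le_abs_self _).trans this

theorem IsLink.measurable_comp (hσ : IsLink L σ) (w : Pt d) :
    Measurable fun z : Example d => σ |inner ℝ w z.1| :=
  hσ.mono.measurable.comp (measurable_abs_inner w)

theorem IsLink.integrable_comp (hσ : IsLink L σ) (w : Pt d) :
    Integrable (fun z : Example d => σ |inner ℝ w z.1|) D :=
  Integrable.of_bound (hσ.measurable_comp w).aestronglyMeasurable 1
    (Filter.Eventually.of_forall fun _ => hσ.bound _)

theorem IsLink.integrable_optErr (hσ : IsLink L σ) (w : Pt d) :
    Integrable (optErr σ ζ w) D :=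
  (((integrable_const 1).sub (hσ.integrable_comp w)).div_const 2).add (integrable_const ζ)

theorem IsMisspecifiedGLM.integrable_abs_inner (hw : ‖w‖ ≤ 1) (h : IsMisspecifiedGLM ζ σ w D) :
    Integrable (fun z : Example d => |inner ℝ w z.1|) D :=
  Integrable.of_bound (measurable_abs_inner w).aestronglyMeasurable 1
    ((h.abs_inner_le hw).mono fun _ hz => by rwa [Real.norm_eq_abs, abs_abs])

theorem integrable_leaky (hD : ∀ᵐ z ∂D, ‖z.1‖ ≤ 1) (lam : ℝ) (w : Pt d) :
    Integrable (leaky lam w) D := by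
  refine Integrable.of_bound ((measurable_leaky lam).comp
    measurable_prodMk_left).aestronglyMeasurable ((|1 / 2 - lam| + 1 / 2) * ‖w‖)
    (hD.mono fun z hz => ?_)
  have h1 : |inner ℝ w z.1| ≤ ‖w‖ :=
    (abs_real_inner_le_norm _ _).trans (mul_le_of_le_one_right (norm_nonneg _) hz)
  rw [Real.norm_eq_abs]
  refine (abs_sub _ _).trans ?_
  rw [abs_mul, abs_abs, abs_mul, abs_mul, abs_lab, one_mul, abs_of_pos (by norm_num : (0:ℝ) < 1 / 2)]
  have := mul_le_mul_of_nonneg_left h1 (abs_nonneg (1 / 2 - lam))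
  linarith

/-- On every region, the label correlates with the true direction at least as well as the link and
the misspecification predict. -/
theorem IsMisspecifiedGLM.le_integral_label (hσ : IsLink L σ) (hw : ‖w‖ ≤ 1)
    (h : IsMisspecifiedGLM ζ σ w D) {R : Set (Pt d)} (hR : MeasurableSet R) :
    ∫ z in Prod.fst ⁻¹' R, (σ |inner ℝ w z.1| - 2 * ζ) * |inner ℝ w z.1| ∂D ≤
      ∫ z in Prod.fst ⁻¹' R, lab z.2 * inner ℝ w z.1 ∂D := by
  classical
  obtain ⟨η, hη, hcond⟩ := h.model
  set m : MeasurableSpace (Example d) := MeasurableSpace.comap Prod.fst inferInstance with hm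
  have hle : m ≤ (Prod.instMeasurableSpace : MeasurableSpace (Pt d × Bool)) :=
    measurable_fst.comap_le
  set f : Example d → ℝ := (Prod.fst ⁻¹' R).indicator fun z => inner ℝ w z.1 with hf
  have hRm : MeasurableSet[m] ((Prod.fst : Example d → Pt d) ⁻¹' R) := ⟨R, hR, rfl⟩
  have hfm : StronglyMeasurable[m] f := by
    refine StronglyMeasurable.indicator ?_ hRm
    have : Measurable[m] fun z : Example d => (inner ℝ w z.1 : ℝ) :=
      (measurable_const.inner measurable_id).comp (comap_measurable _)
    exact this.stronglyMeasurable
  have hfb : ∀ᵐ z ∂D, ‖f z‖ ≤ 1 := (h.abs_inner_le hw).mono fun z hz => by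
    rw [hf, Set.indicator_apply]
    split_ifs
    · exact hz
    · simp
  have hY : Integrable (fun z : Example d => lab z.2) D :=
    Integrable.of_bound (measurable_lab.comp measurable_snd).aestronglyMeasurable 1
      (Filter.Eventually.of_forall fun z => by rw [Real.norm_eq_abs, abs_lab])
  have hfae : AEStronglyMeasurable[Prod.instMeasurableSpace] f D := (hfm.mono hle).aestronglyMeasurable
  have hfY : Integrable (f * fun z : Example d => lab z.2) D := hY.bdd_mul hfae hfb
  -- condition the label on the point, on which the other factor depends
  have h1 : ∫ z in Prod.fst ⁻¹' R, lab z.2 * inner ℝ w z.1 ∂D =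
      ∫ z, f z * (D[fun z => lab z.2 | m]) z ∂D := by
    have e := condExp_mul_of_stronglyMeasurable_left (μ := D) hfm hfY hY
    calc ∫ z in Prod.fst ⁻¹' R, lab z.2 * inner ℝ w z.1 ∂D
        = ∫ z, (f * fun z : Example d => lab z.2) z ∂D := by
          rw [← integral_indicator (hle _ hRm)]
          congr 1
          funext z
          simp only [hf, Pi.mul_apply, Set.indicator_apply]
          split_ifs
          · ring
          · simp
      _ = ∫ z, (D[f * fun z : Example d => lab z.2 | m]) z ∂D := (integral_condExp hle).symm
      _ = _ := integral_congr_ae e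
  rw [h1, ← integral_indicator (hle _ hRm)]
  refine integral_mono_ae ?_ (integrable_condExp.bdd_mul hfae hfb) ?_
  · refine Integrable.indicator ?_ (hle _ hRm)
    refine Integrable.of_bound (((hσ.measurable_comp w).sub_const _).mul
      (measurable_abs_inner w)).aestronglyMeasurable (1 + |2 * ζ|) ?_
    refine (h.abs_inner_le hw).mono fun z hz => ?_
    rw [Real.norm_eq_abs, abs_mul, abs_abs]
    refine (mul_le_of_le_one_right (abs_nonneg _) hz).trans ((abs_sub _ _).trans ?_)
    have := hσ.bound |inner ℝ w z.1|
    linarith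
  · filter_upwards [hcond] with z hz
    simp only [hf, Set.indicator_apply]
    split_ifs
    swap
    · simp
    rw [hz]
    set v : ℝ := inner ℝ w z.1 with hv
    have hη1 := (hη z.1).1
    rw [← hv] at hη1
    -- the misspecification opposes the sign of `v` by at most `2ζ`
    rcases lt_trichotomy v 0 with h0 | h0 | h0
    · rw [Real.sign_of_neg h0] at hη1
      rw [abs_of_neg h0, hσ.odd]
      nlinarith
    · rw [h0]; simp
    · rw [Real.sign_of_pos h0] at hη1
      rw [abs_of_pos h0]
      nlinarith

/-- The leaky loss of the true direction on a region, compared with the error allowed there. -/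
theorem IsMisspecifiedGLM.integral_leaky_le (hσ : IsLink L σ) (hw : ‖w‖ ≤ 1)
    (h : IsMisspecifiedGLM ζ σ w D) {R : Set (Pt d)} (hR : MeasurableSet R)
    (hpos : 0 < D.real (Prod.fst ⁻¹' R)) (lam : ℝ) :
    D.real (Prod.fst ⁻¹' R) * ∫ z in Prod.fst ⁻¹' R, leaky lam w z ∂D ≤
      (∫ z in Prod.fst ⁻¹' R, (optErr σ ζ w z - lam) ∂D) *
        ∫ z in Prod.fst ⁻¹' R, |inner ℝ w z.1| ∂D := by
  set S : Set (Example d) := Prod.fst ⁻¹' R with hS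
  have hu : Integrable (fun z : Example d => |inner ℝ w z.1|) D := h.integrable_abs_inner hw
  have hY : Integrable (fun z : Example d => lab z.2 * inner ℝ w z.1) D :=
    Integrable.of_bound ((measurable_lab.comp measurable_snd).mul
      (measurable_const.inner measurable_fst)).aestronglyMeasurable 1
      ((h.abs_inner_le hw).mono fun z hz => by
        rwa [Real.norm_eq_abs, abs_mul, abs_lab, one_mul])
  have hmul : Integrable (fun z => (optErr σ ζ w z - lam) * |inner ℝ w z.1|) D := by
    refine ((hσ.integrable_optErr w).sub (integrable_const lam)).mul_bdd
      (measurable_abs_inner w).aestronglyMeasurable (c := 1) ?_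
    exact (h.abs_inner_le hw).mono fun z hz => by rwa [Real.norm_eq_abs, abs_abs]
  -- the margin `|⟨w, x⟩|` weights the difference of allowed error and leakage; as the allowed
  -- error is antitone in the margin, the association inequality separates the two factors
  have h1 : ∫ z in S, leaky lam w z ∂D ≤ ∫ z in S, (optErr σ ζ w z - lam) * |inner ℝ w z.1| ∂D := by
    have e := h.le_integral_label hσ hw hR
    have e1 : ∫ z in S, leaky lam w z ∂D = (1 / 2 - lam) * ∫ z in S, |inner ℝ w z.1| ∂D -
        1 / 2 * ∫ z in S, lab z.2 * inner ℝ w z.1 ∂D := by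
      unfold leaky
      rw [integral_sub (hu.integrableOn.const_mul _) (hY.integrableOn.const_mul _),
        integral_const_mul, integral_const_mul]
    have e2 : ∫ z in S, (optErr σ ζ w z - lam) * |inner ℝ w z.1| ∂D =
        (1 / 2 - lam) * ∫ z in S, |inner ℝ w z.1| ∂D -
        1 / 2 * ∫ z in S, (σ |inner ℝ w z.1| - 2 * ζ) * |inner ℝ w z.1| ∂D := by
      have hi : Integrable (fun z : Example d => (σ |inner ℝ w z.1| - 2 * ζ) * |inner ℝ w z.1|) D := by
        refine ((hσ.integrable_comp w).sub (integrable_const _)).mul_bdd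
          (measurable_abs_inner w).aestronglyMeasurable (c := 1) ?_
        exact (h.abs_inner_le hw).mono fun z hz => by rwa [Real.norm_eq_abs, abs_abs]
      rw [← integral_const_mul, ← integral_const_mul, ← integral_sub]
      · congr 1
        funext z
        unfold optErr
        ring
      · exact hu.integrableOn.const_mul _
      · exact hi.integrableOn.const_mul _
    rw [e1, e2]
    linarith
  have h2 := integral_antitone_mul_le (ν := D.restrict S) (u := fun z => |inner ℝ w z.1|)
    (h := fun t => (1 - σ t) / 2 + ζ - lam) (fun a b hab => by
      have := hσ.mono hab
      simp only
      linarith) hu.integrableOn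
    (((hσ.integrable_optErr w).sub (integrable_const lam)).integrableOn)
    hmul.integrableOn (by simpa using hpos)
  rw [measureReal_restrict_apply_univ] at h2
  exact (mul_le_mul_of_nonneg_left h1 hpos.le).trans h2

end GLM

/-! ### Partitions that depend on the stream -/

/-- A partition that depends on the stream `ω`, in a measurable way, through its first `n` terms. -/
structure Predictable (p : (ℕ → Example d) → List (Step d)) (n : ℕ) : Prop where
  measurable : Measurable fun q : (ℕ → Example d) × Pt d => regionOf (p q.1) q.2
  dependsOn : DependsOn p (Set.Iio n)

theorem Predictable.mono {p : (ℕ → Example d) → List (Step d)} {n n' : ℕ} (h : Predictable p n)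
    (hn : n ≤ n') : Predictable p n' :=
  ⟨h.measurable, fun _ _ hx => h.dependsOn fun j hj => hx j (lt_of_lt_of_le hj hn)⟩

theorem predictable_nil (n : ℕ) : Predictable (fun _ => ([] : List (Step d))) n :=
  ⟨measurable_const, fun _ _ _ => rfl⟩

theorem Predictable.merge {p : (ℕ → Example d) → List (Step d)} {n : ℕ} (h : Predictable p n)
    (i j : ℕ) : Predictable (fun ω => Step.merge i j :: p ω) n := by
  refine ⟨?_, fun ω ω' hω => by simp only [h.dependsOn hω]⟩
  simp only [regionOf]
  exact Measurable.ite (h.measurable (measurableSet_singleton j)) measurable_const h.measurable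

theorem Predictable.cut {p : (ℕ → Example d) → List (Step d)} {n : ℕ} (h : Predictable p n)
    (i : ℕ) {w : (ℕ → Example d) → Pt d} {τ : (ℕ → Example d) → ℝ} (t : Bool) (j : ℕ)
    (hw : Measurable w) (hτ : Measurable τ) (hw' : DependsOn w (Set.Iio n))
    (hτ' : DependsOn τ (Set.Iio n)) :
    Predictable (fun ω => Step.cut i (w ω) (τ ω) t j :: p ω) n := by
  refine ⟨?_, fun ω ω' hω => by simp only [h.dependsOn hω, hw' hω, hτ' hω]⟩
  simp only [regionOf]
  refine Measurable.ite ?_ measurable_const h.measurable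
  refine (h.measurable (measurableSet_singleton i)).inter ?_
  exact measurableSet_le (hτ.comp measurable_fst)
    (((hw.comp measurable_fst).inner measurable_snd).const_mul _)

theorem measurable_clip : Measurable (Alg.clip : Pt d → Pt d) := by
  unfold Alg.clip
  exact Measurable.ite (measurableSet_lt measurable_const measurable_norm)
    (measurable_norm.inv.smul measurable_id) measurable_id

theorem measurable_sgdStep (lam ν : ℝ) :
    Measurable fun q : (Pt d × Pt d) × Example d => Alg.sgdStep lam ν q.1 q.2 := by
  have h1 : Measurable fun q : (Pt d × Pt d) × Example d => (inner ℝ q.1.1 q.2.1 : ℝ) :=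
    measurable_fst.fst.inner measurable_snd.fst
  have h2 : Measurable fun q : (Pt d × Pt d) × Example d => lab q.2.2 :=
    measurable_lab.comp measurable_snd.snd
  unfold Alg.sgdStep
  refine Measurable.prodMk (measurable_clip.comp (Measurable.add ?_ measurable_fst.fst))
    ((measurable_fst.fst.const_smul (1 : ℝ)).add measurable_fst.snd)
  refine Measurable.smul (Measurable.mul (Measurable.const_mul ?_ ν) h2) measurable_snd.fst
  exact Measurable.ite (measurableSet_le measurable_const (h2.mul h1).neg) measurable_const
    measurable_const

/-- The test for membership in region `i` of a partition. -/
noncomputable def inRegion (p : List (Step d)) (i : ℕ) (z : Example d) : Bool :=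
  decide (regionOf p z.1 = i)

/-- The state of SGD on region `i` after it has seen `k` examples of the batch at position `pos`. -/
noncomputable def sgdRun (p : (ℕ → Example d) → List (Step d)) (i : ℕ) (lam ν : ℝ) (pos k : ℕ)
    (ω : ℕ → Example d) : Pt d × Pt d :=
  sgdState (inRegion (p ω) i) lam ν (fun j => ω (pos + j)) k

theorem Predictable.measurable_eval {p : (ℕ → Example d) → List (Step d)} {n : ℕ}
    (h : Predictable p n) (j : ℕ) : Measurable fun ω => regionOf (p ω) (ω j).1 :=
  h.measurable.comp (measurable_id.prodMk (measurable_pi_apply j).fst)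

theorem Predictable.measurable_sgdRun {p : (ℕ → Example d) → List (Step d)} {n : ℕ}
    (h : Predictable p n) (i : ℕ) (lam ν : ℝ) (pos k : ℕ) :
    Measurable (sgdRun p i lam ν pos k) := by
  induction k with
  | zero => exact measurable_const
  | succ k ih =>
    have : sgdRun p i lam ν pos (k + 1) = fun ω => if regionOf (p ω) (ω (pos + k)).1 = i then
        Alg.sgdStep lam ν (sgdRun p i lam ν pos k ω) (ω (pos + k)) else
        sgdRun p i lam ν pos k ω := by
      funext ω
      simp only [sgdRun, sgdState, inRegion, decide_eq_true_eq]
    rw [this]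
    have h1 : MeasurableSet {ω | regionOf (p ω) (ω (pos + k)).1 = i} :=
      h.measurable_eval (pos + k) (measurableSet_singleton i)
    have h2 : Measurable fun ω : ℕ → Example d =>
        Alg.sgdStep lam ν (sgdRun p i lam ν pos k ω) (ω (pos + k)) :=
      (measurable_sgdStep lam ν).comp (f := fun ω => (sgdRun p i lam ν pos k ω, ω (pos + k)))
        (ih.prodMk (measurable_pi_apply (pos + k)))
    exact Measurable.ite h1 h2 ih

theorem sgdState_congr {q : Example d → Bool} {lam ν : ℝ} {z z' : ℕ → Example d} {k : ℕ}
    (h : ∀ j < k, z j = z' j) : sgdState q lam ν z k = sgdState q lam ν z' k := by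
  induction k with
  | zero => rfl
  | succ k ih =>
    simp only [sgdState]
    rw [ih fun j hj => h j (by omega), h k (by omega)]

theorem Predictable.dependsOn_sgdRun {p : (ℕ → Example d) → List (Step d)} {n : ℕ}
    (h : Predictable p n) (i : ℕ) (lam ν : ℝ) (pos k : ℕ) :
    DependsOn (sgdRun p i lam ν pos k) (Set.Iio n ∪ Set.Ico pos (pos + k)) := by
  intro ω ω' hω
  unfold sgdRun
  rw [h.dependsOn fun j hj => hω j (Or.inl hj)]
  exact sgdState_congr fun j hj => hω _ (Or.inr ⟨by omega, by omega⟩)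

/-! ### Prescribed sequences of decisions -/

/-! The algorithm adapts its queries to the examples.  But every discrete decision it makes (which
region, leakage parameter and threshold to use, whether to split, and what to merge) comes from
a finite set, and once all these decisions are prescribed, the partition is an explicit measurable
function of the stream.  The sequences of decisions are few enough for a union bound, so no
measurability of the decisions themselves is needed. -/

section Trace

variable (K : Constants) (P : Params)

/-- The direction that SGD finds for region `i` and the `k`-th leakage parameter, in a round that
starts at position `n`. -/
noncomputable def roundDir (p : (ℕ → Example d) → List (Step d)) (n i k : ℕ)
    (ω : ℕ → Example d) : Pt d :=
  Alg.sgdOut K P ω (p ω) i (n + 2 * P.batch K) k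

/-- The threshold obtained from the `a`-th example of the batch of thresholds, in a round that
starts at position `n`. -/
noncomputable def roundThr (p : (ℕ → Example d) → List (Step d)) (n i k a : ℕ)
    (ω : ℕ → Example d) : ℝ :=
  |inner ℝ (roundDir K P p n i k ω) (ω (n + 3 * P.batch K + a)).1|

/-- The partition after the cut that the given decisions determine. -/
noncomputable def roundCut (p : (ℕ → Example d) → List (Step d)) (n i k a : ℕ) (t : Bool) (j : ℕ)
    (ω : ℕ → Example d) : List (Step d) :=
  Step.cut i (roundDir K P p n i k ω) (roundThr K P p n i k a ω) t j :: p ω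

theorem roundDir_eq (p : (ℕ → Example d) → List (Step d)) (n i k : ℕ) (ω : ℕ → Example d) :
    roundDir K P p n i k ω =
      ‖(sgdRun p i (P.ε / 4 * k) (1 / Real.sqrt (P.batch K))
        (Alg.sgdPos K P (n + 2 * P.batch K) k) (P.batch K) ω).2‖⁻¹ •
      (sgdRun p i (P.ε / 4 * k) (1 / Real.sqrt (P.batch K))
        (Alg.sgdPos K P (n + 2 * P.batch K) k) (P.batch K) ω).2 := by
  simp only [roundDir, Alg.sgdOut, Alg.dirAt, Alg.sgdDir, Alg.batchIn, Alg.batch, sgdRun]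
  rw [← foldl_sgdStep]
  rfl

/-- The coordinates on which `roundDir` depends. -/
def dirCoords (n k : ℕ) : Set ℕ :=
  Set.Iio n ∪ Set.Ico (Alg.sgdPos K P (n + 2 * P.batch K) k)
    (Alg.sgdPos K P (n + 2 * P.batch K) k + P.batch K)

variable {K P} {p : (ℕ → Example d) → List (Step d)} {n : ℕ}

theorem Predictable.measurable_roundDir (h : Predictable p n) (i k : ℕ) :
    Measurable (roundDir K P p n i k) := by
  have e := h.measurable_sgdRun i (P.ε / 4 * k) (1 / Real.sqrt (P.batch K))
    (Alg.sgdPos K P (n + 2 * P.batch K) k) (P.batch K)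
  rw [funext (roundDir_eq K P p n i k)]
  exact e.snd.norm.inv.smul e.snd

theorem Predictable.dependsOn_roundDir (h : Predictable p n) (i k : ℕ) :
    DependsOn (roundDir K P p n i k) (dirCoords K P n k) := by
  intro ω ω' hω
  rw [roundDir_eq, roundDir_eq, h.dependsOn_sgdRun i _ _ _ _ hω]

theorem Predictable.measurable_roundThr (h : Predictable p n) (i k a : ℕ) :
    Measurable (roundThr K P p n i k a) :=
  ((h.measurable_roundDir i k).inner (measurable_pi_apply _).fst).abs

theorem Predictable.dependsOn_roundThr (h : Predictable p n) (i k a : ℕ) :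
    DependsOn (roundThr K P p n i k a)
      (dirCoords K P n k ∪ {n + 3 * P.batch K + a}) := by
  intro ω ω' hω
  unfold roundThr
  rw [h.dependsOn_roundDir i k fun j hj => hω j (Or.inl hj), hω _ (Or.inr rfl)]

theorem dirCoords_subset (n k : ℕ) :
    dirCoords K P n k ⊆ Set.Iio n ∪
      Set.Ico (n + 4 * P.batch K) (n + (P.grid + 5) * P.batch K) := by
  intro j hj
  rcases hj with hj | hj
  · exact Or.inl hj
  · right
    simp only [Alg.sgdPos, Set.mem_Ico] at hj ⊢
    have h1 : (P.grid - k) * P.batch K ≤ P.grid * P.batch K :=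
      Nat.mul_le_mul_right _ (Nat.sub_le _ _)
    constructor
    · linarith [hj.1, Nat.zero_le ((P.grid - k) * P.batch K)]
    · linarith [hj.2]

theorem Predictable.roundCut (h : Predictable p n) (i k : ℕ) {a : ℕ} (ha : a < P.batch K)
    (t : Bool) (j : ℕ) :
    Predictable (roundCut K P p n i k a t j) (n + (P.grid + 5) * P.batch K) := by
  have hsub : dirCoords K P n k ⊆ Set.Iio (n + (P.grid + 5) * P.batch K) := fun x hx => by
    rcases dirCoords_subset n k hx with hx | hx
    · exact lt_of_lt_of_le hx (Nat.le_add_right _ _)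
    · exact hx.2
  refine (h.mono (Nat.le_add_right _ _)).cut i t j (h.measurable_roundDir i k)
    (h.measurable_roundThr i k a) (fun _ _ hx => h.dependsOn_roundDir i k fun x hxs =>
      hx x (hsub hxs)) (fun _ _ hx => h.dependsOn_roundThr i k a fun x hxs => hx x ?_)
  rcases hxs with hxs | rfl
  · exact hsub hxs
  · rw [Set.mem_Iio]
    linarith [Nat.zero_le (P.grid * P.batch K), Nat.zero_le (P.batch K)]

variable (K P) in
/-- The discrete decisions of one round: freezing a region (with or without the estimation of
a candidate) or splitting and perhaps merging.  Region names are below `I`. -/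
abbrev Decision (I : ℕ) : Type :=
  Bool ⊕ (Fin I × Fin (P.grid + 1) × Fin (P.batch K) × Bool × Fin I × Option (Fin I × Fin I))

variable (K P) in
/-- The partition and the position in the stream to which a sequence of decisions leads. -/
noncomputable def trace {d : ℕ} {I : ℕ} :
    List (Decision K P I) → ((ℕ → Example d) → List (Step d)) × ℕ
  | [] => (fun _ => [], P.batch K)
  | Sum.inl false :: l => ((trace l).1, (trace (d := d) l).2 + (P.grid + 5) * P.batch K)
  | Sum.inl true :: l => ((trace l).1, (trace (d := d) l).2 + (P.grid + 6) * P.batch K)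
  | Sum.inr (i, k, a, t, j, none) :: l =>
      (_root_.roundCut K P (trace l).1 (trace (d := d) l).2 i k a t j,
        (trace (d := d) l).2 + (P.grid + 7) * P.batch K)
  | Sum.inr (i, k, a, t, j, some (i', j')) :: l =>
      (fun ω => Step.merge i' j' ::
        _root_.roundCut K P (trace l).1 (trace (d := d) l).2 i k a t j ω,
        (trace (d := d) l).2 + (P.grid + 7) * P.batch K)

/-- Prescribed decisions lead to a partition that depends on the past examples only. -/
theorem predictable_trace {I : ℕ} : ∀ l : List (Decision K P I),
    Predictable (trace (d := d) K P l).1 (trace (d := d) K P l).2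
  | [] => predictable_nil _
  | Sum.inl false :: l => (predictable_trace l).mono (Nat.le_add_right _ _)
  | Sum.inl true :: l => (predictable_trace l).mono (Nat.le_add_right _ _)
  | Sum.inr (i, k, a, t, j, none) :: l =>
      ((predictable_trace l).roundCut i k a.2 t j).mono (by simp only [trace]; gcongr; omega)
  | Sum.inr (i, k, a, t, j, some (i', j')) :: l =>
      (((predictable_trace l).roundCut i k a.2 t j).merge i' j').mono
        (by simp only [trace]; gcongr; omega)

end Trace

/-! ### The good event -/

/-- The examples in region `i` with label `b`. -/
def atom (p : List (Step d)) (i : ℕ) (b : Bool) : Set (Example d) :=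
  {z | regionOf p z.1 = i ∧ z.2 = b}

/-- The examples in region `i` on the side `t` of an annulus, with label `b`. -/
def sideAtom (p : List (Step d)) (i : ℕ) (w : Pt d) (τ : ℝ) (t b : Bool) : Set (Example d) :=
  {z | regionOf p z.1 = i ∧ τ ≤ lab t * inner ℝ w z.1 ∧ z.2 = b}

/-- The number of examples of the batch of size `m` at position `pos` that lie in `E`. -/
noncomputable def hits (ω : ℕ → Example d) (pos m : ℕ) (E : Set (Example d)) : ℝ :=
  ∑ j ∈ Finset.range m, E.indicator 1 (ω (pos + j))

/-- The empirical frequency of `E` in a batch is within `α` of its probability. -/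
def Accurate (D : Measure (Example d)) (ω : ℕ → Example d) (pos m : ℕ) (α : ℝ)
    (E : Set (Example d)) : Prop :=
  |hits ω pos m E - m * D.real E| ≤ m * α

section Probability

variable (D : Measure (Example d)) [IsProbabilityMeasure D]

/-- The bound for the probability that one estimate fails. -/
noncomputable def failProb (m : ℕ) (α : ℝ) : ENNReal :=
  2 * ENNReal.ofReal (Real.exp (-(m * α ^ 2 / 4)))

theorem two_mul_exp_le_failProb {m : ℕ} {α c : ℝ} (h : m * α ^ 2 / 4 ≤ c) :
    2 * ENNReal.ofReal (Real.exp (-c)) ≤ failProb m α := by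
  unfold failProb
  gcongr

/-- The frequency of an event in a batch is close to its probability, if the event does not depend on
that batch. -/
theorem prob_not_accurate_le {E : (ℕ → Example d) → Set (Example d)} {s : Set ℕ}
    (hE : MeasurableSet {q : (ℕ → Example d) × Example d | q.2 ∈ E q.1}) (hs : DependsOn E s)
    (pos m : ℕ) (hpos : ∀ j < m, pos + j ∉ s) {α : ℝ} (hα : 0 < α) :
    (Measure.infinitePi fun _ : ℕ => D) {ω | ¬ Accurate D ω pos m α (E ω)} ≤ failProb m α := by
  have hEm : ∀ ω, MeasurableSet (E ω) := fun ω => measurable_prodMk_left (x := ω) hE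
  have h := hoeffding_stream D (fun j => pos + j) m (fun ω z => (E ω).indicator 1 z)
    (fun _ _ _ _ h => Nat.add_left_cancel h)
    ((measurable_const (a := (1 : ℝ))).indicator hE)
    (fun ω => Filter.Eventually.of_forall fun z => by
      by_cases hz : z ∈ E ω <;> simp [hz])
    (fun j hj ω z => by
      have : E (Function.update ω (pos + j) z) = E ω := hs fun x hx =>
        Function.update_of_ne (fun h : x = pos + j => hpos j hj (h ▸ hx)) _ _
      rw [this]) hα
  refine (measure_mono ?_).trans (h.trans (two_mul_exp_le_failProb ?_))
  · intro ω hω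
    have e : ∫ z, (E ω).indicator (1 : Example d → ℝ) z ∂D = D.real (E ω) :=
      integral_indicator_one (hEm ω)
    simp only [Set.mem_ofPred_eq, Accurate, hits] at hω ⊢
    rwa [e]
  · have : 0 ≤ m * α ^ 2 := by positivity
    linarith

/-- The variant of `prob_not_accurate_le` where the event may depend on one example of the batch. -/
theorem prob_not_accurate_le_of_dependsOn_one {E : (ℕ → Example d) → Set (Example d)} {s : Set ℕ}
    (hE : MeasurableSet {q : (ℕ → Example d) × Example d | q.2 ∈ E q.1}) (hs : DependsOn E s)
    (pos : ℕ) {m : ℕ} (a : Fin m) (hm : 2 ≤ m) (hpos : ∀ j < m, j ≠ a → pos + j ∉ s) {α : ℝ}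
    (hα : 0 < α) (hmα : 1 ≤ m * α) :
    (Measure.infinitePi fun _ : ℕ => D) {ω | ¬ Accurate D ω pos m (2 * α) (E ω)} ≤
      failProb m α := by
  obtain ⟨m, rfl⟩ : ∃ k, m = k + 1 := ⟨m - 1, by omega⟩
  have hEm : ∀ ω, MeasurableSet (E ω) := fun ω => measurable_prodMk_left (x := ω) hE
  have hskip : ∀ j < m, (if j < a then j else j + 1 : ℕ) < m + 1 ∧
      (if j < a then j else j + 1 : ℕ) ≠ a := fun j hj => by split_ifs <;> omega
  have h := hoeffding_stream D (fun j => pos + if j < a then j else j + 1) m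
    (fun ω z => (E ω).indicator 1 z)
    (fun i hi i' hi' h => by
      have h : (if i < a then i else i + 1 : ℕ) = if i' < a then i' else i' + 1 :=
        Nat.add_left_cancel h
      split_ifs at h <;> omega)
    ((measurable_const (a := (1 : ℝ))).indicator hE)
    (fun ω => Filter.Eventually.of_forall fun z => by
      by_cases hz : z ∈ E ω <;> simp [hz])
    (fun j hj ω z => by
      obtain ⟨h1, h2⟩ := hskip j hj
      have : E (Function.update ω (pos + if j < a then j else j + 1) z) = E ω := hs fun x hx =>
        Function.update_of_ne
          (fun h : x = pos + if j < a then j else j + 1 => hpos _ h1 h2 (h ▸ hx)) _ _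
      rw [this]) hα
  refine (measure_mono ?_).trans (h.trans (two_mul_exp_le_failProb ?_))
  · intro ω hω hle
    apply hω
    have e : ∫ z, (E ω).indicator (1 : Example d → ℝ) z ∂D = D.real (E ω) :=
      integral_indicator_one (hEm ω)
    rw [e] at hle
    -- the remaining example changes the count by at most one, and `1 ≤ m * α`
    have hsum : hits ω pos (m + 1) (E ω) = (E ω).indicator 1 (ω (pos + a)) +
        ∑ j ∈ Finset.range m, (E ω).indicator 1 (ω (pos + if j < a then j else j + 1)) := by
      rw [hits, Finset.sum_range, Finset.sum_range, Fin.sum_univ_succAbove _ a]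
      congr 1
      refine Finset.sum_congr rfl fun j _ => ?_
      congr 3
      rw [Fin.succAbove]
      simp only [Fin.lt_def, Fin.val_castSucc]
      split_ifs <;> simp
    have h0 : 0 ≤ (E ω).indicator (1 : Example d → ℝ) (ω (pos + a)) :=
      Set.indicator_nonneg (fun _ _ => zero_le_one) _
    have h1 : (E ω).indicator (1 : Example d → ℝ) (ω (pos + a)) ≤ 1 :=
      Set.indicator_le_self' (fun _ _ => zero_le_one) _
    have h2 : 0 ≤ D.real (E ω) := measureReal_nonneg
    have h3 : D.real (E ω) ≤ 1 := measureReal_le_one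
    rw [Accurate, hsum]
    push_cast at hmα ⊢
    rw [abs_le] at hle ⊢
    constructor <;> nlinarith
  · have : 0 ≤ α ^ 2 := by positivity
    have h2 : (2 : ℝ) ≤ (m + 1 : ℕ) := by exact_mod_cast hm
    push_cast at h2 ⊢
    nlinarith

end Probability

/-- The examples in region `i` of a partition. -/
def region (p : List (Step d)) (i : ℕ) : Set (Example d) := {z | regionOf p z.1 = i}

/-- The leaky loss of the direction `w` on region `i`. -/
noncomputable def regionLoss (D : Measure (Example d)) (p : List (Step d)) (i : ℕ) (lam : ℝ)
    (w : Pt d) : ℝ :=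
  ∫ z in region p i, leaky lam w z ∂D

/-- The sum of the leaky losses over the examples of a batch that lie in region `i`. -/
noncomputable def batchLoss (ω : ℕ → Example d) (pos m : ℕ) (p : List (Step d)) (i : ℕ) (lam : ℝ)
    (w : Pt d) : ℝ :=
  ∑ j ∈ Finset.range m, (region p i).indicator (leaky lam w) (ω (pos + j))

/-- In a round that starts at position `n` with the partition `p`, all estimates are accurate,
for all decisions that can be made.  Here `u` is the true direction, `I` a bound for the
names of the regions, and `α` the accuracy. -/
structure RoundGood (K : Constants) (P : Params) (D : Measure (Example d)) (u : Pt d) (I : ℕ)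
    (α : ℝ) (p : (ℕ → Example d) → List (Step d)) (n : ℕ) (ω : ℕ → Example d) : Prop where
  atoms : ∀ i < I, ∀ r < P.grid + 6, ∀ b,
    Accurate D ω (n + r * P.batch K) (P.batch K) α (atom (p ω) i b)
  sgd : ∀ i < I, ∀ k < P.grid + 1, ∑ j ∈ Finset.range (P.batch K),
    (region (p ω) i).indicator (fun z =>
      regionLoss D (p ω) i (P.ε / 4 * k) (sgdRun p i (P.ε / 4 * k) (1 / Real.sqrt (P.batch K))
        (Alg.sgdPos K P (n + 2 * P.batch K) k) j ω).1 -
      D.real (region (p ω) i) * leaky (P.ε / 4 * k) (sgdRun p i (P.ε / 4 * k)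
        (1 / Real.sqrt (P.batch K)) (Alg.sgdPos K P (n + 2 * P.batch K) k) j ω).1 z)
      (ω (Alg.sgdPos K P (n + 2 * P.batch K) k + j)) ≤ P.batch K * (2 * α)
  trueLoss : ∀ i < I, ∀ k < P.grid + 1,
    |batchLoss ω (Alg.sgdPos K P (n + 2 * P.batch K) k) (P.batch K) (p ω) i (P.ε / 4 * k) u -
      P.batch K * regionLoss D (p ω) i (P.ε / 4 * k) u| ≤ P.batch K * α
  scanLoss : ∀ i < I, ∀ k < P.grid + 1,
    |batchLoss ω (n + 3 * P.batch K) (P.batch K) (p ω) i (P.ε / 4 * k) (roundDir K P p n i k ω) -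
      P.batch K * regionLoss D (p ω) i (P.ε / 4 * k) (roundDir K P p n i k ω)| ≤ P.batch K * α
  scanSides : ∀ i < I, ∀ k < P.grid + 1, ∀ a < P.batch K, ∀ t b,
    Accurate D ω (n + 3 * P.batch K) (P.batch K) (2 * α)
      (sideAtom (p ω) i (roundDir K P p n i k ω) (roundThr K P p n i k a ω) t b)
  sides : ∀ i < I, ∀ k < P.grid + 1, ∀ a < P.batch K, ∀ t b,
    Accurate D ω (n + (P.grid + 5) * P.batch K) (P.batch K) α
      (sideAtom (p ω) i (roundDir K P p n i k ω) (roundThr K P p n i k a ω) t b)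
  cutAtoms : ∀ i < I, ∀ k < P.grid + 1, ∀ a < P.batch K, ∀ t, ∀ j < I, ∀ i' < I, ∀ b,
    Accurate D ω (n + (P.grid + 6) * P.batch K) (P.batch K) α
      (atom (roundCut K P p n i k a t j ω) i' b)

section

variable {K : Constants} {P : Params} {p : (ℕ → Example d) → List (Step d)} {n : ℕ}

theorem Predictable.measurableSet_region (h : Predictable p n) (i : ℕ) :
    MeasurableSet {q : (ℕ → Example d) × Example d | q.2 ∈ region (p q.1) i} :=
  (h.measurable.comp (measurable_fst.prodMk measurable_snd.fst)) (measurableSet_singleton i)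

theorem Predictable.measurableSet_atom (h : Predictable p n) (i : ℕ) (b : Bool) :
    MeasurableSet {q : (ℕ → Example d) × Example d | q.2 ∈ atom (p q.1) i b} :=
  (h.measurableSet_region i).inter (measurable_snd.snd (measurableSet_singleton b))

theorem Predictable.measurableSet_sideAtom (h : Predictable p n) (i : ℕ)
    {w : (ℕ → Example d) → Pt d} {τ : (ℕ → Example d) → ℝ} (hw : Measurable w) (hτ : Measurable τ)
    (t b : Bool) :
    MeasurableSet {q : (ℕ → Example d) × Example d |
      q.2 ∈ sideAtom (p q.1) i (w q.1) (τ q.1) t b} :=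
  (h.measurableSet_region i).inter ((measurableSet_le (hτ.comp measurable_fst)
    (((hw.comp measurable_fst).inner measurable_snd.fst).const_mul _)).inter
      (measurable_snd.snd (measurableSet_singleton b)))

theorem norm_inv_smul_self_le (v : Pt d) : ‖‖v‖⁻¹ • v‖ ≤ 1 := by
  rw [norm_smul, norm_inv, norm_norm]
  exact inv_mul_le_one

theorem norm_roundDir_le (i k : ℕ) (ω : ℕ → Example d) : ‖roundDir K P p n i k ω‖ ≤ 1 := by
  rw [roundDir_eq]
  exact norm_inv_smul_self_le _

theorem Params.lam_nonneg (hε : 0 < P.ε) (k : ℕ) : 0 ≤ P.ε / 4 * k := by positivity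

theorem Params.lam_le_half (hε : 0 < P.ε) {k : ℕ} (hk : k < P.grid + 1) :
    P.ε / 4 * k ≤ 1 / 2 := by
  have h1 : (k : ℝ) ≤ P.grid := by exact_mod_cast Nat.lt_succ_iff.1 hk
  have h2 : (P.grid : ℝ) ≤ 2 / P.ε := Nat.floor_le (by positivity)
  have h3 : P.ε * (2 / P.ε) = 2 := by field_simp
  have h4 := mul_le_mul_of_nonneg_left (h1.trans h2) hε.le
  linarith

theorem notMem_dirCoords {k j : ℕ} (h1 : n ≤ j)
    (h2 : j < n + 4 * P.batch K ∨ n + (P.grid + 5) * P.batch K ≤ j) : j ∉ dirCoords K P n k := by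
  intro h
  rcases dirCoords_subset n k h with h | h
  · exact absurd h1 (not_le.2 h)
  · rcases h2 with h2 | h2
    · exact absurd h2 (not_lt.2 h.1)
    · exact absurd h.2 (not_lt.2 h2)

theorem measurable_uncurry_indicator {E : (ℕ → Example d) → Set (Example d)}
    (hE : MeasurableSet {q : (ℕ → Example d) × Example d | q.2 ∈ E q.1})
    {f : (ℕ → Example d) → Example d → ℝ} (hf : Measurable (Function.uncurry f)) :
    Measurable (Function.uncurry fun ω => (E ω).indicator (f ω)) := by
  have e : (Function.uncurry fun ω => (E ω).indicator (f ω)) =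
      {q : (ℕ → Example d) × Example d | q.2 ∈ E q.1}.indicator (Function.uncurry f) := by
    funext q
    by_cases hq : q.2 ∈ E q.1
    · rw [Set.indicator_of_mem (show q ∈ {q : (ℕ → Example d) × Example d | q.2 ∈ E q.1} from hq)]
      exact Set.indicator_of_mem hq _
    · rw [Set.indicator_of_notMem
        (show q ∉ {q : (ℕ → Example d) × Example d | q.2 ∈ E q.1} from hq)]
      exact Set.indicator_of_notMem hq _
  rw [e]
  exact hf.indicator hE

theorem measurable_uncurry_leaky (lam : ℝ) {w : (ℕ → Example d) → Pt d} (hw : Measurable w) :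
    Measurable (Function.uncurry fun ω => leaky lam (w ω)) := by
  have h1 : Measurable fun q : (ℕ → Example d) × Example d => (inner ℝ (w q.1) q.2.1 : ℝ) :=
    (hw.comp measurable_fst).inner measurable_snd.fst
  have h2 : Measurable fun q : (ℕ → Example d) × Example d => lab q.2.2 :=
    measurable_lab.comp measurable_snd.snd
  unfold leaky
  exact ((h1.abs).const_mul _).sub ((h2.mul h1).const_mul _)

variable (D : Measure (Example d)) [IsProbabilityMeasure D]

/-- The leaky loss of a direction on a batch is close to its population loss, if the direction does
not depend on that batch. -/
theorem Predictable.prob_loss_le (h : Predictable p n) (hD : ∀ᵐ z ∂D, ‖z.1‖ ≤ 1) (i : ℕ)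
    {w : (ℕ → Example d) → Pt d} (hw : Measurable w) (hw1 : ∀ ω, ‖w ω‖ ≤ 1) {s : Set ℕ}
    (hs : DependsOn w s) (pos m : ℕ) (hn : n ≤ pos) (hpos : ∀ j < m, pos + j ∉ s) {lam α : ℝ}
    (h0 : 0 ≤ lam) (h1 : lam ≤ 1 / 2) (hα : 0 < α) :
    (Measure.infinitePi fun _ : ℕ => D) {ω | ¬ |batchLoss ω pos m (p ω) i lam (w ω) -
      m * regionLoss D (p ω) i lam (w ω)| ≤ m * α} ≤ failProb m α := by
  have hm : MeasurableSet {q : (ℕ → Example d) × Example d | q.2 ∈ region (p q.1) i} :=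
    h.measurableSet_region i
  have hf : Measurable (Function.uncurry fun ω => leaky lam (w ω)) :=
    measurable_uncurry_leaky lam hw
  have key := hoeffding_stream D (fun j => pos + j) m
    (fun ω => (region (p ω) i).indicator (leaky lam (w ω)))
    (fun _ _ _ _ h => Nat.add_left_cancel h) (measurable_uncurry_indicator hm hf)
    (fun ω => hD.mono fun z hz => by
      by_cases hzr : z ∈ region (p ω) i
      · rw [Set.indicator_of_mem hzr]; exact abs_leaky_le h0 h1 (hw1 ω) hz
      · rw [Set.indicator_of_notMem hzr]; simp)
    (fun j hj ω z => by
      have e1 : p (Function.update ω (pos + j) z) = p ω := h.dependsOn fun x hx =>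
        Function.update_of_ne (fun hxe : x = pos + j => by
          have : x < n := hx
          omega) _ _
      have e2 : w (Function.update ω (pos + j) z) = w ω := hs fun x hx =>
        Function.update_of_ne (fun hxe : x = pos + j => hpos j hj (hxe ▸ hx)) _ _
      simp only [e1, e2]) hα
  refine (measure_mono ?_).trans (key.trans (two_mul_exp_le_failProb ?_))
  · intro ω hω
    have hr : MeasurableSet (region (p ω) i) := measurable_prodMk_left (x := ω) hm
    simp only [Set.mem_ofPred_eq, batchLoss, regionLoss] at hω ⊢
    rwa [integral_indicator hr]
  · have : 0 ≤ m * α ^ 2 := by positivity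
    linarith

theorem abs_regionLoss_le (hD : ∀ᵐ z ∂D, ‖z.1‖ ≤ 1) (q : List (Step d)) (i : ℕ) {w : Pt d}
    (hw : ‖w‖ ≤ 1) {lam : ℝ} (h0 : 0 ≤ lam) (h1 : lam ≤ 1 / 2) :
    |regionLoss D q i lam w| ≤ 1 := by
  have := norm_setIntegral_le_of_norm_le_const_ae (μ := D) (s := region q i) (f := leaky lam w)
    (C := 1) (measure_lt_top _ _)
    (ae_restrict_of_ae (hD.mono fun z hz => abs_leaky_le h0 h1 hw hz))
  rw [Real.norm_eq_abs, one_mul] at this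
  exact this.trans measureReal_le_one

/-- The losses of the SGD iterates on their own examples are close to their losses on the population.
Each iterate depends on earlier examples only, so the differences form a martingale difference
sequence once they are multiplied by the mass of the region, which avoids the conditional law. -/
theorem Predictable.prob_sgd_le (h : Predictable p n) (hD : ∀ᵐ z ∂D, ‖z.1‖ ≤ 1) (i : ℕ)
    (ν : ℝ) (pos m : ℕ) (hn : n ≤ pos) {lam α : ℝ} (h0 : 0 ≤ lam) (h1 : lam ≤ 1 / 2)
    (hα : 0 < α) :
    (Measure.infinitePi fun _ : ℕ => D) {ω | ¬ ∑ j ∈ Finset.range m,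
      (region (p ω) i).indicator (fun z =>
        regionLoss D (p ω) i lam (sgdRun p i lam ν pos j ω).1 -
        D.real (region (p ω) i) * leaky lam (sgdRun p i lam ν pos j ω).1 z) (ω (pos + j)) ≤
      m * (2 * α)} ≤ failProb m α := by
  have hm : MeasurableSet {q : (ℕ → Example d) × Example d | q.2 ∈ region (p q.1) i} :=
    h.measurableSet_region i
  have hr : ∀ ω, MeasurableSet (region (p ω) i) := fun ω => measurable_prodMk_left (x := ω) hm
  have hw : ∀ j, Measurable fun ω => (sgdRun p i lam ν pos j ω).1 := fun j =>
    (h.measurable_sgdRun i lam ν pos j).fst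
  have hw1 : ∀ j ω, ‖(sgdRun p i lam ν pos j ω).1‖ ≤ 1 := fun j ω => norm_sgdState_le _ _ _ _ _
  have hf : ∀ j, Measurable (Function.uncurry fun ω =>
      leaky lam (sgdRun p i lam ν pos j ω).1) := fun j =>
    measurable_uncurry_leaky lam (hw j)
  have hF : ∀ j, Measurable fun ω => regionLoss D (p ω) i lam (sgdRun p i lam ν pos j ω).1 := by
    intro j
    have := (((measurable_uncurry_indicator (E := fun ω => region (p ω) i) hm (hf j)).stronglyMeasurable).integral_prod_right
      (ν := D)).measurable
    convert this using 1
    funext ω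
    exact (integral_indicator (hr ω)).symm
  have hM : Measurable fun ω => D.real (region (p ω) i) :=
    (measurable_measure_prodMk_left hm).ennreal_toReal
  have hM1 : ∀ ω, |D.real (region (p ω) i)| ≤ 1 := fun ω => by
    rw [abs_of_nonneg measureReal_nonneg]; exact measureReal_le_one
  set G : (ℕ → Example d) → ℕ → Example d → ℝ := fun ω j z =>
    regionLoss D (p ω) i lam (sgdRun p i lam ν pos j ω).1 -
        D.real (region (p ω) i) * leaky lam (sgdRun p i lam ν pos j ω).1 z with hG
  have hGm : ∀ j, Measurable (Function.uncurry fun ω z => 1 / 2 * G ω j z) := fun j =>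
    Measurable.const_mul (((hF j).comp measurable_fst).sub
      ((hM.comp measurable_fst).mul (hf j))) (1 / 2)
  have key := azuma_stream D (fun j => pos + j) m
    (fun j ω => (region (p ω) i).indicator (fun z => 1 / 2 * G ω j z))
    (fun _ _ _ _ h => Nat.add_left_cancel h)
    (fun j _ => measurable_uncurry_indicator hm (hGm j))
    (fun j _ ω => hD.mono fun z hz => by
      by_cases hzr : z ∈ region (p ω) i
      · rw [Set.indicator_of_mem hzr]
        have e1 := abs_regionLoss_le D hD (p ω) i (hw1 j ω) h0 h1
        have e2 := abs_leaky_le h0 h1 (hw1 j ω) hz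
        have e3 : |D.real (region (p ω) i) * leaky lam (sgdRun p i lam ν pos j ω).1 z| ≤ 1 := by
          rw [abs_mul]; exact mul_le_one₀ (hM1 ω) (abs_nonneg _) e2
        rw [abs_le] at e1 e3 ⊢
        simp only [hG]
        constructor <;> linarith
      · rw [Set.indicator_of_notMem hzr]; simp)
    (fun j hj j' hj' hjj ω z => by
      have e1 : p (Function.update ω (pos + j') z) = p ω := h.dependsOn fun x hx =>
        Function.update_of_ne (fun hxe : x = pos + j' => by
          have : x < n := hx
          omega) _ _
      have e2 : sgdRun p i lam ν pos j (Function.update ω (pos + j') z) =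
          sgdRun p i lam ν pos j ω := h.dependsOn_sgdRun i lam ν pos j fun x hx =>
        Function.update_of_ne (fun hxe : x = pos + j' => by
          rcases hx with hx | hx
          · have : x < n := hx
            omega
          · have := hx.2
            omega) _ _
      simp only [hG, e1, e2]) hα
  refine (measure_mono ?_).trans (key.trans ?_)
  · intro ω hω
    simp only [Set.mem_ofPred_eq, not_le] at hω ⊢
    have hzero : ∀ j, ∫ z, (region (p ω) i).indicator (fun z => 1 / 2 * G ω j z) z ∂D = 0 := by
      intro j
      rw [integral_indicator (hr ω), integral_const_mul, hG]
      simp only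
      rw [integral_sub (integrable_const _)
        ((integrable_leaky hD lam _).integrableOn.const_mul _), integral_const_mul,
        setIntegral_const, smul_eq_mul]
      unfold regionLoss
      ring
    simp only [hzero, sub_zero]
    have : ∑ j ∈ Finset.range m, (region (p ω) i).indicator (fun z => 1 / 2 * G ω j z)
        (ω (pos + j)) = 1 / 2 * ∑ j ∈ Finset.range m, (region (p ω) i).indicator (G ω j)
        (ω (pos + j)) := by
      rw [Finset.mul_sum]
      refine Finset.sum_congr rfl fun j _ => ?_
      by_cases hz : ω (pos + j) ∈ region (p ω) i
      · rw [Set.indicator_of_mem hz, Set.indicator_of_mem hz]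
      · rw [Set.indicator_of_notMem hz, Set.indicator_of_notMem hz, mul_zero]
    rw [this]
    linarith
  · refine le_trans ?_ (two_mul_exp_le_failProb (m := m) (α := α) (c := m * α ^ 2 / 2) ?_)
    · rw [two_mul]; exact le_self_add
    · have : 0 ≤ m * α ^ 2 := by positivity
      linarith

end

theorem measure_exists_le {Ω ι : Type*} [MeasurableSpace Ω] {μ : Measure Ω} [Fintype ι]
    {Q : ι → Ω → Prop} {c : ENNReal} (h : ∀ i, μ {ω | Q i ω} ≤ c) :
    μ {ω | ∃ i, Q i ω} ≤ Fintype.card ι * c := by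
  have : {ω | ∃ i, Q i ω} = ⋃ i, {ω | Q i ω} := by ext; simp
  rw [this]
  refine (measure_iUnion_fintype_le μ _).trans ((Finset.sum_le_sum fun i _ => h i).trans ?_)
  simp

/-- A bound for the number of estimates in a round. -/
noncomputable def estimates (K : Constants) (P : Params) (I : ℕ) : ℕ :=
  17 * (I ^ 4 * (P.grid + 6) * P.batch K)

theorem measure_union_le_add {Ω : Type*} [MeasurableSpace Ω] {μ : Measure Ω} {s t : Set Ω}
    {a b : ENNReal} (hs : μ s ≤ a) (ht : μ t ≤ b) : μ (s ∪ t) ≤ a + b :=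
  (measure_union_le s t).trans (add_le_add hs ht)

/-- A union bound over all estimates of one round with a prescribed history. -/
theorem prob_not_roundGood_le {K : Constants} {P : Params} (D : Measure (Example d))
    [IsProbabilityMeasure D] (hD : ∀ᵐ z ∂D, ‖z.1‖ ≤ 1) {u : Pt d} (hu : ‖u‖ ≤ 1) {I : ℕ}
    (hI : 0 < I) {α : ℝ}
    (hα : 0 < α) (hε : 0 < P.ε) (hm : 2 ≤ P.batch K) (hmα : 1 ≤ P.batch K * α)
    {p : (ℕ → Example d) → List (Step d)} {n : ℕ} (h : Predictable p n) :
    (Measure.infinitePi fun _ : ℕ => D) {ω | ¬ RoundGood K P D u I α p n ω} ≤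
      estimates K P I * failProb (P.batch K) α := by
  set m := P.batch K with hmdef
  set μ := Measure.infinitePi fun _ : ℕ => D with hμ
  have hdir := fun i k => h.measurable_roundDir (K := K) (P := P) i k
  have hthr := fun i k a => h.measurable_roundThr (K := K) (P := P) i k a
  have hpos : ∀ k, n ≤ Alg.sgdPos K P (n + 2 * m) k := fun k => by
    simp only [Alg.sgdPos]; omega
  have hsdep : ∀ i k a t b, DependsOn (fun ω => sideAtom (p ω) i (roundDir K P p n i k ω)
      (roundThr K P p n i k a ω) t b) (Set.Iio n ∪ (dirCoords K P n k ∪ {n + 3 * m + a})) := by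
    intro i k a t b ω ω' hω
    simp only [h.dependsOn fun j hj => hω j (Or.inl hj),
      h.dependsOn_roundDir (K := K) (P := P) i k fun j hj => hω j (Or.inr (Or.inl hj)),
      h.dependsOn_roundThr (K := K) (P := P) i k a fun j hj => hω j (Or.inr hj)]
  have b1 : μ {ω | ∃ x : Fin I × Fin (P.grid + 6) × Bool, ¬ Accurate D ω (n + x.2.1 * m) m α
      (atom (p ω) x.1 x.2.2)} ≤ _ := measure_exists_le fun x =>
    prob_not_accurate_le D (h.measurableSet_atom x.1 x.2.2) (s := Set.Iio n)
      (fun ω ω' hω => by simp only [h.dependsOn hω]) _ m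
      (fun j _ hj => by have : n + x.2.1 * m + j < n := hj; omega) hα
  have b2 : μ {ω | ∃ x : Fin I × Fin (P.grid + 1), _} ≤ _ := measure_exists_le fun x =>
    h.prob_sgd_le D hD x.1 (1 / Real.sqrt m) (Alg.sgdPos K P (n + 2 * m) x.2) m (hpos _)
      (Params.lam_nonneg hε x.2) (Params.lam_le_half hε x.2.2) hα
  have b3 : μ {ω | ∃ x : Fin I × Fin (P.grid + 1), _} ≤ _ := measure_exists_le fun x =>
    h.prob_loss_le D hD x.1 (w := fun _ => u) measurable_const (fun _ => hu) (s := ∅)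
      (fun _ _ _ => rfl) (Alg.sgdPos K P (n + 2 * m) x.2) m (hpos _) (fun _ _ => by simp)
      (Params.lam_nonneg hε x.2) (Params.lam_le_half hε x.2.2) hα
  have b4 : μ {ω | ∃ x : Fin I × Fin (P.grid + 1), _} ≤ _ := measure_exists_le fun x =>
    h.prob_loss_le D hD x.1 (hdir x.1 x.2) (fun ω => norm_roundDir_le _ _ ω)
      (h.dependsOn_roundDir x.1 x.2) (n + 3 * m) m (by omega)
      (fun j hj => notMem_dirCoords (by omega) (Or.inl (by omega)))
      (Params.lam_nonneg hε x.2) (Params.lam_le_half hε x.2.2) hα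
  have b5 : μ {ω | ∃ x : Fin I × Fin (P.grid + 1) × Fin m × Bool × Bool,
      ¬ Accurate D ω (n + 3 * m) m (2 * α) (sideAtom (p ω) x.1 (roundDir K P p n x.1 x.2.1 ω)
        (roundThr K P p n x.1 x.2.1 x.2.2.1 ω) x.2.2.2.1 x.2.2.2.2)} ≤ _ :=
    measure_exists_le fun x => prob_not_accurate_le_of_dependsOn_one D
      (h.measurableSet_sideAtom x.1 (hdir x.1 x.2.1) (hthr x.1 x.2.1 x.2.2.1) _ _)
      (hsdep x.1 x.2.1 x.2.2.1 _ _) (n + 3 * m) x.2.2.1 hm (fun j hj hja hmem => by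
        rcases hmem with hmem | hmem | hmem
        · have : n + 3 * m + j < n := hmem
          omega
        · exact notMem_dirCoords (by omega) (Or.inl (by omega)) hmem
        · exact hja (Nat.add_left_cancel hmem)) hα hmα
  have b6 : μ {ω | ∃ x : Fin I × Fin (P.grid + 1) × Fin m × Bool × Bool,
      ¬ Accurate D ω (n + (P.grid + 5) * m) m α
        (sideAtom (p ω) x.1 (roundDir K P p n x.1 x.2.1 ω)
        (roundThr K P p n x.1 x.2.1 x.2.2.1 ω) x.2.2.2.1 x.2.2.2.2)} ≤ _ :=
    measure_exists_le fun x => prob_not_accurate_le D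
      (h.measurableSet_sideAtom x.1 (hdir x.1 x.2.1) (hthr x.1 x.2.1 x.2.2.1) _ _)
      (hsdep x.1 x.2.1 x.2.2.1 _ _) (n + (P.grid + 5) * m) m (fun j hj hmem => by
        have hlt := x.2.2.1.2
        have h3 : 4 * m ≤ (P.grid + 5) * m := Nat.mul_le_mul_right _ (by omega)
        rcases hmem with hmem | hmem | hmem
        · have : n + (P.grid + 5) * m + j < n := hmem
          omega
        · exact notMem_dirCoords (by omega) (Or.inr (by simp only [← hmdef]; omega)) hmem
        · have : n + (P.grid + 5) * m + j = n + 3 * m + x.2.2.1 := hmem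
          omega) hα
  have b7 : μ {ω | ∃ x : Fin I × Fin (P.grid + 1) × Fin m × Bool × Fin I × Fin I × Bool,
      ¬ Accurate D ω (n + (P.grid + 6) * m) m α
        (atom (roundCut K P p n x.1 x.2.1 x.2.2.1 x.2.2.2.1 x.2.2.2.2.1 ω) x.2.2.2.2.2.1
          x.2.2.2.2.2.2)} ≤ _ :=
    measure_exists_le fun x => by
      have hc := h.roundCut (K := K) (P := P) x.1 x.2.1 x.2.2.1.2 x.2.2.2.1 x.2.2.2.2.1
      refine prob_not_accurate_le D (hc.measurableSet_atom _ _)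
        (s := Set.Iio (n + (P.grid + 5) * m)) (fun ω ω' hω => by
          simp only [hc.dependsOn hω]) _ m (fun j _ hj => ?_) hα
      have : n + (P.grid + 6) * m + j < n + (P.grid + 5) * m := hj
      have h3 : (P.grid + 5) * m ≤ (P.grid + 6) * m := Nat.mul_le_mul_right _ (by omega)
      omega
  refine (measure_mono (t := _ ∪ (_ ∪ (_ ∪ (_ ∪ (_ ∪ (_ ∪ _)))))) ?_).trans
    ((measure_union_le_add b1 (measure_union_le_add b2 (measure_union_le_add b3
      (measure_union_le_add b4 (measure_union_le_add b5 (measure_union_le_add b6 b7)))))).trans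
      ?_)
  · intro ω hω
    by_contra hcon
    simp only [Set.mem_union, Set.mem_ofPred_eq, not_or, not_exists, not_not] at hcon
    obtain ⟨c1, c2, c3, c4, c5, c6, c7⟩ := hcon
    refine hω ⟨fun i hi r hr b => c1 (⟨i, hi⟩, ⟨r, hr⟩, b), fun i hi k hk => c2 (⟨i, hi⟩, ⟨k, hk⟩),
      fun i hi k hk => c3 (⟨i, hi⟩, ⟨k, hk⟩), fun i hi k hk => c4 (⟨i, hi⟩, ⟨k, hk⟩),
      fun i hi k hk a ha t b => c5 (⟨i, hi⟩, ⟨k, hk⟩, ⟨a, ha⟩, t, b),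
      fun i hi k hk a ha t b => c6 (⟨i, hi⟩, ⟨k, hk⟩, ⟨a, ha⟩, t, b),
      fun i hi k hk a ha t j hj i' hi' b => c7 (⟨i, hi⟩, ⟨k, hk⟩, ⟨a, ha⟩, t, ⟨j, hj⟩, ⟨i', hi'⟩, b)⟩
  · simp only [← add_mul]
    gcongr
    simp only [Fintype.card_prod, Fintype.card_fin, Fintype.card_bool]
    norm_cast
    have h1 : 1 ≤ I := hI
    have h2 : 1 ≤ m := by omega
    have t1 : I * (P.grid + 6) * 1 ≤ I ^ 4 * (P.grid + 6) * m :=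
      Nat.mul_le_mul (Nat.mul_le_mul_right _ (Nat.le_self_pow (by norm_num) I)) h2
    have t2 : I * (P.grid + 1) * 1 ≤ I ^ 4 * (P.grid + 6) * m :=
      Nat.mul_le_mul (Nat.mul_le_mul (Nat.le_self_pow (by norm_num) I) (by omega)) h2
    have t3 : I * (P.grid + 1) * m ≤ I ^ 4 * (P.grid + 6) * m :=
      Nat.mul_le_mul_right _ (Nat.mul_le_mul (Nat.le_self_pow (by norm_num) I) (by omega))
    have t4 : I ^ 3 * (P.grid + 1) * m ≤ I ^ 4 * (P.grid + 6) * m :=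
      Nat.mul_le_mul_right _ (Nat.mul_le_mul (Nat.pow_le_pow_right h1 (by norm_num)) (by omega))
    unfold estimates
    rw [← hmdef]
    refine le_trans (b := 2 * (I * (P.grid + 6) * 1) + 3 * (I * (P.grid + 1) * 1) +
      8 * (I * (P.grid + 1) * m) + 4 * (I ^ 3 * (P.grid + 1) * m)) (le_of_eq ?_) (by omega)
    ring

/-! ### Empirical frequencies in terms of batches -/

section Hits

variable (ω : ℕ → Example d) (pos m : ℕ)

theorem hits_eq_countP {E : Set (Example d)} (q : Example d → Bool)
    (hq : ∀ z, q z = true ↔ z ∈ E) :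
    hits ω pos m E = ((Alg.batch ω pos m).countP q : ℝ) := by
  unfold hits Alg.batch
  induction m with
  | zero => simp
  | succ m ih =>
    rw [Finset.sum_range_succ, ih, List.range_succ, List.map_append, List.countP_append]
    by_cases h : ω (pos + m) ∈ E
    · rw [Set.indicator_of_mem h]
      simp [(hq _).2 h]
    · rw [Set.indicator_of_notMem h]
      have : q (ω (pos + m)) = false := by
        rw [← Bool.not_eq_true, hq]; exact h
      simp [this]

theorem hits_nonneg (E : Set (Example d)) : 0 ≤ hits ω pos m E :=
  Finset.sum_nonneg fun _ _ => Set.indicator_nonneg (fun _ _ => zero_le_one) _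

theorem hits_union {E F : Set (Example d)} (h : Disjoint E F) :
    hits ω pos m (E ∪ F) = hits ω pos m E + hits ω pos m F := by
  unfold hits
  rw [← Finset.sum_add_distrib, Set.indicator_union_of_disjoint h]

theorem atom_union_atom_not (p : List (Step d)) (i : ℕ) (s : Bool) :
    atom p i s ∪ atom p i (!s) = region p i := by
  ext z
  simp only [atom, region, Set.mem_union, Set.mem_ofPred_eq, ← and_or_left]
  refine and_iff_left ?_
  cases z.2 <;> cases s <;> simp

theorem disjoint_atom_atom_not (p : List (Step d)) (i : ℕ) (s : Bool) :
    Disjoint (atom p i s) (atom p i (!s)) :=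
  Set.disjoint_left.2 fun _ h1 h2 => Bool.not_ne_self s (h2.2.symm.trans h1.2)

theorem hits_region (p : List (Step d)) (i : ℕ) (s : Bool) :
    hits ω pos m (region p i) = hits ω pos m (atom p i s) + hits ω pos m (atom p i (!s)) := by
  rw [← atom_union_atom_not p i s, hits_union _ _ _ (disjoint_atom_atom_not p i s)]

/-- The examples in region `i` on the side `t` of an annulus. -/
def sideRegion (p : List (Step d)) (i : ℕ) (w : Pt d) (τ : ℝ) (t : Bool) : Set (Example d) :=
  {z | regionOf p z.1 = i ∧ τ ≤ lab t * inner ℝ w z.1}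

theorem sideAtom_union_sideAtom_not (p : List (Step d)) (i : ℕ) (w : Pt d) (τ : ℝ) (t s : Bool) :
    sideAtom p i w τ t s ∪ sideAtom p i w τ t (!s) = sideRegion p i w τ t := by
  ext z
  simp only [sideAtom, sideRegion, Set.mem_union, Set.mem_ofPred_eq, ← and_or_left]
  refine and_congr_right fun _ => and_iff_left ?_
  cases z.2 <;> cases s <;> simp

theorem disjoint_sideAtom_sideAtom_not (p : List (Step d)) (i : ℕ) (w : Pt d) (τ : ℝ)
    (t s : Bool) : Disjoint (sideAtom p i w τ t s) (sideAtom p i w τ t (!s)) :=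
  Set.disjoint_left.2 fun _ h1 h2 => Bool.not_ne_self s (h2.2.2.symm.trans h1.2.2)

theorem disjoint_sideRegion (p : List (Step d)) (i : ℕ) (w : Pt d) {τ : ℝ} (hτ : 0 < τ) :
    Disjoint (sideRegion p i w τ true) (sideRegion p i w τ false) :=
  Set.disjoint_left.2 fun z h1 h2 => by
    have h3 := h1.2
    have h4 := h2.2
    simp only [lab] at h3 h4
    norm_num at h3 h4
    linarith

theorem hits_sideRegion (p : List (Step d)) (i : ℕ) (w : Pt d) (τ : ℝ) (t s : Bool) :
    hits ω pos m (sideRegion p i w τ t) =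
      hits ω pos m (sideAtom p i w τ t s) + hits ω pos m (sideAtom p i w τ t (!s)) := by
  rw [← sideAtom_union_sideAtom_not p i w τ t s,
    hits_union _ _ _ (disjoint_sideAtom_sideAtom_not p i w τ t s)]

theorem length_batchIn (p : List (Step d)) (i : ℕ) :
    ((Alg.batchIn ω p i pos m).length : ℝ) = hits ω pos m (region p i) := by
  rw [Alg.batchIn, ← List.countP_eq_length_filter]
  exact (hits_eq_countP ω pos m _ fun z => by simp [region]).symm

theorem errFrac_batchIn (p : List (Step d)) (i : ℕ) (s : Bool) :
    Alg.errFrac s ((Alg.batchIn ω p i pos m).map fun z => z.2) =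
      hits ω pos m (atom p i (!s)) / hits ω pos m (region p i) := by
  rw [Alg.errFrac, List.length_map, length_batchIn, List.countP_map, Alg.batchIn,
    List.countP_filter, ← hits_eq_countP ω pos m (E := atom p i (!s))]
  intro z
  cases s <;> simp [atom, and_comm]

theorem sideMass_batchIn (p : List (Step d)) (i : ℕ) (w : Pt d) (τ : ℝ) (t : Bool) :
    Alg.sideMass (Alg.batchIn ω p i pos m) w τ t =
      hits ω pos m (sideRegion p i w τ t) / hits ω pos m (region p i) := by
  rw [Alg.sideMass, length_batchIn, Alg.batchIn, List.countP_filter,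
    ← hits_eq_countP ω pos m (E := sideRegion p i w τ t)]
  intro z
  simp [sideRegion, and_comm]

theorem sideErr_batchIn (p : List (Step d)) (i : ℕ) (w : Pt d) (τ : ℝ) (t : Bool) :
    Alg.sideErr (Alg.batchIn ω p i pos m) w τ t =
      hits ω pos m (sideAtom p i w τ t (!t)) / hits ω pos m (sideRegion p i w τ t) := by
  rw [Alg.sideErr, Alg.errFrac, List.length_map, List.countP_map, Alg.side, Alg.batchIn,
    List.filter_filter, List.countP_filter, ← List.countP_eq_length_filter,
    ← hits_eq_countP ω pos m (E := sideAtom p i w τ t (!t)),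
    ← hits_eq_countP ω pos m (E := sideRegion p i w τ t)]
  · intro z
    simp [sideRegion, and_comm]
  · intro z
    cases t <;> simp [sideAtom, and_comm, and_left_comm]

theorem le_abs_iff_lab {τ a : ℝ} :
    τ ≤ |a| ↔ τ ≤ lab true * a ∨ τ ≤ lab false * a := by
  simp [lab, le_abs]

theorem length_annulus (p : List (Step d)) (i : ℕ) (w : Pt d) {τ : ℝ} (hτ : 0 < τ) :
    ((Alg.annulus (Alg.proj w (Alg.batchIn ω p i pos m)) τ).length : ℝ) =
      hits ω pos m (sideRegion p i w τ true) + hits ω pos m (sideRegion p i w τ false) := by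
  rw [Alg.annulus, ← List.countP_eq_length_filter, Alg.proj, List.countP_map, Alg.batchIn,
    List.countP_filter, ← hits_union _ _ _ (disjoint_sideRegion p i w hτ),
    ← hits_eq_countP ω pos m]
  intro z
  simp only [Function.comp, Bool.and_eq_true, decide_eq_true_eq, sideRegion, Set.mem_union,
    Set.mem_ofPred_eq, le_abs_iff_lab]
  tauto

theorem countP_annulus (p : List (Step d)) (i : ℕ) (w : Pt d) {τ : ℝ} (hτ : 0 < τ) :
    ((Alg.annulus (Alg.proj w (Alg.batchIn ω p i pos m)) τ).countP
      fun a => decide (lab a.2 * a.1 < 0) : ℝ) =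
      hits ω pos m (sideAtom p i w τ true false) + hits ω pos m (sideAtom p i w τ false true) := by
  have hd : Disjoint (sideAtom p i w τ true false) (sideAtom p i w τ false true) :=
    Set.disjoint_of_subset (fun _ h => (⟨h.1, h.2.1⟩ : _ ∧ _)) (fun _ h => (⟨h.1, h.2.1⟩ : _ ∧ _))
      (disjoint_sideRegion p i w hτ)
  rw [Alg.annulus, List.countP_filter, Alg.proj, List.countP_map, Alg.batchIn,
    List.countP_filter, ← hits_union _ _ _ hd, ← hits_eq_countP ω pos m]
  intro z
  simp only [Function.comp, Bool.and_eq_true, decide_eq_true_eq, sideAtom, Set.mem_union,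
    Set.mem_ofPred_eq, le_abs_iff_lab]
  cases z.2 <;> simp only [lab] <;> norm_num
  · constructor
    · rintro ⟨⟨h1, h2 | h2⟩, h3⟩
      · exact ⟨h3, h2⟩
      · linarith
    · rintro ⟨h1, h2⟩
      exact ⟨⟨by linarith, Or.inl h2⟩, h1⟩
  · constructor
    · rintro ⟨⟨h1, h2 | h2⟩, h3⟩
      · linarith
      · exact ⟨h3, h2⟩
    · rintro ⟨h1, h2⟩
      exact ⟨⟨by linarith, Or.inr h2⟩, h1⟩

theorem liveErr_eq (K : Constants) (P : Params) (h : Classifier d) (i : ℕ) :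
    Alg.liveErr K P ω h pos i = hits ω pos (P.batch K) (atom h.steps i (!h.label i)) /
      hits ω pos (P.batch K) (region h.steps i) := by
  rw [Alg.liveErr, Alg.errFrac, List.length_map, List.countP_map, List.countP_filter,
    ← List.countP_eq_length_filter, List.countP_map, List.countP_map,
    ← hits_eq_countP ω pos _ (E := atom h.steps i (!h.label i)),
    ← hits_eq_countP ω pos _ (E := region h.steps i)]
  · intro z; simp [region]
  · intro z
    cases h.label i <;> simp [atom, and_comm]

theorem regionCount_eq (K : Constants) (P : Params) (h : Alg.Hyp d) (i : ℕ) :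
    (Alg.regionCount K P ω h pos i : ℝ) = hits ω pos (P.batch K) (region h.cls.steps i) := by
  rw [Alg.regionCount, List.countP_map, ← hits_eq_countP ω pos _ (E := region h.cls.steps i)]
  intro z; simp [region]

/-- The examples in the live regions. -/
def liveSet (p : List (Step d)) (l : List ℕ) : Set (Example d) := {z | regionOf p z.1 ∈ l}

theorem liveSet_cons (p : List (Step d)) (i : ℕ) (l : List ℕ) :
    liveSet p (i :: l) = region p i ∪ liveSet p l := by
  ext z; simp [liveSet, region]

theorem disjoint_region_liveSet (p : List (Step d)) {i : ℕ} {l : List ℕ} (h : i ∉ l) :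
    Disjoint (region p i) (liveSet p l) :=
  Set.disjoint_left.2 fun z h1 h2 => h (by
    have h3 : regionOf p z.1 = i := h1
    have h4 : regionOf p z.1 ∈ l := h2
    rwa [h3] at h4)

theorem hits_liveSet (p : List (Step d)) {l : List ℕ} (h : l.Nodup) :
    hits ω pos m (liveSet p l) = (l.map fun i => hits ω pos m (region p i)).sum := by
  induction l with
  | nil =>
    have : liveSet p [] = ∅ := by ext z; simp [liveSet]
    simp [this, hits]
  | cons i l ih =>
    rw [List.nodup_cons] at h
    rw [liveSet_cons, hits_union _ _ _ (disjoint_region_liveSet p h.1), ih h.2, List.map_cons,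
      List.sum_cons]

theorem liveMass_eq (K : Constants) (P : Params) (h : Alg.Hyp d) :
    Alg.liveMass K P ω h pos = hits ω pos (P.batch K) (liveSet h.cls.steps h.live) /
      P.batch K := by
  rw [Alg.liveMass, Alg.length_batch,
    ← hits_eq_countP ω pos _ (E := liveSet h.cls.steps h.live)]
  intro z; simp [liveSet]

end Hits

/-! ### The range of the parameters -/

/-- The quantity `ε / (1 + L)`, in powers of which all accuracies are measured. -/
noncomputable def Params.scale (P : Params) : ℝ := P.ε / (1 + P.L)

/-- The accuracy of the estimates. -/
noncomputable def Params.acc (P : Params) : ℝ := P.scale ^ 50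

/-- The range of parameters in which the algorithm is analyzed: `ε` is small and the batches are
large enough. -/
structure Regime (K : Constants) (P : Params) : Prop where
  ε_pos : 0 < P.ε
  ε_le : P.ε ≤ 1 / 100
  ζ_nonneg : 0 ≤ P.ζ
  cMerge : K.cMerge = 10
  cMass : K.cMass = 40
  batch : 1 ≤ P.batch K * P.acc ^ 2

namespace Regime

variable {K : Constants} {P : Params}

theorem scale_pos (h : Regime K P) : 0 < P.scale := div_pos h.ε_pos (by positivity)

theorem scale_le_ε (h : Regime K P) : P.scale ≤ P.ε :=
  div_le_self h.ε_pos.le (by have := P.L.coe_nonneg; linarith)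

theorem scale_le (h : Regime K P) : P.scale ≤ 1 / 100 := h.scale_le_ε.trans h.ε_le

theorem scale_pow_le (h : Regime K P) (a b : ℕ) : P.scale ^ (a + b) ≤ P.scale ^ a * (1 / 100) ^ b := by
  rw [pow_add]
  exact mul_le_mul_of_nonneg_left (pow_le_pow_left₀ h.scale_pos.le h.scale_le b)
    (pow_nonneg h.scale_pos.le a)

theorem acc_pos (h : Regime K P) : 0 < P.acc := pow_pos h.scale_pos _

theorem acc_le_pow (h : Regime K P) {k : ℕ} (hk : k ≤ 46) :
    P.acc ≤ P.scale ^ k * (1 / 100) ^ 4 := by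
  refine (pow_le_pow_of_le_one h.scale_pos.le (h.scale_le.trans (by norm_num))
    (show k + 4 ≤ 50 by omega)).trans (h.scale_pow_le k 4)

theorem coarse_eq (h : Regime K P) : P.coarse K = (P.scale / 10) ^ 10 := by
  have h1 : (1 : ℝ) + P.L ≠ 0 := by positivity
  rw [Params.coarse, h.cMerge, Params.scale]
  congr 1
  push_cast
  field_simp

theorem coarse_le (h : Regime K P) : P.coarse K ≤ P.scale ^ 10 := by
  rw [h.coarse_eq]
  have := h.scale_pos
  exact pow_le_pow_left₀ (by positivity) (by linarith) _

theorem le_coarse (h : Regime K P) : P.scale ^ 15 ≤ P.coarse K := by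
  rw [h.coarse_eq, div_pow]
  refine (h.scale_pow_le 10 5).trans (le_of_eq ?_)
  norm_num
  ring

theorem coarse_pos (h : Regime K P) : 0 < P.coarse K :=
  lt_of_lt_of_le (pow_pos h.scale_pos _) h.le_coarse

theorem batch_pos (h : Regime K P) : 0 < P.batch K := by
  by_contra hc
  have h1 : P.batch K = 0 := by omega
  have h2 := h.batch
  rw [h1] at h2
  norm_num at h2

theorem batch_pos' (h : Regime K P) : (0 : ℝ) < P.batch K := by exact_mod_cast h.batch_pos

theorem sqrt_batch_le (h : Regime K P) : Real.sqrt (P.batch K) ≤ P.batch K * P.acc := by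
  have h1 := h.batch
  have h2 := h.batch_pos'
  have h3 := h.acc_pos
  rw [Real.sqrt_le_left (by positivity)]
  have := mul_le_mul_of_nonneg_left h1 h2.le
  nlinarith

theorem slack_pos (h : Regime K P) : 0 < P.slack := by
  have h1 := h.ε_pos
  have h2 := h.ζ_nonneg
  unfold Params.slack
  linarith

theorem ε_le_slack (h : Regime K P) : P.ε ≤ P.slack := by
  have h2 := h.ζ_nonneg
  unfold Params.slack
  linarith

/-- The gap of the leaky losses is at least of order `scale ^ 2`. -/
theorem scale_sq_le (h : Regime K P) (hL : 0 < (P.L : ℝ)) :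
    P.scale ^ 2 ≤ P.ε * P.slack / P.L := by
  have h1 := h.ε_pos
  have h2 := mul_le_mul_of_nonneg_left h.ε_le_slack h1.le
  unfold Params.scale
  rw [div_pow, div_le_div_iff₀ (by positivity) hL]
  have h3 : (P.L : ℝ) ≤ (1 + P.L) ^ 2 := by nlinarith
  calc P.ε ^ 2 * P.L ≤ P.ε ^ 2 * (1 + P.L) ^ 2 := by gcongr
    _ ≤ P.ε * P.slack * (1 + P.L) ^ 2 := by
      rw [sq P.ε]; gcongr

end Regime

/-- The stability of a ratio. -/
theorem abs_div_sub_div_le {x y X Y β γ : ℝ} (hX : |X - x| ≤ β) (hY : |Y - y| ≤ β) (hx : 0 ≤ x)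
    (hxy : x ≤ y) (hy : 0 < y) (hY0 : 0 < Y) (hγ : 2 * β ≤ γ * Y) : |X / Y - x / y| ≤ γ := by
  have hβ : 0 ≤ β := (abs_nonneg _).trans hX
  have h1 : X / Y - x / y = ((X - x) * y - x * (Y - y)) / (Y * y) := by
    field_simp
    ring
  rw [h1, abs_div, abs_of_pos (mul_pos hY0 hy), div_le_iff₀ (mul_pos hY0 hy)]
  calc |(X - x) * y - x * (Y - y)| ≤ |(X - x) * y| + |x * (Y - y)| := abs_sub _ _
    _ = |X - x| * y + x * |Y - y| := by rw [abs_mul, abs_mul, abs_of_pos hy, abs_of_nonneg hx]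
    _ ≤ β * y + y * β := by gcongr
    _ = 2 * β * y := by ring
    _ ≤ γ * Y * y := by gcongr
    _ = γ * (Y * y) := by ring

/-! ### The direction found by SGD -/

section Sublinear

variable {D : Measure (Example d)} (p : List (Step d)) (i : ℕ)

theorem regionLoss_smul (lam : ℝ) {c : ℝ} (hc : 0 ≤ c) (w : Pt d) :
    regionLoss D p i lam (c • w) = c * regionLoss D p i lam w := by
  unfold regionLoss
  rw [← integral_const_mul]
  exact integral_congr_ae (Filter.Eventually.of_forall fun z => leaky_smul lam hc w z)

theorem regionLoss_zero (lam : ℝ) : regionLoss D p i lam 0 = 0 := by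
  simp [regionLoss, leaky_zero]

theorem regionLoss_add_le [IsProbabilityMeasure D] (hD : ∀ᵐ z ∂D, ‖z.1‖ ≤ 1) {lam : ℝ} (h : lam ≤ 1 / 2) (w w' : Pt d) :
    regionLoss D p i lam (w + w') ≤ regionLoss D p i lam w + regionLoss D p i lam w' := by
  have hi := fun w => (integrable_leaky hD lam w).integrableOn (s := region p i)
  unfold regionLoss
  rw [← integral_add (hi w) (hi w')]
  exact integral_mono (hi _) ((hi w).add (hi w')) fun z => leaky_add_le h w w' z

theorem regionLoss_sum_le [IsProbabilityMeasure D] (hD : ∀ᵐ z ∂D, ‖z.1‖ ≤ 1) {lam : ℝ} (h : lam ≤ 1 / 2) (f : ℕ → Pt d)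
    (m : ℕ) : regionLoss D p i lam (∑ j ∈ Finset.range m, f j) ≤
      ∑ j ∈ Finset.range m, regionLoss D p i lam (f j) := by
  induction m with
  | zero => simp [regionLoss_zero]
  | succ m ih =>
    rw [Finset.sum_range_succ, Finset.sum_range_succ]
    exact (regionLoss_add_le p i hD h _ _).trans (by linarith)

end Sublinear

section Masses

theorem measurable_regionOf : ∀ p : List (Step d), Measurable (regionOf p)
  | [] => measurable_const
  | Step.cut i w τ s j :: p => by
    have h : MeasurableSet {x : Pt d | τ ≤ lab s * inner ℝ w x} :=
      measurableSet_le measurable_const ((measurable_const.inner measurable_id).const_mul _)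
    simp only [regionOf]
    exact Measurable.ite (((measurable_regionOf p) (measurableSet_singleton i)).inter h)
      measurable_const (measurable_regionOf p)
  | Step.merge i j :: p => by
    simp only [regionOf]
    exact Measurable.ite ((measurable_regionOf p) (measurableSet_singleton j)) measurable_const
      (measurable_regionOf p)

theorem measurableSet_region (p : List (Step d)) (i : ℕ) : MeasurableSet (region p i) :=
  ((measurable_regionOf p).comp measurable_fst) (measurableSet_singleton i)

theorem measurableSet_atom (p : List (Step d)) (i : ℕ) (b : Bool) : MeasurableSet (atom p i b) :=
  (measurableSet_region p i).inter (measurable_snd (measurableSet_singleton b))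

theorem measurableSet_sideRegion (p : List (Step d)) (i : ℕ) (w : Pt d) (τ : ℝ) (t : Bool) :
    MeasurableSet (sideRegion p i w τ t) := by
  have h : MeasurableSet {z : Example d | τ ≤ lab t * inner ℝ w z.1} :=
    measurableSet_le measurable_const ((measurable_const.inner measurable_fst).const_mul _)
  exact (measurableSet_region p i).inter h

theorem measurableSet_sideAtom (p : List (Step d)) (i : ℕ) (w : Pt d) (τ : ℝ) (t b : Bool) :
    MeasurableSet (sideAtom p i w τ t b) := by
  have : sideAtom p i w τ t b = sideRegion p i w τ t ∩ {z | z.2 = b} := by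
    ext z; simp [sideAtom, sideRegion, and_assoc]
  rw [this]
  exact (measurableSet_sideRegion p i w τ t).inter (measurable_snd (measurableSet_singleton b))

variable (D : Measure (Example d)) [IsProbabilityMeasure D]

theorem real_region (p : List (Step d)) (i : ℕ) (s : Bool) :
    D.real (region p i) = D.real (atom p i s) + D.real (atom p i (!s)) := by
  rw [← atom_union_atom_not p i s,
    measureReal_union (disjoint_atom_atom_not p i s) (measurableSet_atom p i _)]

theorem real_sideRegion (p : List (Step d)) (i : ℕ) (w : Pt d) (τ : ℝ) (t s : Bool) :
    D.real (sideRegion p i w τ t) =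
      D.real (sideAtom p i w τ t s) + D.real (sideAtom p i w τ t (!s)) := by
  rw [← sideAtom_union_sideAtom_not p i w τ t s,
    measureReal_union (disjoint_sideAtom_sideAtom_not p i w τ t s)
      (measurableSet_sideAtom p i w τ t _)]

variable {D}

theorem Accurate.region {ω : ℕ → Example d} {pos m : ℕ} {α : ℝ} {p : List (Step d)} {i : ℕ}
    (h : ∀ b, Accurate D ω pos m α (atom p i b)) : Accurate D ω pos m (2 * α) (region p i) := by
  have h1 := abs_le.1 (h true)
  have h2 := abs_le.1 (h false)
  rw [Accurate, hits_region ω pos m p i true, real_region D p i true, abs_le]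
  simp only [Bool.not_true]
  constructor <;> linarith [h1.1, h1.2, h2.1, h2.2]

theorem Accurate.sideRegion {ω : ℕ → Example d} {pos m : ℕ} {α : ℝ} {p : List (Step d)} {i : ℕ}
    {w : Pt d} {τ : ℝ} {t : Bool} (h : ∀ b, Accurate D ω pos m α (sideAtom p i w τ t b)) :
    Accurate D ω pos m (2 * α) (sideRegion p i w τ t) := by
  have h1 := abs_le.1 (h true)
  have h2 := abs_le.1 (h false)
  rw [Accurate, hits_sideRegion ω pos m p i w τ t true, real_sideRegion D p i w τ t true, abs_le]
  simp only [Bool.not_true]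
  constructor <;> linarith [h1.1, h1.2, h2.1, h2.2]

end Masses

section Split

variable {K : Constants} {P : Params} {D : Measure (Example d)} [IsProbabilityMeasure D]
  {u : Pt d} {I : ℕ} {p : (ℕ → Example d) → List (Step d)} {n : ℕ} {ω : ℕ → Example d}

theorem indicator_region (p : List (Step d)) (i : ℕ) (f : Example d → ℝ) (z : Example d) :
    (region p i).indicator f z = if inRegion p i z then f z else 0 := by
  by_cases hz : regionOf p z.1 = i
  · rw [Set.indicator_of_mem (show z ∈ region p i from hz)]; simp [inRegion, hz]
  · rw [Set.indicator_of_notMem (show z ∉ region p i from hz)]; simp [inRegion, hz]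

/-- If the true direction has a small loss on a region, then so does the direction found by SGD:
the regret bound compares the iterates with the true direction on the batch, concentration passes
to the population, and the loss of the normalized sum of the iterates is at most their
average loss, as the loss is sublinear. -/
theorem RoundGood.regionLoss_roundDir_le (h : Regime K P)
    (hg : RoundGood K P D u I P.acc p n ω) (hD : ∀ᵐ z ∂D, ‖z.1‖ ≤ 1) (hω : ∀ j, ‖(ω j).1‖ ≤ 1)
    (hu : ‖u‖ ≤ 1) {i : ℕ} (hi : i < I) {k : ℕ} (hk : k < P.grid + 1) {Δ : ℝ}
    (hα : 1000 * P.acc ≤ D.real (region (p ω) i))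
    (hΔ : 100 * P.acc ≤ Δ * D.real (region (p ω) i) ^ 2)
    (hF : regionLoss D (p ω) i (P.ε / 4 * k) u ≤ -(2 * Δ * D.real (region (p ω) i))) :
    regionLoss D (p ω) i (P.ε / 4 * k) (roundDir K P p n i k ω) ≤
      -(19 / 10 * Δ * D.real (region (p ω) i)) := by
  set m := P.batch K with hm
  set lam := P.ε / 4 * k with hlam
  set M := D.real (region (p ω) i) with hM
  set α := P.acc with hαdef
  set pos := Alg.sgdPos K P (n + 2 * m) k with hpos
  have hpos' : pos = n + (P.grid - k + 4) * m := by
    rw [hpos, Alg.sgdPos, ← hm]; ring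
  have l0 : 0 ≤ lam := Params.lam_nonneg h.ε_pos k
  have l1 : lam ≤ 1 / 2 := Params.lam_le_half h.ε_pos hk
  have hmpos : (0 : ℝ) < m := h.batch_pos'
  have hαpos : 0 < α := h.acc_pos
  have hM0 : 0 < M := by linarith
  have hM1 : M ≤ 1 := measureReal_le_one
  have hΔ0 : 0 < Δ := by
    by_contra hc
    have : Δ * M ^ 2 ≤ 0 := mul_nonpos_of_nonpos_of_nonneg (not_lt.1 hc) (sq_nonneg _)
    linarith
  set q := inRegion (p ω) i with hq
  set z : ℕ → Example d := fun j => ω (pos + j) with hz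
  set ν := 1 / Real.sqrt m with hν
  set W : ℕ → Pt d := fun j => (sgdState q lam ν z j).1 with hW
  set F := regionLoss D (p ω) i lam with hFdef
  set V := (sgdState q lam ν z m).2 with hV
  have hdir : roundDir K P p n i k ω = ‖V‖⁻¹ • V := roundDir_eq K P p n i k ω
  have hVsum : V = ∑ j ∈ Finset.range m, if q (z j) then W j else 0 := sgdState_snd q lam ν z m
  have g1 : ∑ j ∈ Finset.range m, (if q (z j) then F (W j) - M * leaky lam (W j) (z j) else 0) ≤
      m * (2 * α) := by
    have := hg.sgd i hi k hk
    simp only [indicator_region] at this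
    exact this
  have g2 : |∑ j ∈ Finset.range m, (if q (z j) then leaky lam u (z j) else 0) - m * F u| ≤
      m * α := by
    have := hg.trueLoss i hi k hk
    simp only [batchLoss, indicator_region] at this
    exact this
  have g3 : hits ω pos m (region (p ω) i) ≤ m * (M + 2 * α) := by
    have := (abs_le.1 (Accurate.region (fun b => hg.atoms i hi (P.grid - k + 4) (by omega) b))).2
    rw [← hpos'] at this
    linarith
  have hs0 : 0 < Real.sqrt m := Real.sqrt_pos.2 hmpos
  have hss : Real.sqrt m * Real.sqrt m = m := Real.mul_self_sqrt hmpos.le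
  have g4 : ∑ j ∈ Finset.range m, (if q (z j) then leaky lam (W j) (z j) - leaky lam u (z j)
      else 0) ≤ Real.sqrt m := by
    have := sgd_regret (q := q) l0 l1 (by positivity : 0 ≤ ν) hu m (z := z)
      (fun j _ => hω _)
    have h1 : ν ^ 2 * m = 1 := by
      rw [hν, div_pow, one_pow, sq, hss]; field_simp
    rw [h1] at this
    have h2 := sq_nonneg ‖(sgdState q lam ν z m).1 - u‖
    set S := ∑ j ∈ Finset.range m, (if q (z j) then leaky lam (W j) (z j) - leaky lam u (z j)
      else 0) with hS
    have h3 : 2 * ν * S ≤ 2 := by linarith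
    have h4 : ν * Real.sqrt m = 1 := by rw [hν]; field_simp
    have h5 := mul_le_mul_of_nonneg_right h3 hs0.le
    have h6 : 2 * ν * S * Real.sqrt m = 2 * S := by
      rw [show 2 * ν * S * Real.sqrt m = 2 * S * (ν * Real.sqrt m) by ring, h4, mul_one]
    linarith
  have g5 : Real.sqrt m ≤ m * α := h.sqrt_batch_le
  -- the loss of the sum of the iterates
  have g6 : F V ≤ m * (4 * α + M * F u) := by
    have e1 : F V ≤ ∑ j ∈ Finset.range m, (if q (z j) then F (W j) else 0) := by
      rw [hVsum]
      refine (regionLoss_sum_le (p ω) i hD l1 _ m).trans (le_of_eq ?_)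
      refine Finset.sum_congr rfl fun j _ => ?_
      split_ifs
      · rfl
      · exact regionLoss_zero _ _ _
    have e2 : ∑ j ∈ Finset.range m, (if q (z j) then F (W j) else 0) =
        ∑ j ∈ Finset.range m, (if q (z j) then F (W j) - M * leaky lam (W j) (z j) else 0) +
        M * (∑ j ∈ Finset.range m, (if q (z j) then leaky lam (W j) (z j) - leaky lam u (z j)
          else 0) + ∑ j ∈ Finset.range m, (if q (z j) then leaky lam u (z j) else 0)) := by
      rw [← Finset.sum_add_distrib, Finset.mul_sum, ← Finset.sum_add_distrib]
      refine Finset.sum_congr rfl fun j _ => ?_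
      split_ifs <;> ring
    have e3 := (abs_le.1 g2).2
    have e4 := mul_le_mul_of_nonneg_left (add_le_add g4 (show _ ≤ m * F u + m * α by linarith))
      hM0.le
    have e5 : M * (Real.sqrt m + (m * F u + m * α)) ≤ M * (m * F u) + 2 * (m * α) := by
      have : M * (Real.sqrt m + m * α) ≤ 1 * (m * α + m * α) := by gcongr
      linarith
    linarith
  have g7 : F V ≤ -(m * (Δ * M ^ 2) * (196 / 100)) := by
    have : M * F u ≤ -(2 * Δ * M ^ 2) := by
      have := mul_le_mul_of_nonneg_left hF hM0.le
      linarith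
    have h2 : 4 * α + M * F u ≤ -((Δ * M ^ 2) * (196 / 100)) := by linarith
    have := mul_le_mul_of_nonneg_left h2 hmpos.le
    linarith
  have hVn : ‖V‖ ≤ m * (M * (1002 / 1000)) := by
    have e1 : ‖V‖ ≤ hits ω pos m (region (p ω) i) := by
      rw [hVsum, hits]
      refine (norm_sum_le _ _).trans (Finset.sum_le_sum fun j _ => ?_)
      rw [indicator_region]
      split_ifs
      · exact norm_sgdState_le _ _ _ _ _
      · simp
    refine e1.trans (g3.trans ?_)
    gcongr
    linarith
  have hneg : F V < 0 := by
    have : 0 < m * (Δ * M ^ 2) := by positivity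
    linarith
  have hV0 : 0 < ‖V‖ := by
    refine norm_pos_iff.2 fun h0 => ?_
    rw [h0, hFdef, regionLoss_zero] at hneg
    exact lt_irrefl _ hneg
  rw [hdir, hFdef, regionLoss_smul _ _ _ (inv_nonneg.2 hV0.le), inv_mul_le_iff₀ hV0]
  have e1 : ‖V‖ * (19 / 10 * Δ * M) ≤ m * (M * (1002 / 1000)) * (19 / 10 * Δ * M) := by gcongr
  have e2 : 0 < m * (Δ * M ^ 2) := by positivity
  have e3 : m * (M * (1002 / 1000)) * (19 / 10 * Δ * M) =
      m * (Δ * M ^ 2) * (1002 / 1000 * (19 / 10)) := by ring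
  linarith

end Split

/-! ### The candidate annulus -/

theorem batchLoss_eq (ω : ℕ → Example d) (pos m : ℕ) (p : List (Step d)) (i : ℕ) (lam : ℝ)
    (w : Pt d) : batchLoss ω pos m p i lam w =
      ((Alg.proj w (Alg.batchIn ω p i pos m)).map fun a =>
        ((if lab a.2 * a.1 < 0 then 1 else 0) - lam) * |a.1|).sum := by
  unfold batchLoss Alg.proj Alg.batchIn Alg.batch
  induction m with
  | zero => simp
  | succ m ih =>
    rw [Finset.sum_range_succ, ih, List.range_succ, List.map_append, List.filter_append,
      List.map_append, List.map_append, List.sum_append, indicator_region, leaky_eq_ite]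
    congr 1
    by_cases hz : regionOf p (ω (pos + m)).1 = i <;> simp [inRegion, hz]

theorem exists_of_mem_absProj {ω : ℕ → Example d} {pos m : ℕ} {p : List (Step d)} {i : ℕ}
    {w : Pt d} {τ : ℝ} (h : τ ∈ Alg.absProj w (Alg.batchIn ω p i pos m)) :
    ∃ a < m, τ = |inner ℝ w (ω (pos + a)).1| := by
  simp only [Alg.absProj, Alg.proj, Alg.batchIn, Alg.batch, List.map_map, List.mem_map,
    List.mem_filter, List.mem_range] at h
  obtain ⟨z, ⟨⟨a, ha, rfl⟩, -⟩, rfl⟩ := h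
  exact ⟨a, ha, rfl⟩

theorem scanList_eq (K : Constants) (P : Params) (ω : ℕ → Example d) (p : List (Step d))
    (i n : ℕ) : Alg.scanList K P ω p i (n + 2 * P.batch K) =
      Alg.batchIn ω p i (n + 3 * P.batch K) (P.batch K) := by
  rw [Alg.scanList]; congr 1; ring

theorem sideList_eq (K : Constants) (P : Params) (ω : ℕ → Example d) (p : List (Step d))
    (i n : ℕ) : Alg.sideList K P ω p i (n + 2 * P.batch K) =
      Alg.batchIn ω p i (n + (P.grid + 5) * P.batch K) (P.batch K) := by
  rw [Alg.sideList]; congr 1; ring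

section Split

variable {K : Constants} {P : Params} {D : Measure (Example d)} [IsProbabilityMeasure D]
  {u : Pt d} {I : ℕ} {p : (ℕ → Example d) → List (Step d)} {n : ℕ} {ω : ℕ → Example d}

theorem Regime.acc_le_mul (h : Regime K P) {M : ℝ} (hM : P.scale ^ 17 ≤ M) :
    P.acc ≤ P.scale ^ 25 * M * (1 / 100) ^ 4 := by
  refine (h.acc_le_pow (k := 42) (by norm_num)).trans ?_
  have := h.scale_pos
  rw [show 42 = 25 + 17 from rfl, pow_add]
  gcongr

theorem Regime.acc_le_scale_pow_mul (h : Regime K P) {M : ℝ} (hM : P.scale ^ 17 ≤ M) {k : ℕ}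
    (hk : k ≤ 25) : P.acc ≤ P.scale ^ k * M * (1 / 100) ^ 4 := by
  refine (h.acc_le_mul hM).trans ?_
  have h1 := h.scale_pos
  have h2 : 0 < M := lt_of_lt_of_le (pow_pos h1 _) hM
  have := pow_le_pow_of_le_one h1.le (h.scale_le.trans (by norm_num)) hk
  gcongr

/-- If the direction found by SGD has a small loss, then some annulus passes the mass test and has
a small empirical error. -/
theorem RoundGood.exists_admissible (h : Regime K P) (hg : RoundGood K P D u I P.acc p n ω)
    (hω : ∀ j, ‖(ω j).1‖ ≤ 1) {i : ℕ} (hi : i < I) {k : ℕ} (hk : k < P.grid + 1)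
    (hL : 0 < (P.L : ℝ)) (hM : P.scale ^ 17 ≤ D.real (region (p ω) i))
    (hF : regionLoss D (p ω) i (P.ε / 4 * k) (roundDir K P p n i k ω) ≤
      -(19 / 10 * (P.ε * P.slack / P.L) * D.real (region (p ω) i))) :
    ∃ τ ∈ Alg.absProj (roundDir K P p n i k ω)
        (Alg.batchIn ω (p ω) i (n + 3 * P.batch K) (P.batch K)),
      Alg.Admissible P (P.ε / 4 * k) (Alg.proj (roundDir K P p n i k ω)
        (Alg.batchIn ω (p ω) i (n + 3 * P.batch K) (P.batch K))) τ ∧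
      Alg.annulusErr (Alg.proj (roundDir K P p n i k ω)
        (Alg.batchIn ω (p ω) i (n + 3 * P.batch K) (P.batch K))) τ ≤ P.ε / 4 * k := by
  set m := P.batch K with hm
  set lam := P.ε / 4 * k with hlam
  set M := D.real (region (p ω) i) with hMdef
  set w := roundDir K P p n i k ω with hw
  set Δ := P.ε * P.slack / P.L with hΔ
  set S := Alg.batchIn ω (p ω) i (n + 3 * m) m with hS
  have hmpos : (0 : ℝ) < m := h.batch_pos'
  have hM0 : 0 < M := lt_of_lt_of_le (pow_pos h.scale_pos _) hM
  have hΔy : P.scale ^ 2 ≤ Δ := h.scale_sq_le hL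
  have hΔ0 : 0 < Δ := lt_of_lt_of_le (pow_pos h.scale_pos _) hΔy
  have l0 : 0 ≤ lam := Params.lam_nonneg h.ε_pos k
  have a1 : P.acc ≤ Δ * M * (1 / 100) ^ 4 := (h.acc_le_scale_pow_mul hM (k := 2) (by norm_num)).trans
    (by gcongr)
  have a2 : P.acc ≤ M * (1 / 100) ^ 4 := by
    simpa using h.acc_le_scale_pow_mul hM (k := 0) (by norm_num)
  have hsum : ((Alg.proj w S).map fun a =>
      ((if lab a.2 * a.1 < 0 then 1 else 0) - lam) * |a.1|).sum ≤
      -(2 * (9 / 10 * Δ * M * m)) := by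
    rw [← batchLoss_eq]
    have := (abs_le.1 (hg.scanLoss i hi k hk)).2
    have h2 : batchLoss ω (n + 3 * m) m (p ω) i lam w ≤ m * (-(19 / 10 * Δ * M)) + m * P.acc := by
      have := mul_le_mul_of_nonneg_left hF hmpos.le
      linarith
    have h3 : m * P.acc ≤ m * (Δ * M * (1 / 100) ^ 4) := by gcongr
    have h4 : 0 < m * (Δ * M) := by positivity
    linarith
  have hκ : 0 < 9 / 10 * Δ * M * m := by positivity
  -- a threshold at which the errors fall short of `lam` times the mass by a definite amount: the
  -- mass is then large, and the relative error is at most `lam`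
  obtain ⟨τ, hτ, hτ0, hle⟩ := exists_threshold hκ (Alg.proj w S) (fun a ha => by
    simp only [Alg.proj, hS, Alg.batchIn, Alg.batch, List.mem_map, List.mem_filter] at ha
    obtain ⟨z, ⟨⟨j, -, rfl⟩, -⟩, rfl⟩ := ha
    exact (abs_real_inner_le_norm _ _).trans (mul_le_one₀ (norm_roundDir_le _ _ _)
      (norm_nonneg _) (hω _))) hsum
  refine ⟨τ, hτ, ⟨hτ0, ?_⟩, ?_⟩
  · set N : ℝ := ((Alg.annulus (Alg.proj w S) τ).length : ℝ) with hN
    have hlen : ((Alg.proj w S).length : ℝ) ≤ m * (M * (1002 / 1000)) := by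
      have h1 := (abs_le.1 (Accurate.region (fun b => hg.atoms i hi 3 (by omega) b))).2
      rw [Alg.proj, List.length_map, hS, length_batchIn]
      have h2 : m * (2 * P.acc) ≤ m * (2 * (M * (1 / 100) ^ 4)) := by gcongr
      have h3 : 0 < m * M := by positivity
      linarith
    have hNl : 9 / 10 * Δ * M * m ≤ lam * N := by
      have : (0 : ℝ) ≤ ((Alg.annulus (Alg.proj w S) τ).countP
        fun a => decide (lab a.2 * a.1 < 0) : ℝ) := Nat.cast_nonneg _
      linarith
    have hlen0 : 0 < ((Alg.proj w S).length : ℝ) := by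
      have : N ≤ (Alg.proj w S).length := by
        exact Nat.cast_le.2 (List.length_filter_le _ _)
      have hN0 : 0 < N := by
        by_contra hc
        have := mul_nonpos_of_nonneg_of_nonpos l0 (not_lt.1 hc)
        linarith
      linarith
    have e1 : P.ε * P.slack = P.L * Δ := by rw [hΔ]; field_simp
    rw [e1, show 9 * (P.L : ℝ) * lam * (N / (Alg.proj w S).length) =
      P.L * (9 * (lam * N)) / (Alg.proj w S).length by ring, le_div_iff₀ hlen0, mul_assoc]
    refine mul_le_mul_of_nonneg_left ?_ hL.le
    have e2 := mul_le_mul_of_nonneg_left hlen hΔ0.le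
    have e3 : 0 < Δ * (m * M) := by positivity
    linarith
  · rw [Alg.annulusErr]
    refine div_le_of_le_mul₀ (Nat.cast_nonneg _) l0 ?_
    linarith

variable {i k a : ℕ}

/-- The facts about a candidate annulus that hold when the estimates are accurate: the true mass
of the annulus is not much smaller than required by the test, and the empirical error is
close to the true one. -/
theorem RoundGood.candidate (h : Regime K P) (hg : RoundGood K P D u I P.acc p n ω) (hi : i < I)
    (hk : k < P.grid + 1) (ha : a < P.batch K) (hM : P.scale ^ 17 ≤ D.real (region (p ω) i))
    (hadm : Alg.Admissible P (P.ε / 4 * k) (Alg.proj (roundDir K P p n i k ω)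
        (Alg.batchIn ω (p ω) i (n + 3 * P.batch K) (P.batch K))) (roundThr K P p n i k a ω)) :
    0 < P.L * (P.ε / 4 * k) ∧
    2 * P.scale ^ 2 ≤ P.ε * P.slack / (P.L * (P.ε / 4 * k)) ∧
    99 / 900 * (P.ε * P.slack / (P.L * (P.ε / 4 * k))) * D.real (region (p ω) i) ≤
      D.real (sideRegion (p ω) i (roundDir K P p n i k ω) (roundThr K P p n i k a ω) true) +
      D.real (sideRegion (p ω) i (roundDir K P p n i k ω) (roundThr K P p n i k a ω) false) ∧
    D.real (sideAtom (p ω) i (roundDir K P p n i k ω) (roundThr K P p n i k a ω) true false) +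
      D.real (sideAtom (p ω) i (roundDir K P p n i k ω) (roundThr K P p n i k a ω) false true) ≤
      (Alg.annulusErr (Alg.proj (roundDir K P p n i k ω)
        (Alg.batchIn ω (p ω) i (n + 3 * P.batch K) (P.batch K))) (roundThr K P p n i k a ω) +
        P.ε / 4) *
      (D.real (sideRegion (p ω) i (roundDir K P p n i k ω) (roundThr K P p n i k a ω) true) +
      D.real (sideRegion (p ω) i (roundDir K P p n i k ω) (roundThr K P p n i k a ω) false)) := by
  set m := P.batch K with hm
  set lam := P.ε / 4 * k with hlam
  set M := D.real (region (p ω) i) with hMdef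
  set w := roundDir K P p n i k ω with hw
  set τ := roundThr K P p n i k a ω with hτ
  set S := Alg.batchIn ω (p ω) i (n + 3 * m) m with hS
  have hmpos : (0 : ℝ) < m := h.batch_pos'
  have hy := h.scale_pos
  have hM0 : 0 < M := lt_of_lt_of_le (pow_pos hy _) hM
  have l0 : 0 ≤ lam := Params.lam_nonneg h.ε_pos k
  have l1 : lam ≤ 1 / 2 := Params.lam_le_half h.ε_pos hk
  obtain ⟨hτ0, hmass⟩ := hadm
  rw [length_annulus ω _ _ (p ω) i w hτ0, Alg.proj, List.length_map, length_batchIn] at hmass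
  set NR := hits ω (n + 3 * m) m (region (p ω) i) with hNR
  set NA := hits ω (n + 3 * m) m (sideRegion (p ω) i w τ true) +
    hits ω (n + 3 * m) m (sideRegion (p ω) i w τ false) with hNA
  have hes : 0 < P.ε * P.slack := mul_pos h.ε_pos h.slack_pos
  have hpos : 0 < P.L * lam := by
    have hnn : 0 ≤ P.L * lam := mul_nonneg P.L.coe_nonneg l0
    rcases hnn.eq_or_lt with h0 | h0
    · rw [mul_assoc 9, ← h0] at hmass
      linarith
    · exact h0
  have hL : 0 < (P.L : ℝ) := by
    refine lt_of_le_of_ne P.L.coe_nonneg fun h0 => ?_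
    rw [← h0, zero_mul] at hpos
    exact lt_irrefl _ hpos
  have hlam0 : 0 < lam := by
    refine lt_of_le_of_ne l0 fun h0 => ?_
    rw [← h0, mul_zero] at hpos
    exact lt_irrefl _ hpos
  set Θ := P.ε * P.slack / (P.L * lam) with hΘ
  have hΘ2 : 2 * P.scale ^ 2 ≤ Θ := by
    have h1 := h.scale_sq_le hL
    have h2 : P.ε * P.slack / P.L = Θ * lam := by rw [hΘ]; field_simp
    rw [h2] at h1
    have h3 : 0 < Θ := div_pos hes hpos
    have := mul_le_mul_of_nonneg_left l1 h3.le
    linarith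
  have hΘ0 : 0 < Θ := lt_of_lt_of_le (by positivity) hΘ2
  have hNRlow : m * (M * (999 / 1000)) ≤ NR := by
    have h1 := (abs_le.1 (Accurate.region (fun b => hg.atoms i hi 3 (by omega) b))).1
    have a2 : P.acc ≤ M * (1 / 100) ^ 4 := by
      simpa using h.acc_le_scale_pow_mul hM (k := 0) (by norm_num)
    have h2 : m * (2 * P.acc) ≤ m * (2 * (M * (1 / 100) ^ 4)) := by gcongr
    have h3 : 0 < m * M := by positivity
    linarith
  have hNR0 : 0 < NR := lt_of_lt_of_le (by positivity) hNRlow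
  have hNAlow : Θ / 9 * NR ≤ NA := by
    have e1 : P.ε * P.slack = Θ * (P.L * lam) := by rw [hΘ]; field_simp
    rw [e1, show 9 * (P.L : ℝ) * lam * (NA / NR) = 9 * (NA / NR) * (P.L * lam) by ring] at hmass
    have h1 := le_of_mul_le_mul_right hmass hpos
    rw [← mul_div_assoc, le_div_iff₀ hNR0] at h1
    linarith
  have hA : ∀ t, Accurate D ω (n + 3 * m) m (2 * (2 * P.acc)) (sideRegion (p ω) i w τ t) :=
    fun t => Accurate.sideRegion fun b => hg.scanSides i hi k hk a ha t b
  have hA' : ∀ t b, Accurate D ω (n + 3 * m) m (2 * P.acc) (sideAtom (p ω) i w τ t b) :=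
    fun t b => hg.scanSides i hi k hk a ha t b
  set pA := D.real (sideRegion (p ω) i w τ true) + D.real (sideRegion (p ω) i w τ false) with hpA
  have hacc : P.acc ≤ Θ * M * (1 / 100) ^ 4 :=
    (h.acc_le_scale_pow_mul hM (k := 2) (by norm_num)).trans (by
      have : P.scale ^ 2 ≤ Θ := by have := sq_nonneg P.scale; linarith
      gcongr)
  have hNAclose : |NA - m * pA| ≤ m * (8 * P.acc) := by
    have h1 := abs_le.1 (hA true)
    have h2 := abs_le.1 (hA false)
    rw [abs_le]
    constructor <;> linarith [h1.1, h1.2, h2.1, h2.2]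
  have hmacc : m * P.acc ≤ m * (Θ * M * (1 / 100) ^ 4) := by gcongr
  have hmΘ : 0 < m * (Θ * M) := by positivity
  have hNAlow' : m * (Θ * M * (999 / 9000)) ≤ NA := by
    refine le_trans (le_of_eq (by ring)) ((mul_le_mul_of_nonneg_left hNRlow
      (by positivity : 0 ≤ Θ / 9)).trans hNAlow)
  have hpAlow : 99 / 900 * Θ * M ≤ pA := by
    refine le_of_mul_le_mul_left ?_ hmpos
    have := (abs_le.1 hNAclose).2
    linarith
  refine ⟨hpos, hΘ2, hpAlow, ?_⟩
  have hpA0 : 0 < pA := lt_of_lt_of_le (by positivity) hpAlow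
  have hNA0 : 0 < NA := lt_of_lt_of_le (by positivity) hNAlow'
  rw [Alg.annulusErr, length_annulus ω _ _ (p ω) i w hτ0, countP_annulus ω _ _ (p ω) i w hτ0]
  set NW := hits ω (n + 3 * m) m (sideAtom (p ω) i w τ true false) +
    hits ω (n + 3 * m) m (sideAtom (p ω) i w τ false true) with hNW
  set pW := D.real (sideAtom (p ω) i w τ true false) + D.real (sideAtom (p ω) i w τ false true)
    with hpW
  have hpWle : pW ≤ pA := by
    have h1 := real_sideRegion D (p ω) i w τ true false
    have h2 := real_sideRegion D (p ω) i w τ false true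
    have h3 : 0 ≤ D.real (sideAtom (p ω) i w τ true (!false)) := measureReal_nonneg
    have h4 : 0 ≤ D.real (sideAtom (p ω) i w τ false (!true)) := measureReal_nonneg
    linarith
  have hNWclose : |NW - m * pW| ≤ m * (8 * P.acc) := by
    have h1 := abs_le.1 (hA' true false)
    have h2 := abs_le.1 (hA' false true)
    have := mul_nonneg hmpos.le h.acc_pos.le
    rw [abs_le]
    constructor <;> linarith [h1.1, h1.2, h2.1, h2.2]
  have hacc4 : P.acc ≤ P.ε * (Θ * M * (1 / 100) ^ 4) :=
    (h.acc_le_scale_pow_mul hM (k := 3) (by norm_num)).trans (by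
      have h1 : P.scale ^ 2 ≤ Θ := by have := sq_nonneg P.scale; linarith
      have h2 := h.scale_le_ε
      calc P.scale ^ 3 * M * (1 / 100) ^ 4 = P.scale * (P.scale ^ 2 * M * (1 / 100) ^ 4) := by ring
        _ ≤ P.ε * (Θ * M * (1 / 100) ^ 4) := by
          have := h.ε_pos
          gcongr)
  have key := abs_div_sub_div_le hNWclose hNAclose (γ := P.ε / 4)
    (mul_nonneg hmpos.le (add_nonneg measureReal_nonneg measureReal_nonneg))
    (mul_le_mul_of_nonneg_left hpWle hmpos.le) (mul_pos hmpos hpA0) hNA0 (by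
      have h1 : m * P.acc ≤ m * (P.ε * (Θ * M * (1 / 100) ^ 4)) := by gcongr
      have h2 := mul_le_mul_of_nonneg_left hNAlow' (by linarith [h.ε_pos] : 0 ≤ P.ε / 4)
      have h3 : 0 < P.ε * (m * (Θ * M)) := mul_pos h.ε_pos hmΘ
      linarith)
  rw [mul_div_mul_left _ _ hmpos.ne'] at key
  have := (abs_le.1 key).1
  rw [← div_le_iff₀ hpA0]
  linarith

end Split

/-! ### The two sides of the annulus -/

section Split

variable {K : Constants} {P : Params} {D : Measure (Example d)} [IsProbabilityMeasure D]
  {u : Pt d} {I : ℕ} {p : (ℕ → Example d) → List (Step d)} {n : ℕ} {ω : ℕ → Example d}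
  {i k a : ℕ}

/-- If the side `t` has enough estimated mass, then its mass and error are estimated well. -/
theorem RoundGood.sideErr_close (h : Regime K P) (hg : RoundGood K P D u I P.acc p n ω)
    (hi : i < I) (hk : k < P.grid + 1) (ha : a < P.batch K)
    (hM : P.scale ^ 17 ≤ D.real (region (p ω) i)) {t : Bool}
    (ht : P.scale ^ 4 ≤ Alg.sideMass (Alg.batchIn ω (p ω) i (n + (P.grid + 5) * P.batch K)
      (P.batch K)) (roundDir K P p n i k ω) (roundThr K P p n i k a ω) t) :
    98 / 100 * P.scale ^ 4 * D.real (region (p ω) i) ≤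
      D.real (sideRegion (p ω) i (roundDir K P p n i k ω) (roundThr K P p n i k a ω) t) ∧
    |Alg.sideErr (Alg.batchIn ω (p ω) i (n + (P.grid + 5) * P.batch K)
      (P.batch K)) (roundDir K P p n i k ω) (roundThr K P p n i k a ω) t -
      D.real (sideAtom (p ω) i (roundDir K P p n i k ω) (roundThr K P p n i k a ω) t (!t)) /
      D.real (sideRegion (p ω) i (roundDir K P p n i k ω) (roundThr K P p n i k a ω) t)| ≤
      P.ε / 8 := by
  set m := P.batch K with hm
  set M := D.real (region (p ω) i) with hMdef
  set w := roundDir K P p n i k ω with hw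
  set τ := roundThr K P p n i k a ω with hτ
  have hmpos : (0 : ℝ) < m := h.batch_pos'
  have hy := h.scale_pos
  have hM0 : 0 < M := lt_of_lt_of_le (pow_pos hy _) hM
  rw [sideMass_batchIn] at ht
  rw [sideErr_batchIn]
  set N := hits ω (n + (P.grid + 5) * m) m (sideRegion (p ω) i w τ t) with hN
  set q := D.real (sideRegion (p ω) i w τ t) with hq
  have hNR : m * (M * (999 / 1000)) ≤ hits ω (n + (P.grid + 5) * m) m (region (p ω) i) := by
    have h1 := (abs_le.1 (Accurate.region
      (fun b => hg.atoms i hi (P.grid + 5) (by omega) b))).1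
    have a2 : P.acc ≤ M * (1 / 100) ^ 4 := by
      simpa using h.acc_le_scale_pow_mul hM (k := 0) (by norm_num)
    have h2 : m * (2 * P.acc) ≤ m * (2 * (M * (1 / 100) ^ 4)) := by gcongr
    have h3 : 0 < m * M := by positivity
    linarith
  have hNR0 := lt_of_lt_of_le (show 0 < m * (M * (999 / 1000)) by positivity) hNR
  have hNlow : m * (P.scale ^ 4 * M * (999 / 1000)) ≤ N := by
    rw [le_div_iff₀ hNR0] at ht
    exact le_trans (le_of_eq (by ring)) ((mul_le_mul_of_nonneg_left hNR
      (pow_nonneg hy.le 4)).trans ht)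
  have hclose : |N - m * q| ≤ m * (2 * P.acc) :=
    Accurate.sideRegion fun b => hg.sides i hi k hk a ha t b
  have hacc : P.acc ≤ P.scale ^ 4 * M * (1 / 100) ^ 4 :=
    h.acc_le_scale_pow_mul hM (k := 4) (by norm_num)
  have hy4 : 0 < m * (P.scale ^ 4 * M) := by positivity
  have hqlow : 98 / 100 * P.scale ^ 4 * M ≤ q := by
    refine le_of_mul_le_mul_left ?_ hmpos
    have h1 := (abs_le.1 hclose).2
    have h2 : m * P.acc ≤ m * (P.scale ^ 4 * M * (1 / 100) ^ 4) := by gcongr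
    linarith
  refine ⟨hqlow, ?_⟩
  have hq0 : 0 < q := lt_of_lt_of_le (by positivity) hqlow
  have hsub : D.real (sideAtom (p ω) i w τ t (!t)) ≤ q := by
    rw [hq, real_sideRegion D (p ω) i w τ t t]
    linarith [measureReal_nonneg (μ := D) (s := sideAtom (p ω) i w τ t t)]
  have hcl2 : |hits ω (n + (P.grid + 5) * m) m (sideAtom (p ω) i w τ t (!t)) -
      m * D.real (sideAtom (p ω) i w τ t (!t))| ≤ m * (2 * P.acc) :=
    (hg.sides i hi k hk a ha t (!t)).trans (by
      have := mul_nonneg hmpos.le h.acc_pos.le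
      linarith)
  have key := abs_div_sub_div_le hcl2 hclose (γ := P.ε / 8) (mul_nonneg hmpos.le measureReal_nonneg)
    (mul_le_mul_of_nonneg_left hsub hmpos.le) (mul_pos hmpos hq0)
    (lt_of_lt_of_le (by positivity) hNlow) (by
      have h1 : P.acc ≤ P.ε * (P.scale ^ 4 * M * (1 / 100) ^ 4) :=
        (h.acc_le_scale_pow_mul hM (k := 5) (by norm_num)).trans (by
          rw [show P.scale ^ 5 * M * (1 / 100) ^ 4 = P.scale * (P.scale ^ 4 * M * (1 / 100) ^ 4) by
            ring]
          exact mul_le_mul_of_nonneg_right h.scale_le_ε (by positivity))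
      have h2 : m * P.acc ≤ m * (P.ε * (P.scale ^ 4 * M * (1 / 100) ^ 4)) := by gcongr
      have h3 := mul_le_mul_of_nonneg_left hNlow (by linarith [h.ε_pos] : 0 ≤ P.ε / 8)
      have h4 := mul_pos h.ε_pos hy4
      linarith)
  rwa [mul_div_mul_left _ _ hmpos.ne'] at key

theorem Regime.massTest_iff (h : Regime K P) {lam : ℝ} (hpos : 0 < P.L * lam) (x : ℝ) :
    P.ε ^ 2 * P.slack ≤ K.cMass * P.L * lam * x ↔
      P.ε * (P.ε * P.slack / (P.L * lam)) ≤ 40 * x := by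
  rw [← mul_div_assoc, div_le_iff₀ hpos, h.cMass]
  push_cast
  rw [show P.ε * (P.ε * P.slack) = P.ε ^ 2 * P.slack by ring,
    show 40 * x * (P.L * lam) = 40 * P.L * lam * x by ring]

theorem Regime.le_of_massTest (h : Regime K P) {Θ : ℝ} (hΘ : 2 * P.scale ^ 2 ≤ Θ) {x : ℝ}
    (hx : P.ε * Θ ≤ 40 * x) : P.scale ^ 4 ≤ x := by
  have h1 : P.scale * (2 * P.scale ^ 2) ≤ P.ε * Θ :=
    mul_le_mul h.scale_le_ε hΘ (by positivity) h.ε_pos.le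
  have h3 : P.scale * (2 * P.scale ^ 2) = 2 * P.scale ^ 3 := by ring
  have h4 := h.scale_pow_le 3 1
  have := pow_pos h.scale_pos 3
  linarith

/-- The side that the algorithm chooses has enough estimated mass. -/
theorem RoundGood.le_sideMass_chosenSide (h : Regime K P)
    (hg : RoundGood K P D u I P.acc p n ω) (hi : i < I)
    (hk : k < P.grid + 1) (ha : a < P.batch K) (hM : P.scale ^ 17 ≤ D.real (region (p ω) i))
    (hadm : Alg.Admissible P (P.ε / 4 * k) (Alg.proj (roundDir K P p n i k ω)
        (Alg.batchIn ω (p ω) i (n + 3 * P.batch K) (P.batch K))) (roundThr K P p n i k a ω)) :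
    let S := Alg.batchIn ω (p ω) i (n + (P.grid + 5) * P.batch K) (P.batch K)
    P.scale ^ 4 ≤ Alg.sideMass S (roundDir K P p n i k ω) (roundThr K P p n i k a ω)
      (Alg.chosenSide K P S (roundDir K P p n i k ω) (roundThr K P p n i k a ω)
        (P.ε / 4 * k)) := by
  obtain ⟨hpos, hΘ2, hpA, -⟩ := hg.candidate h hi hk ha hM hadm
  intro S
  set m := P.batch K with hm
  set M := D.real (region (p ω) i) with hMdef
  set w := roundDir K P p n i k ω with hw
  set τ := roundThr K P p n i k a ω with hτ
  set lam := P.ε / 4 * k with hlam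
  set Θ := P.ε * P.slack / (P.L * lam) with hΘ
  have hmpos : (0 : ℝ) < m := h.batch_pos'
  have hy := h.scale_pos
  have hy1 := h.scale_le
  have hy2 : 0 < P.scale ^ 2 := by positivity
  have hM0 : 0 < M := lt_of_lt_of_le (pow_pos hy _) hM
  have hε := h.ε_pos
  have hΘ0 : 0 < Θ := by linarith
  have hy3 : P.scale ^ 3 ≤ 1 / 100 * P.scale ^ 2 := by
    rw [pow_succ, mul_comm]; gcongr
  have hy4 : P.scale ^ 4 ≤ 1 / 100 * P.scale ^ 3 := by
    rw [pow_succ, mul_comm]; gcongr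
  unfold Alg.chosenSide
  split_ifs with hcase
  · have hmin := h.le_of_massTest hΘ2 ((h.massTest_iff hpos _).1 hcase)
    cases decide (Alg.sideErr S w τ true ≤ Alg.sideErr S w τ false)
    · exact hmin.trans (min_le_right _ _)
    · exact hmin.trans (min_le_left _ _)
  · have hA : ∀ t, Accurate D ω (n + (P.grid + 5) * m) m (2 * P.acc) (sideRegion (p ω) i w τ t) :=
      fun t => Accurate.sideRegion fun b => hg.sides i hi k hk a ha t b
    have hR := (abs_le.1 (Accurate.region
      (fun b => hg.atoms i hi (P.grid + 5) (by omega) b)))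
    have a2 : P.acc ≤ M * (1 / 100) ^ 4 := by
      simpa using h.acc_le_scale_pow_mul hM (k := 0) (by norm_num)
    have a3 : m * P.acc ≤ m * (M * (1 / 100) ^ 4) := by gcongr
    have hmM : 0 < m * M := by positivity
    have hR0 : 0 < hits ω (n + (P.grid + 5) * m) m (region (p ω) i) := by linarith [hR.1]
    have hsum : 2 * P.scale ^ 4 ≤ Alg.sideMass S w τ true + Alg.sideMass S w τ false := by
      rw [sideMass_batchIn, sideMass_batchIn, ← add_div, le_div_iff₀ hR0]
      have h1 := (abs_le.1 (hA true)).1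
      have h2 := (abs_le.1 (hA false)).1
      have a4 : P.acc ≤ P.scale ^ 2 * M * (1 / 100) ^ 4 :=
        h.acc_le_scale_pow_mul hM (k := 2) (by norm_num)
      have a5 : m * P.acc ≤ m * (P.scale ^ 2 * M * (1 / 100) ^ 4) := by gcongr
      have a6 : 99 / 900 * (2 * P.scale ^ 2) * M ≤ 99 / 900 * Θ * M := by gcongr
      have a7 := mul_le_mul_of_nonneg_left (a6.trans hpA) hmpos.le
      have a8 : P.scale ^ 4 * hits ω (n + (P.grid + 5) * m) m (region (p ω) i) ≤
          P.scale ^ 4 * (2 * (m * M)) := by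
        gcongr
        linarith [hR.2]
      have a9 : P.scale ^ 4 * (2 * (m * M)) ≤ 1 / 100 * (1 / 100 * P.scale ^ 2) * (2 * (m * M)) := by
        gcongr
        linarith
      have a10 : 0 < P.scale ^ 2 * (m * M) := by positivity
      linarith
    by_cases hle : Alg.sideMass S w τ false ≤ Alg.sideMass S w τ true
    · rw [decide_eq_true hle]; linarith
    · rw [decide_eq_false hle]; linarith [not_le.1 hle]

/-- If the candidate annulus has a small empirical error, then so has the chosen side. -/
theorem RoundGood.sideErr_chosenSide_le (h : Regime K P)
    (hg : RoundGood K P D u I P.acc p n ω) (hi : i < I)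
    (hk : k < P.grid + 1) (ha : a < P.batch K) (hM : P.scale ^ 17 ≤ D.real (region (p ω) i))
    (hadm : Alg.Admissible P (P.ε / 4 * k) (Alg.proj (roundDir K P p n i k ω)
        (Alg.batchIn ω (p ω) i (n + 3 * P.batch K) (P.batch K))) (roundThr K P p n i k a ω))
    {c : ℝ} (hc0 : 0 ≤ c) (hc : c ≤ 1 / 2) (herr : Alg.annulusErr (Alg.proj (roundDir K P p n i k ω)
        (Alg.batchIn ω (p ω) i (n + 3 * P.batch K) (P.batch K))) (roundThr K P p n i k a ω) ≤ c) :
    let S := Alg.batchIn ω (p ω) i (n + (P.grid + 5) * P.batch K) (P.batch K)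
    Alg.sideErr S (roundDir K P p n i k ω) (roundThr K P p n i k a ω)
      (Alg.chosenSide K P S (roundDir K P p n i k ω) (roundThr K P p n i k a ω)
        (P.ε / 4 * k)) ≤ c + P.ε := by
  intro S
  have hmass := hg.le_sideMass_chosenSide h hi hk ha hM hadm
  obtain ⟨hpos, hΘ2, hpA, hW⟩ := hg.candidate h hi hk ha hM hadm
  have hclose := fun t => hg.sideErr_close h hi hk ha hM (t := t)
  set m := P.batch K with hm
  set M := D.real (region (p ω) i) with hMdef
  set w := roundDir K P p n i k ω with hw
  set τ := roundThr K P p n i k a ω with hτ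
  set lam := P.ε / 4 * k with hlam
  set Θ := P.ε * P.slack / (P.L * lam) with hΘ
  have hmpos : (0 : ℝ) < m := h.batch_pos'
  have hy := h.scale_pos
  have hM0 : 0 < M := lt_of_lt_of_le (pow_pos hy _) hM
  have hε := h.ε_pos
  have hy2 : 0 < P.scale ^ 2 := by positivity
  have hΘ0 : 0 < Θ := by linarith
  set qt := D.real (sideRegion (p ω) i w τ true) with hqt
  set qf := D.real (sideRegion (p ω) i w τ false) with hqf
  set et := D.real (sideAtom (p ω) i w τ true false) with het
  set ef := D.real (sideAtom (p ω) i w τ false true) with hef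
  have hW' : et + ef ≤ (c + P.ε / 4) * (qt + qf) :=
    hW.trans (by gcongr)
  have hpA0 : 0 < qt + qf := lt_of_lt_of_le (by positivity) hpA
  have het0 : 0 ≤ et := measureReal_nonneg
  have hef0 : 0 ≤ ef := measureReal_nonneg
  simp only at hmass
  by_cases hcase : P.ε ^ 2 * P.slack ≤ K.cMass * P.L * lam *
      min (Alg.sideMass S w τ true) (Alg.sideMass S w τ false)
  · -- both sides are heavy, and the better one is at most as bad as the whole annulus
    have hmin := h.le_of_massTest hΘ2 ((h.massTest_iff hpos _).1 hcase)
    obtain ⟨h1, h2⟩ := hclose true (hmin.trans (min_le_left _ _))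
    obtain ⟨h3, h4⟩ := hclose false (hmin.trans (min_le_right _ _))
    simp only [Bool.not_true, Bool.not_false] at h2 h4
    have hqt0 : 0 < qt := lt_of_lt_of_le (by positivity) h1
    have hqf0 : 0 < qf := lt_of_lt_of_le (by positivity) h3
    have h5 := (abs_le.1 h2).2
    have h6 := (abs_le.1 h4).2
    have hle : ∀ x, x ≤ Alg.sideErr S w τ true → x ≤ Alg.sideErr S w τ false →
        x ≤ c + P.ε := by
      intro x hx1 hx2
      have g1 : (x - P.ε / 8) * qt ≤ et := by
        rw [← le_div_iff₀ hqt0]; linarith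
      have g2 : (x - P.ε / 8) * qf ≤ ef := by
        rw [← le_div_iff₀ hqf0]; linarith
      have g3 : (x - P.ε / 8) * (qt + qf) ≤ (c + P.ε / 4) * (qt + qf) := by linarith
      have := le_of_mul_le_mul_right g3 hpA0
      linarith
    unfold Alg.chosenSide
    rw [if_pos hcase]
    by_cases hd : Alg.sideErr S w τ true ≤ Alg.sideErr S w τ false
    · rw [decide_eq_true hd]; exact hle _ le_rfl hd
    · rw [decide_eq_false hd]; exact hle _ (not_le.1 hd).le le_rfl
  · -- the smaller side is a negligible part of the annulus
    have hmin : 40 * min (Alg.sideMass S w τ true) (Alg.sideMass S w τ false) < P.ε * Θ :=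
      not_le.1 fun hc => hcase ((h.massTest_iff hpos _).2 hc)
    have hsmall : ∀ t, 40 * Alg.sideMass S w τ t < P.ε * Θ →
        D.real (sideRegion (p ω) i w τ t) ≤ 24 / 100 * P.ε * (qt + qf) := by
      intro t ht
      have hA : Accurate D ω (n + (P.grid + 5) * m) m (2 * P.acc) (sideRegion (p ω) i w τ t) :=
        Accurate.sideRegion fun b => hg.sides i hi k hk a ha t b
      have hR := (abs_le.1 (Accurate.region
        (fun b => hg.atoms i hi (P.grid + 5) (by omega) b)))
      have a2 : P.acc ≤ M * (1 / 100) ^ 4 := by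
        simpa using h.acc_le_scale_pow_mul hM (k := 0) (by norm_num)
      have a3 : m * P.acc ≤ m * (M * (1 / 100) ^ 4) := by gcongr
      have hmM : 0 < m * M := by positivity
      have hR0 : 0 < hits ω (n + (P.grid + 5) * m) m (region (p ω) i) := by linarith [hR.1]
      rw [sideMass_batchIn, ← mul_div_assoc, div_lt_iff₀ hR0] at ht
      have hΘy : P.scale ^ 3 ≤ P.ε * Θ := by
        have h1 := h.scale_le_ε
        have h2 : P.scale ^ 2 ≤ Θ := by linarith
        calc P.scale ^ 3 = P.scale * P.scale ^ 2 := by ring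
          _ ≤ P.ε * Θ := by gcongr
      have a4 : P.acc ≤ P.ε * Θ * M * (1 / 100) ^ 4 :=
        (h.acc_le_scale_pow_mul hM (k := 3) (by norm_num)).trans (by gcongr)
      have a5 : m * P.acc ≤ m * (P.ε * Θ * M * (1 / 100) ^ 4) := by gcongr
      have a6 : P.ε * Θ * hits ω (n + (P.grid + 5) * m) m (region (p ω) i) ≤
          P.ε * Θ * (m * M * (1001 / 1000)) := by
        gcongr
        linarith [hR.2]
      have a7 := (abs_le.1 hA).1
      have a8 : 0 < P.ε * Θ * (m * M) := by positivity
      have a9 : m * D.real (sideRegion (p ω) i w τ t) ≤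
          m * (P.ε * Θ * M * (1001 / 40000 + 2 / 10 ^ 8)) := by linarith
      have a10 := le_of_mul_le_mul_left a9 hmpos
      have a11 := mul_le_mul_of_nonneg_left hpA hε.le
      have a12 : 0 < P.ε * Θ * M := by positivity
      linarith
    have hlarge : ∀ t, P.scale ^ 4 ≤ Alg.sideMass S w τ t →
        (D.real (sideAtom (p ω) i w τ t (!t)) ≤ et + ef) →
        (1 - 24 / 100 * P.ε) * (qt + qf) ≤ D.real (sideRegion (p ω) i w τ t) →
        Alg.sideErr S w τ t ≤ c + P.ε := by
      intro t ht h1 h2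
      obtain ⟨h3, h4⟩ := hclose t ht
      have h5 := (abs_le.1 h4).2
      have h6 : 0 < D.real (sideRegion (p ω) i w τ t) := lt_of_lt_of_le (by positivity) h3
      have h7 : D.real (sideAtom (p ω) i w τ t (!t)) / D.real (sideRegion (p ω) i w τ t) ≤
          c + P.ε / 2 := by
        rw [div_le_iff₀ h6]
        refine h1.trans (hW'.trans ?_)
        have g1 := mul_le_mul_of_nonneg_left h2 (by linarith : 0 ≤ c + P.ε / 2)
        refine le_trans ?_ g1
        have g2 : c + P.ε / 4 ≤ (c + P.ε / 2) * (1 - 24 / 100 * P.ε) := by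
          have := h.ε_le
          have g3 : c * P.ε ≤ 1 / 2 * P.ε := by gcongr
          have g4 : P.ε * P.ε ≤ 1 / 100 * P.ε := by gcongr
          nlinarith
        calc (c + P.ε / 4) * (qt + qf) ≤ (c + P.ε / 2) * (1 - 24 / 100 * P.ε) * (qt + qf) := by
              gcongr
          _ = _ := by ring
      linarith
    have hch : Alg.chosenSide K P S w τ lam =
        decide (Alg.sideMass S w τ false ≤ Alg.sideMass S w τ true) := by
      unfold Alg.chosenSide
      rw [if_neg hcase]
    rw [hch] at hmass ⊢
    by_cases hd : Alg.sideMass S w τ false ≤ Alg.sideMass S w τ true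
    · rw [decide_eq_true hd] at hmass ⊢
      rw [min_eq_right hd] at hmin
      refine hlarge true hmass (le_add_of_nonneg_right hef0) ?_
      have := hsmall false hmin
      linarith
    · rw [decide_eq_false hd] at hmass ⊢
      rw [min_eq_left (not_le.1 hd).le] at hmin
      refine hlarge false hmass (le_add_of_nonneg_left het0) ?_
      have := hsmall true hmin
      linarith

end Split

/-! ### The outcome of the splitting step -/

section Split

variable {K : Constants} {P : Params} {D : Measure (Example d)} [IsProbabilityMeasure D]
  {u : Pt d} {I : ℕ} {p : (ℕ → Example d) → List (Step d)} {n : ℕ} {ω : ℕ → Example d}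
  {i : ℕ}

/-- The estimated error of a region is close to its true error, whichever label it is read off from. -/
theorem RoundGood.err_close (h : Regime K P) (hg : RoundGood K P D u I P.acc p n ω) (hi : i < I)
    (hM : P.scale ^ 17 ≤ D.real (region (p ω) i)) {s : Bool} {e : ℝ}
    (he : e = Alg.errFrac s ((Alg.batchIn ω (p ω) i (n + 2 * P.batch K) (P.batch K)).map
        fun z => z.2) ∨
      e = 1 - Alg.errFrac (!s) ((Alg.batchIn ω (p ω) i (n + 2 * P.batch K) (P.batch K)).map
        fun z => z.2)) :
    |e - D.real (atom (p ω) i (!s)) / D.real (region (p ω) i)| ≤ P.ε / 8 := by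
  set m := P.batch K with hm
  set M := D.real (region (p ω) i) with hMdef
  have hmpos : (0 : ℝ) < m := h.batch_pos'
  have hM0 : 0 < M := lt_of_lt_of_le (pow_pos h.scale_pos _) hM
  have hat : ∀ b, Accurate D ω (n + 2 * m) m P.acc (atom (p ω) i b) :=
    fun b => hg.atoms i hi 2 (by omega) b
  have hR : Accurate D ω (n + 2 * m) m (2 * P.acc) (region (p ω) i) := Accurate.region hat
  have a1 : P.acc ≤ P.ε * (M * (1 / 100) ^ 4) := (h.acc_le_scale_pow_mul hM (k := 1)
    (by norm_num)).trans (by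
      rw [pow_one, mul_assoc]
      exact mul_le_mul_of_nonneg_right h.scale_le_ε (by positivity))
  have a2 : m * P.acc ≤ m * (P.ε * (M * (1 / 100) ^ 4)) := by gcongr
  have hmM : 0 < m * M := by positivity
  have a3 : P.ε * (m * M) ≤ 1 / 100 * (m * M) := by gcongr; exact h.ε_le
  have a5 : 0 < P.ε * (m * M) := mul_pos h.ε_pos hmM
  have hNlow : m * M * (999 / 1000) ≤ hits ω (n + 2 * m) m (region (p ω) i) := by
    have := (abs_le.1 hR).1
    linarith
  have hN0 : 0 < hits ω (n + 2 * m) m (region (p ω) i) := lt_of_lt_of_le (by positivity) hNlow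
  have he' : e = hits ω (n + 2 * m) m (atom (p ω) i (!s)) /
      hits ω (n + 2 * m) m (region (p ω) i) := by
    rcases he with he | he
    · rw [he, errFrac_batchIn]
    · rw [he, errFrac_batchIn, Bool.not_not, hits_region ω _ _ (p ω) i s, eq_div_iff, sub_mul,
        div_mul_cancel₀]
      · ring
      all_goals rw [← hits_region ω _ _ (p ω) i s]; exact hN0.ne'
  rw [he', ← mul_div_mul_left (D.real (atom (p ω) i (!s))) M hmpos.ne']
  refine abs_div_sub_div_le ((hat _).trans ?_) hR (mul_nonneg hmpos.le measureReal_nonneg)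
    (mul_le_mul_of_nonneg_left ?_ hmpos.le) hmM hN0 ?_
  · have := mul_nonneg hmpos.le h.acc_pos.le
    linarith
  · rw [hMdef, real_region D (p ω) i s]
    linarith [measureReal_nonneg (μ := D) (s := atom (p ω) i s)]
  · have := mul_le_mul_of_nonneg_left hNlow (by linarith [h.ε_pos] : 0 ≤ P.ε / 8)
    linarith

theorem IsLink.optErr_nonneg {σ : ℝ → ℝ} {L : ℝ≥0} (hσ : IsLink L σ) {ζ : ℝ} (hζ : 0 ≤ ζ)
    (w : Pt d) (z : Example d) : 0 ≤ optErr σ ζ w z := by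
  have := (abs_le.1 (hσ.bound |inner ℝ w z.1|)).2
  unfold optErr
  linarith

/-- On a region where the allowed error is below `1 / 2`, the margin of the true direction is
large, as the link is Lipschitz. -/
theorem IsMisspecifiedGLM.le_mul_integral_abs_inner {σ : ℝ → ℝ} {L : ℝ≥0} (hσ : IsLink L σ)
    {ζ : ℝ} (hu : ‖u‖ ≤ 1) (hmod : IsMisspecifiedGLM ζ σ u D) (R : Set (Example d)) :
    (1 + 2 * ζ) * D.real R - 2 * ∫ z in R, optErr σ ζ u z ∂D ≤
      L * ∫ z in R, |inner ℝ u z.1| ∂D := by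
  have i1 := (hmod.integrable_abs_inner hu).integrableOn (s := R)
  have i2 := (hσ.integrable_optErr (ζ := ζ) (D := D) u).integrableOn (s := R)
  have h1 : ∫ z in R, ((1 + 2 * ζ) - 2 * optErr σ ζ u z) ∂D ≤
      ∫ z in R, L * |inner ℝ u z.1| ∂D := by
    refine integral_mono ((integrable_const _).sub (i2.const_mul 2)) (i1.const_mul _) fun z => ?_
    have := hσ.abs_sub_le |inner ℝ u z.1| (abs_nonneg _)
    simp only [optErr]
    linarith
  rw [integral_sub (integrable_const _) (i2.const_mul 2), integral_const_mul, integral_const_mul,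
    setIntegral_const, smul_eq_mul, mul_comm (D.real R)] at h1
  exact h1

/-- A region is frozen only if its label is nearly optimal on it.  Otherwise the true direction
would have a small leaky loss for a suitable leakage parameter, SGD would find a direction with a
small loss, some annulus would pass the tests, and one of its sides would be split off. -/
theorem RoundGood.freeze_le {σ : ℝ → ℝ} (h : Regime K P) (hg : RoundGood K P D u I P.acc p n ω)
    (hσ : IsLink P.L σ) (hu : ‖u‖ ≤ 1) (hmod : IsMisspecifiedGLM P.ζ σ u D)
    (hω : ∀ j, ‖(ω j).1‖ ≤ 1) (hi : i < I) (hM : P.scale ^ 17 ≤ D.real (region (p ω) i))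
    {s : Bool} {e : ℝ} (he1 : e ≤ 1 / 2)
    (he : e = Alg.errFrac s ((Alg.batchIn ω (p ω) i (n + 2 * P.batch K) (P.batch K)).map
        fun z => z.2) ∨
      e = 1 - Alg.errFrac (!s) ((Alg.batchIn ω (p ω) i (n + 2 * P.batch K) (P.batch K)).map
        fun z => z.2)) {n₁ : ℕ}
    (hout : Alg.SplitOutcome K P ω (p ω) i (n + 2 * P.batch K) e none n₁) :
    D.real (atom (p ω) i (!s)) ≤
      ∫ z in region (p ω) i, optErr σ P.ζ u z ∂D + 5 * P.ε * D.real (region (p ω) i) := by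
  by_contra hcon
  rw [not_le] at hcon
  have hec := abs_le.1 (hg.err_close h hi hM he)
  have hLU := hmod.le_mul_integral_abs_inner hσ hu (region (p ω) i)
  set M := D.real (region (p ω) i) with hMdef
  set X := ∫ z in region (p ω) i, optErr σ P.ζ u z ∂D with hX
  set U := ∫ z in region (p ω) i, |inner ℝ u z.1| ∂D with hU
  set A := D.real (atom (p ω) i (!s)) with hA
  have hM0 : 0 < M := lt_of_lt_of_le (pow_pos h.scale_pos _) hM
  have hε := h.ε_pos
  have hεle := h.ε_le
  have hX0 : 0 ≤ X := integral_nonneg fun z => hσ.optErr_nonneg h.ζ_nonneg u z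
  have hU0 : 0 ≤ U := integral_nonneg fun z => abs_nonneg _
  -- as `e ≤ 1 / 2`, the allowed error is well below `1 / 2`, and hence the average margin on the
  -- region is at least `ζ' / L`
  have hAM : A ≤ (1 / 2 + P.ε / 8) * M := by
    rw [← div_le_iff₀ hM0]; linarith
  have hXM : X ≤ (1 / 2 - 4 * P.ε) * M := by
    have : 0 < P.ε * M := mul_pos hε hM0
    linarith
  have hLU' : P.slack * M ≤ P.L * U := by
    have : 0 < P.ε * M := mul_pos hε hM0
    unfold Params.slack
    linarith
  have hL : 0 < (P.L : ℝ) := by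
    refine lt_of_le_of_ne P.L.coe_nonneg fun h0 => ?_
    rw [← h0, zero_mul] at hLU'
    exact absurd hLU' (not_le.2 (mul_pos h.slack_pos hM0))
  set opt := X / M with hopt
  have hoptM : X = opt * M := by rw [hopt]; field_simp
  have hopt0 : 0 ≤ opt := by positivity
  have hopt1 : opt ≤ 1 / 2 - 4 * P.ε := by rw [hopt, div_le_iff₀ hM0]; exact hXM
  -- the grid point slightly above the allowed error
  set k := ⌈(opt + 2 * P.ε) / (P.ε / 4)⌉₊ with hk
  have hk1 : opt + 2 * P.ε ≤ P.ε / 4 * k := by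
    have := Nat.le_ceil ((opt + 2 * P.ε) / (P.ε / 4))
    rw [← hk, div_le_iff₀ (by positivity)] at this
    linarith
  have hk2 : P.ε / 4 * k ≤ opt + 9 / 4 * P.ε := by
    have := (Nat.ceil_lt_add_one (show 0 ≤ (opt + 2 * P.ε) / (P.ε / 4) by positivity)).le
    rw [← hk] at this
    have h2 := mul_le_mul_of_nonneg_left this (by positivity : 0 ≤ P.ε / 4)
    have h3 : P.ε / 4 * ((opt + 2 * P.ε) / (P.ε / 4)) = opt + 2 * P.ε := by field_simp
    linarith
  have hkg : k < P.grid + 1 := by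
    refine Nat.lt_succ_of_le (Nat.le_floor ?_)
    rw [le_div_iff₀ hε]
    linarith
  set lam := P.ε / 4 * k with hlam
  set Δ := P.ε * P.slack / P.L with hΔ
  have hΔy : P.scale ^ 2 ≤ Δ := h.scale_sq_le hL
  have hF : regionLoss D (p ω) i lam u ≤ -(2 * Δ * M) := by
    have h1 := hmod.integral_leaky_le hσ hu (R := {x | regionOf (p ω) x = i})
      ((measurable_regionOf (p ω)) (measurableSet_singleton i)) hM0 lam
    have h2 : M * regionLoss D (p ω) i lam u ≤
        (∫ z in region (p ω) i, (optErr σ P.ζ u z - lam) ∂D) * U := h1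
    have h3 : ∫ z in region (p ω) i, (optErr σ P.ζ u z - lam) ∂D = X - lam * M := by
      rw [integral_sub (hσ.integrable_optErr u).integrableOn (integrable_const _),
        setIntegral_const, smul_eq_mul, mul_comm]
    rw [h3, hoptM] at h2
    have h4 : opt * M - lam * M ≤ -(2 * P.ε * M) := by
      have := mul_le_mul_of_nonneg_right hk1 hM0.le
      linarith
    have h5 := mul_le_mul_of_nonneg_right h4 hU0
    have h6 : P.ε * (P.slack * M) ≤ P.ε * (P.L * U) := by gcongr
    have h7 : Δ * M ≤ P.ε * U := by
      rw [hΔ, div_mul_eq_mul_div, div_le_iff₀ hL]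
      linarith
    have h8 := mul_le_mul_of_nonneg_left h7 hM0.le
    refine le_of_mul_le_mul_left ?_ hM0
    linarith
  -- SGD finds a direction with a comparable loss, which yields an admissible annulus
  have hw := hg.regionLoss_roundDir_le h hmod.support hω hu hi hkg (Δ := Δ)
    (by
      have := h.acc_le_scale_pow_mul hM (k := 0) (by norm_num)
      rw [pow_zero, one_mul] at this
      linarith)
    (by
      have h1 := h.acc_le_scale_pow_mul hM (k := 19) (by norm_num)
      have h2 : P.scale ^ 19 * M ≤ Δ * M ^ 2 := by
        rw [show 19 = 2 + 17 from rfl, pow_add, sq M, ← mul_assoc]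
        have := h.scale_pos
        have : 0 ≤ Δ := (sq_nonneg _).trans hΔy
        gcongr
      have h3 : 0 < P.scale ^ 19 * M := mul_pos (pow_pos h.scale_pos _) hM0
      linarith) hF
  obtain ⟨τ, hτ, hadm, herr⟩ := hg.exists_admissible h hω hi hkg hL hM hw
  -- the candidate that was chosen is at least as good, so one of its sides should have been split off
  rcases hout with ⟨-, -, hnone⟩ | ⟨k₀, hk₀, c, ⟨τ₀, hτ₀, hadm₀, hc⟩, hbest, -, hcase⟩
  · rw [scanList_eq] at hnone
    exact hnone k hkg τ hτ hadm
  · rw [scanList_eq] at hτ₀ hadm₀ hc hbest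
    rw [sideList_eq] at hcase
    obtain ⟨a, ha, hτa⟩ := exists_of_mem_absProj hτ₀
    have hcerr := (hbest k hkg τ hτ hadm).trans herr
    have hτ' : τ₀ = roundThr K P p n i k₀ a ω := hτa
    subst hτ'
    subst hc
    have key := hg.sideErr_chosenSide_le h hi hk₀ ha hM hadm₀ (c := lam)
      (Params.lam_nonneg hε k) (Params.lam_le_half hε hkg) hcerr
    rcases hcase with ⟨-, h2⟩ | ⟨h2, -⟩
    · simp at h2
    · refine h2 (le_trans key ?_)
      have h3 : opt + 5 * P.ε < A / M := by
        rw [lt_div_iff₀ hM0]; linarith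
      linarith

/-- The part that is split off has a much smaller error than the region, for the label with which
it is split off. -/
theorem RoundGood.split_le (h : Regime K P) (hg : RoundGood K P D u I P.acc p n ω)
    (hi : i < I) (hM : P.scale ^ 17 ≤ D.real (region (p ω) i))
    {s : Bool} {e : ℝ} (he1 : e ≤ 1 / 2)
    (he : e = Alg.errFrac s ((Alg.batchIn ω (p ω) i (n + 2 * P.batch K) (P.batch K)).map
        fun z => z.2) ∨
      e = 1 - Alg.errFrac (!s) ((Alg.batchIn ω (p ω) i (n + 2 * P.batch K) (P.batch K)).map
        fun z => z.2)) {w : Pt d} {τ : ℝ} {t : Bool} {n₁ : ℕ}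
    (hout : Alg.SplitOutcome K P ω (p ω) i (n + 2 * P.batch K) e (some (w, τ, t)) n₁) :
    ∃ k < P.grid + 1, ∃ a < P.batch K, w = roundDir K P p n i k ω ∧ τ = roundThr K P p n i k a ω ∧
      n₁ = n + (P.grid + 6) * P.batch K ∧
      98 / 100 * P.scale ^ 4 * D.real (region (p ω) i) ≤ D.real (sideRegion (p ω) i w τ t) ∧
      D.real (sideAtom (p ω) i w τ t (!t)) / D.real (sideRegion (p ω) i w τ t) ≤
        D.real (atom (p ω) i (!t)) / D.real (region (p ω) i) - P.ε / 2 := by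
  have hec := abs_le.1 (hg.err_close h hi hM he)
  have hM0 : 0 < D.real (region (p ω) i) := lt_of_lt_of_le (pow_pos h.scale_pos _) hM
  have hε := h.ε_pos
  rcases hout with ⟨hnone, -⟩ | ⟨k, hk, c, ⟨τ₀, hτ₀, hadm, hc⟩, -, hn, hcase⟩
  · simp at hnone
  rw [scanList_eq] at hτ₀ hadm hc
  rw [sideList_eq] at hcase
  obtain ⟨a, ha, hτa⟩ := exists_of_mem_absProj hτ₀
  have hτ' : τ₀ = roundThr K P p n i k a ω := hτa
  subst hτ'
  subst hc
  have hmass := hg.le_sideMass_chosenSide h hi hk ha hM hadm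
  rcases hcase with ⟨h1, h2⟩ | ⟨-, h2⟩
  swap
  · simp at h2
  simp only [Option.some.injEq, Prod.mk.injEq] at h2
  obtain ⟨hw, hτ, ht⟩ := h2
  simp only at h1 hmass
  have ht' := ht
  have hw' : w = roundDir K P p n i k ω := hw
  subst hw'
  subst hτ
  refine ⟨k, hk, a, ha, rfl, rfl, by rw [hn]; ring, ?_⟩
  have hmass' : P.scale ^ 4 ≤ Alg.sideMass (Alg.batchIn ω (p ω) i
      (n + (P.grid + 5) * P.batch K) (P.batch K)) (roundDir K P p n i k ω)
      (roundThr K P p n i k a ω) t := by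
    rw [ht]; exact hmass
  have h1' : Alg.sideErr (Alg.batchIn ω (p ω) i
      (n + (P.grid + 5) * P.batch K) (P.batch K)) (roundDir K P p n i k ω)
      (roundThr K P p n i k a ω) t ≤ e - P.ε := by
    rw [ht]; exact h1
  obtain ⟨h3, h4⟩ := hg.sideErr_close h hi hk ha hM hmass'
  refine ⟨h3, ?_⟩
  have h5 := (abs_le.1 h4).1
  have h6 : e - P.ε / 8 ≤ D.real (atom (p ω) i (!t)) / D.real (region (p ω) i) := by
    have hsum : D.real (atom (p ω) i s) / D.real (region (p ω) i) +
        D.real (atom (p ω) i (!s)) / D.real (region (p ω) i) = 1 := by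
      rw [← add_div, ← real_region D (p ω) i s, div_self hM0.ne']
    by_cases hts : t = s
    · rw [hts]; linarith
    · have : t = !s := by cases t <;> cases s <;> simp_all
      rw [this, Bool.not_not]
      linarith
  linarith

end Split

/-! ### The potential -/

/-- The potential of a region with mass `a` of one label and mass `b` of the other: the mass times
the variance of the label. -/
noncomputable def labelVar (a b : ℝ) : ℝ := a * b / (a + b)

theorem labelVar_comm (a b : ℝ) : labelVar a b = labelVar b a := by
  rw [labelVar, labelVar, mul_comm, add_comm]

theorem labelVar_nonneg {a b : ℝ} (ha : 0 ≤ a) (hb : 0 ≤ b) : 0 ≤ labelVar a b :=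
  div_nonneg (mul_nonneg ha hb) (add_nonneg ha hb)

theorem labelVar_le {a b : ℝ} (ha : 0 ≤ a) (hb : 0 ≤ b) : labelVar a b ≤ (a + b) / 4 := by
  refine div_le_of_le_mul₀ (add_nonneg ha hb) (by positivity) ?_
  nlinarith [sq_nonneg (a - b)]

/-- The exact change of the potential when two regions are merged. -/
theorem labelVar_add {a₁ b₁ a₂ b₂ : ℝ} (h₁ : 0 < a₁ + b₁) (h₂ : 0 < a₂ + b₂) :
    labelVar (a₁ + a₂) (b₁ + b₂) = labelVar a₁ b₁ + labelVar a₂ b₂ +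
      (a₁ + b₁) * (a₂ + b₂) / (a₁ + b₁ + (a₂ + b₂)) *
        (b₁ / (a₁ + b₁) - b₂ / (a₂ + b₂)) ^ 2 := by
  have h₃ : 0 < a₁ + b₁ + (a₂ + b₂) := by linarith
  have h₄ : a₁ + a₂ + (b₁ + b₂) = a₁ + b₁ + (a₂ + b₂) := by ring
  unfold labelVar
  rw [h₄]
  have e1 := h₁.ne'
  have e2 := h₂.ne'
  have e3 := h₃.ne'
  field_simp
  ring

/-- Splitting a region lowers the potential. -/
theorem labelVar_add_le {a₁ b₁ a₂ b₂ : ℝ} (ha₂ : 0 ≤ a₂) (hb₂ : 0 ≤ b₂) (h₁ : 0 < a₁ + b₁) :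
    labelVar a₁ b₁ + labelVar a₂ b₂ + (a₁ + b₁) *
      (b₁ / (a₁ + b₁) - (b₁ + b₂) / (a₁ + b₁ + (a₂ + b₂))) ^ 2 ≤
      labelVar (a₁ + a₂) (b₁ + b₂) := by
  rcases (add_nonneg ha₂ hb₂).eq_or_lt with h₂ | h₂
  · have h3 : a₂ = 0 := by linarith
    have h4 : b₂ = 0 := by linarith
    subst h3 h4
    simp [labelVar]
  · have h₃ : 0 < a₁ + b₁ + (a₂ + b₂) := by linarith
    rw [labelVar_add h₁ h₂]
    set x := b₁ / (a₁ + b₁) - b₂ / (a₂ + b₂) with hx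
    set r := (a₂ + b₂) / (a₁ + b₁ + (a₂ + b₂)) with hr
    have e : b₁ / (a₁ + b₁) - (b₁ + b₂) / (a₁ + b₁ + (a₂ + b₂)) = r * x := by
      rw [hx, hr]
      have e1 := h₁.ne'
      have e2 := h₂.ne'
      have e3 := h₃.ne'
      field_simp
      ring
    have hr0 : 0 ≤ r := by positivity
    have hr1 : r ≤ 1 := by rw [hr, div_le_one h₃]; linarith
    rw [e, show (a₁ + b₁) * (a₂ + b₂) / (a₁ + b₁ + (a₂ + b₂)) * x ^ 2 =
      (a₁ + b₁) * (r * x ^ 2) by rw [hr]; ring, show (r * x) ^ 2 = r * (r * x ^ 2) by ring]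
    have : r * (r * x ^ 2) ≤ 1 * (r * x ^ 2) := by gcongr
    have := mul_le_mul_of_nonneg_left this h₁.le
    linarith

/-- Merging two regions with similar label frequencies, one of which may be tiny, raises the
potential only a little. -/
theorem labelVar_merge_le {a₁ b₁ a₂ b₂ c : ℝ} (ha₁ : 0 ≤ a₁) (hb₁ : 0 ≤ b₁) (ha₂ : 0 ≤ a₂)
    (hb₂ : 0 ≤ b₂) (hc : min (a₁ + b₁) (a₂ + b₂) *
      (b₁ / (a₁ + b₁) - b₂ / (a₂ + b₂)) ^ 2 ≤ c) :
    labelVar (a₁ + a₂) (b₁ + b₂) ≤ labelVar a₁ b₁ + labelVar a₂ b₂ + c := by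
  have hn₁ := add_nonneg ha₁ hb₁
  have hn₂ := add_nonneg ha₂ hb₂
  have hc0 : 0 ≤ c := le_trans (mul_nonneg (le_min hn₁ hn₂) (sq_nonneg _)) hc
  rcases hn₁.eq_or_lt with h₁ | h₁
  · have h3 : a₁ = 0 := by linarith
    have h4 : b₁ = 0 := by linarith
    subst h3 h4
    simpa [labelVar] using hc0
  rcases hn₂.eq_or_lt with h₂ | h₂
  · have h3 : a₂ = 0 := by linarith
    have h4 : b₂ = 0 := by linarith
    subst h3 h4
    simpa [labelVar] using hc0
  rw [labelVar_add h₁ h₂]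
  have h₃ : 0 < a₁ + b₁ + (a₂ + b₂) := by linarith
  have hle : (a₁ + b₁) * (a₂ + b₂) / (a₁ + b₁ + (a₂ + b₂)) ≤ min (a₁ + b₁) (a₂ + b₂) := by
    rw [div_le_iff₀ h₃]
    rcases min_choice (a₁ + b₁) (a₂ + b₂) with h | h <;> rw [h] <;> nlinarith
  have := mul_le_mul_of_nonneg_right hle (sq_nonneg (b₁ / (a₁ + b₁) - b₂ / (a₂ + b₂)))
  linarith

/-- The potential of a list of regions. -/
noncomputable def potential (D : Measure (Example d)) (p : List (Step d)) (l : List ℕ) : ℝ :=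
  (l.map fun i => labelVar (D.real (atom p i true)) (D.real (atom p i false))).sum

theorem potential_cons (D : Measure (Example d)) (p : List (Step d)) (i : ℕ) (l : List ℕ) :
    potential D p (i :: l) =
      labelVar (D.real (atom p i true)) (D.real (atom p i false)) + potential D p l := by
  simp [potential]

theorem labelVar_atom (D : Measure (Example d)) (p : List (Step d)) (i : ℕ) (s : Bool) :
    labelVar (D.real (atom p i true)) (D.real (atom p i false)) =
      labelVar (D.real (atom p i s)) (D.real (atom p i (!s))) := by
  cases s
  · exact labelVar_comm _ _
  · rfl

theorem potential_nonneg (D : Measure (Example d)) (p : List (Step d)) (l : List ℕ) :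
    0 ≤ potential D p l :=
  List.sum_nonneg fun x hx => by
    obtain ⟨i, -, rfl⟩ := List.mem_map.1 hx
    exact labelVar_nonneg measureReal_nonneg measureReal_nonneg

theorem potential_erase (D : Measure (Example d)) (p : List (Step d)) {i : ℕ} {l : List ℕ}
    (h : i ∈ l) : potential D p l =
      labelVar (D.real (atom p i true)) (D.real (atom p i false)) +
        potential D p (l.erase i) := by
  rw [← potential_cons]
  exact ((List.perm_cons_erase h).map _).sum_eq

theorem potential_congr (D : Measure (Example d)) {p p' : List (Step d)} {l : List ℕ}
    (h : ∀ i ∈ l, ∀ b, atom p i b = atom p' i b) : potential D p l = potential D p' l := by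
  unfold potential
  congr 1
  exact List.map_congr_left fun i hi => by rw [h i hi, h i hi]

/-! ### Cuts and merges -/

section Refine

variable {p : List (Step d)} {i j : ℕ} {w : Pt d} {τ : ℝ} {t : Bool}

theorem atom_cut_new (hj : ∀ x, regionOf p x ≠ j) (b : Bool) :
    atom (Step.cut i w τ t j :: p) j b = sideAtom p i w τ t b := by
  ext z
  simp only [atom, sideAtom, regionOf, Set.mem_ofPred_eq]
  split_ifs with h
  · simp [h.1, h.2]
  · simp only [hj, false_and, false_iff]
    tauto

theorem atom_cut_old (hij : j ≠ i) (b : Bool) :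
    atom (Step.cut i w τ t j :: p) i b ∪ sideAtom p i w τ t b = atom p i b ∧
      Disjoint (atom (Step.cut i w τ t j :: p) i b) (sideAtom p i w τ t b) := by
  constructor
  · ext z
    simp only [atom, sideAtom, regionOf, Set.mem_union, Set.mem_ofPred_eq]
    split_ifs with h
    · simp [h.1, h.2, hij]
    · constructor
      · rintro (h1 | h1)
        · exact h1
        · exact absurd ⟨h1.1, h1.2.1⟩ h
      · exact Or.inl
  · refine Set.disjoint_left.2 fun z h1 h2 => ?_
    simp only [atom, sideAtom, regionOf, Set.mem_ofPred_eq] at h1 h2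
    rw [if_pos ⟨h2.1, h2.2.1⟩] at h1
    exact hij h1.1

theorem atom_cut_other {i' : ℕ} (h1 : i' ≠ i) (h2 : i' ≠ j) (b : Bool) :
    atom (Step.cut i w τ t j :: p) i' b = atom p i' b := by
  ext z
  simp only [atom, regionOf, Set.mem_ofPred_eq]
  split_ifs with h
  · simp [h.1, h1.symm, h2.symm]
  · rfl

theorem liveSet_cut {l : List ℕ} (hi : i ∈ l) (hj : ∀ x, regionOf p x ≠ j) :
    liveSet (Step.cut i w τ t j :: p) (j :: l) = liveSet p l := by
  ext z
  simp only [liveSet, regionOf, Set.mem_ofPred_eq]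
  split_ifs with h
  · simp [h.1, hi]
  · simp [hj]

theorem atom_merge_left (hij : i ≠ j) (b : Bool) :
    atom (Step.merge i j :: p) i b = atom p i b ∪ atom p j b := by
  ext z
  simp only [atom, regionOf, Set.mem_union, Set.mem_ofPred_eq]
  split_ifs with h
  · simp [h, hij.symm]
  · simp [h]

theorem atom_merge_other {i' : ℕ} (h1 : i' ≠ i) (h2 : i' ≠ j) (b : Bool) :
    atom (Step.merge i j :: p) i' b = atom p i' b := by
  ext z
  simp only [atom, regionOf, Set.mem_ofPred_eq]
  split_ifs with h
  · simp [h, h1.symm, h2.symm]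
  · rfl

theorem liveSet_merge {l : List ℕ} (hl : l.Nodup) (hi : i ∈ l) (hj : j ∈ l) (hij : i ≠ j) :
    liveSet (Step.merge i j :: p) (l.erase j) = liveSet p l := by
  ext z
  simp only [liveSet, regionOf, Set.mem_ofPred_eq, hl.mem_erase_iff]
  split_ifs with h
  · simp [h, hi, hj, hij]
  · simp [h]

theorem liveSet_erase {l : List ℕ} (hi : i ∈ l) :
    liveSet p l = region p i ∪ liveSet p (l.erase i) := by
  rw [← liveSet_cons]
  ext z
  simp only [liveSet, Set.mem_ofPred_eq]
  exact (List.perm_cons_erase hi).mem_iff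

variable (D : Measure (Example d)) [IsProbabilityMeasure D]

theorem potential_cut_le {l : List ℕ} (hl : l.Nodup) (hi : i ∈ l) (hj : ∀ x, regionOf p x ≠ j)
    (hjl : j ∉ l) (hpos : 0 < D.real (sideRegion p i w τ t)) :
    potential D (Step.cut i w τ t j :: p) (j :: l) + D.real (sideRegion p i w τ t) *
      (D.real (sideAtom p i w τ t (!t)) / D.real (sideRegion p i w τ t) -
        D.real (atom p i (!t)) / D.real (region p i)) ^ 2 ≤ potential D p l := by
  have hij : j ≠ i := fun h => hjl (h ▸ hi)
  rw [potential_cons, potential_erase D _ hi, potential_erase D p hi,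
    potential_congr D (p := Step.cut i w τ t j :: p) (p' := p) (l := l.erase i) fun i' hi' b => by
      rw [hl.mem_erase_iff] at hi'
      exact atom_cut_other hi'.1 (fun h : i' = j => hjl (h ▸ hi'.2)) b,
    labelVar_atom D _ j t, labelVar_atom D _ i t, labelVar_atom D p i t, atom_cut_new hj,
    atom_cut_new hj]
  have hold : ∀ b, D.real (atom p i b) = D.real (sideAtom p i w τ t b) +
      D.real (atom (Step.cut i w τ t j :: p) i b) := fun b => by
    obtain ⟨h1, h2⟩ := atom_cut_old (p := p) (w := w) (τ := τ) (t := t) hij b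
    rw [← h1, measureReal_union h2 (measurableSet_sideAtom p i w τ t b), add_comm]
  rw [real_region D p i t, real_sideRegion D p i w τ t t, hold t, hold (!t)]
  rw [real_sideRegion D p i w τ t t] at hpos
  set a₁ := D.real (sideAtom p i w τ t t)
  set b₁ := D.real (sideAtom p i w τ t (!t))
  set a₂ := D.real (atom (Step.cut i w τ t j :: p) i t)
  set b₂ := D.real (atom (Step.cut i w τ t j :: p) i (!t))
  have := labelVar_add_le (a₁ := a₁) (b₁ := b₁) (a₂ := a₂) (b₂ := b₂) measureReal_nonneg
    measureReal_nonneg hpos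
  rw [show a₁ + a₂ + (b₁ + b₂) = a₁ + b₁ + (a₂ + b₂) by ring]
  linarith

theorem potential_merge_le {l : List ℕ} (hl : l.Nodup) (hi : i ∈ l) (hj : j ∈ l) (hij : i ≠ j)
    (s : Bool) {c : ℝ} (hc : min (D.real (region p i)) (D.real (region p j)) *
      (D.real (atom p i (!s)) / D.real (region p i) -
        D.real (atom p j (!s)) / D.real (region p j)) ^ 2 ≤ c) :
    potential D (Step.merge i j :: p) (l.erase j) ≤ potential D p l + c := by
  have hi' : i ∈ l.erase j := (hl.mem_erase_iff).2 ⟨hij, hi⟩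
  have hl' : (l.erase j).Nodup := hl.erase j
  rw [potential_erase D _ hi', potential_erase D p hj, potential_erase D p hi',
    potential_congr D (p := Step.merge i j :: p) (p' := p) (l := (l.erase j).erase i)
      fun i' hi'' b => by
        rw [hl'.mem_erase_iff, hl.mem_erase_iff] at hi''
        exact atom_merge_other hi''.1 hi''.2.1 b,
    labelVar_atom D _ i s, labelVar_atom D p i s, labelVar_atom D p j s]
  have hu : ∀ b, D.real (atom (Step.merge i j :: p) i b) =
      D.real (atom p i b) + D.real (atom p j b) := fun b => by
    rw [atom_merge_left hij, measureReal_union _ (measurableSet_atom p j b)]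
    exact Set.disjoint_left.2 fun z h1 h2 => hij (h1.1.symm.trans h2.1)
  rw [hu, hu]
  rw [real_region D p i s, real_region D p j s] at hc
  have := labelVar_merge_le (measureReal_nonneg (μ := D) (s := atom p i s))
    (measureReal_nonneg (μ := D) (s := atom p i (!s)))
    (measureReal_nonneg (μ := D) (s := atom p j s))
    (measureReal_nonneg (μ := D) (s := atom p j (!s))) hc
  linarith

end Refine

/-! ### The number of live regions -/

/-- Numbers in `[0, 1]` with a label such that those with the same label are more than `υ` apart:
there are at most `2 (⌊1 / υ⌋ + 1)` of them. -/
theorem length_le_of_separated {l : List ℕ} (hl : l.Nodup) {υ : ℝ} (hυ : 0 < υ) {e : ℕ → ℝ}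
    (he0 : ∀ i, 0 ≤ e i) (he1 : ∀ i, e i ≤ 1) {s : ℕ → Bool}
    (hsep : l.Pairwise fun i j => ¬ (s j = s i ∧ |e i - e j| ≤ υ)) :
    l.length ≤ 2 * (⌊1 / υ⌋₊ + 1) := by
  have hsymm : Std.Symm fun i j => ¬ (s j = s i ∧ |e i - e j| ≤ υ) :=
    ⟨fun i j h h' => h ⟨h'.1.symm, by rw [abs_sub_comm]; exact h'.2⟩⟩
  have hinj : Set.InjOn (fun i => (s i, ⌊e i / υ⌋₊)) (l.toFinset : Set ℕ) := by
    intro i hi j hj hij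
    by_contra hne
    simp only [List.coe_toFinset, Set.mem_ofPred_eq] at hi hj
    simp only [Prod.mk.injEq] at hij
    refine hsep.forall hi hj hne ⟨hij.1.symm, ?_⟩
    have h1 := Nat.floor_le (div_nonneg (he0 i) hυ.le)
    have h2 := Nat.lt_floor_add_one (e i / υ)
    have h3 := Nat.floor_le (div_nonneg (he0 j) hυ.le)
    have h4 := Nat.lt_floor_add_one (e j / υ)
    rw [hij.2] at h1 h2
    rw [le_div_iff₀ hυ] at h1 h3
    rw [div_lt_iff₀ hυ] at h2 h4
    rw [abs_le]
    constructor <;> linarith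
  have hcard := Finset.card_le_card_of_injOn (t := Finset.univ ×ˢ Finset.range (⌊1 / υ⌋₊ + 1)) _
    (fun i _ => by
      simp only [Finset.coe_product, Set.mem_prod, Finset.coe_univ, Set.mem_univ, true_and,
        Finset.coe_range, Set.mem_Iio]
      exact Nat.lt_succ_of_le (Nat.floor_le_floor (by gcongr; exact he1 i))) hinj
  rw [List.toFinset_card_of_nodup hl, Finset.card_product, Finset.card_univ, Fintype.card_bool,
    Finset.card_range] at hcard
  exact hcard

/-! ### The invariant of the main loop -/

/-- The examples in frozen regions that are misclassified. -/
def frozenErr (h : Alg.Hyp d) : Set (Example d) :=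
  {z | regionOf h.cls.steps z.1 ∉ h.live ∧ h.cls.label (regionOf h.cls.steps z.1) ≠ z.2}

/-- The part of the invariant that does not depend on the examples drawn: region names are fresh
when they are introduced, the classifier is nearly optimal on the frozen regions, and the
potential plus the mass of the live regions is at most `c`. -/
structure Sound (D : Measure (Example d)) (σ : ℝ → ℝ) (ζ ε : ℝ) (u : Pt d) (h : Alg.Hyp d)
    (c : ℝ) : Prop where
  region_lt : ∀ x, regionOf h.cls.steps x < h.next
  live_lt : ∀ i ∈ h.live, i < h.next
  nodup : h.live.Nodup
  frozen : D.real (frozenErr h) ≤ ∫ z in (liveSet h.cls.steps h.live)ᶜ, optErr σ ζ u z ∂D +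
    5 * ε * D.real (liveSet h.cls.steps h.live)ᶜ
  potential_le : potential D h.cls.steps h.live + D.real (liveSet h.cls.steps h.live) ≤ c

theorem measurableSet_liveSet (p : List (Step d)) (l : List ℕ) : MeasurableSet (liveSet p l) :=
  ((measurable_regionOf p).comp measurable_fst) (MeasurableSet.of_discrete (s := {i | i ∈ l}))

namespace Sound

variable {D : Measure (Example d)} {σ : ℝ → ℝ} {ζ ε : ℝ} {u : Pt d}
  {h : Alg.Hyp d} {c : ℝ} {L : ℝ≥0}

theorem mono (hs : Sound D σ ζ ε u h c) {c' : ℝ} (hc : c ≤ c') : Sound D σ ζ ε u h c' :=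
  { hs with potential_le := hs.potential_le.trans hc }

variable [IsProbabilityMeasure D]

theorem freeze (hs : Sound D σ ζ ε u h c) (hσ : IsLink L σ) {i : ℕ} (hi : i ∈ h.live) (s : Bool)
    (herr : D.real (atom h.cls.steps i (!s)) ≤ ∫ z in region h.cls.steps i, optErr σ ζ u z ∂D +
      5 * ε * D.real (region h.cls.steps i)) :
    Sound D σ ζ ε u (h.freeze i s) (c - D.real (region h.cls.steps i)) := by
  have hnot : i ∉ h.live.erase i := fun hm => ((hs.nodup.mem_erase_iff).1 hm).1 rfl
  have hset : liveSet h.cls.steps h.live =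
      region h.cls.steps i ∪ liveSet h.cls.steps (h.live.erase i) := liveSet_erase hi
  have hdisj : Disjoint (region h.cls.steps i) (liveSet h.cls.steps (h.live.erase i)) :=
    disjoint_region_liveSet _ hnot
  have hmass : D.real (liveSet h.cls.steps h.live) = D.real (region h.cls.steps i) +
      D.real (liveSet h.cls.steps (h.live.erase i)) := by
    rw [hset, measureReal_union hdisj (measurableSet_liveSet _ _)]
  refine ⟨hs.region_lt, fun j hj => hs.live_lt j (List.mem_of_mem_erase hj), hs.nodup.erase i,
    ?_, ?_⟩
  · have hcompl : (liveSet h.cls.steps (h.live.erase i))ᶜ =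
        (liveSet h.cls.steps h.live)ᶜ ∪ region h.cls.steps i := by
      rw [hset]
      ext z
      have : z ∈ region h.cls.steps i → z ∉ liveSet h.cls.steps (h.live.erase i) :=
        fun hz => Set.disjoint_left.1 hdisj hz
      simp only [Set.mem_compl_iff, Set.mem_union]
      tauto
    have hdisj2 : Disjoint (liveSet h.cls.steps h.live)ᶜ (region h.cls.steps i) := by
      rw [Set.disjoint_left]
      intro z hz hzi
      exact hz (hset ▸ Or.inl hzi)
    have hfr : frozenErr (h.freeze i s) ⊆ frozenErr h ∪ atom h.cls.steps i (!s) := by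
      rintro z ⟨h1, h2⟩
      simp only [Alg.Hyp.freeze] at h1 h2
      by_cases hz : regionOf h.cls.steps z.1 = i
      · right
        rw [hz, Function.update_self] at h2
        refine ⟨hz, ?_⟩
        revert h2
        cases z.2 <;> cases s <;> simp
      · left
        rw [Function.update_of_ne hz] at h2
        exact ⟨fun hm => h1 ((List.mem_erase_of_ne hz).2 hm), h2⟩
    change D.real (frozenErr (h.freeze i s)) ≤
      ∫ z in (liveSet h.cls.steps (h.live.erase i))ᶜ, optErr σ ζ u z ∂D +
        5 * ε * D.real (liveSet h.cls.steps (h.live.erase i))ᶜ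
    rw [hcompl, setIntegral_union hdisj2 (measurableSet_region _ _)
      (hσ.integrable_optErr u).integrableOn (hσ.integrable_optErr u).integrableOn,
      measureReal_union hdisj2 (measurableSet_region _ _)]
    have h1 := (measureReal_mono hfr).trans (measureReal_union_le (μ := D) (frozenErr h)
      (atom h.cls.steps i (!s)))
    have h2 := hs.frozen
    linarith
  · change potential D h.cls.steps (h.live.erase i) +
      D.real (liveSet h.cls.steps (h.live.erase i)) ≤ _
    have h1 := hs.potential_le
    rw [potential_erase D _ hi, hmass] at h1
    have h2 := labelVar_nonneg (measureReal_nonneg (μ := D) (s := atom h.cls.steps i true))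
      (measureReal_nonneg (μ := D) (s := atom h.cls.steps i false))
    linarith

theorem splitOff (hs : Sound D σ ζ ε u h c) {i : ℕ} (hi : i ∈ h.live) (s : Bool) {w : Pt d}
    {τ : ℝ} {t : Bool} (hpos : 0 < D.real (sideRegion h.cls.steps i w τ t)) :
    Sound D σ ζ ε u (h.splitOff i s w τ t) (c - D.real (sideRegion h.cls.steps i w τ t) *
      (D.real (sideAtom h.cls.steps i w τ t (!t)) / D.real (sideRegion h.cls.steps i w τ t) -
        D.real (atom h.cls.steps i (!t)) / D.real (region h.cls.steps i)) ^ 2) := by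
  have hnew : ∀ x, regionOf h.cls.steps x ≠ h.next := fun x => (hs.region_lt x).ne
  have hnl : h.next ∉ h.live := fun hm => lt_irrefl _ (hs.live_lt _ hm)
  have hset : liveSet (h.splitOff i s w τ t).cls.steps (h.splitOff i s w τ t).live =
      liveSet h.cls.steps h.live := liveSet_cut hi hnew
  refine ⟨fun x => ?_, fun j hj => ?_, List.nodup_cons.2 ⟨hnl, hs.nodup⟩, ?_, ?_⟩
  · simp only [Alg.Hyp.splitOff, regionOf]
    split_ifs
    · exact Nat.lt_succ_self _
    · exact (hs.region_lt x).trans (Nat.lt_succ_self _)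
  · rcases List.mem_cons.1 hj with rfl | hj
    · exact Nat.lt_succ_self _
    · exact (hs.live_lt j hj).trans (Nat.lt_succ_self _)
  · have hfr : frozenErr (h.splitOff i s w τ t) ⊆ frozenErr h := by
      rintro z ⟨h1, h2⟩
      have hz : regionOf h.cls.steps z.1 ∉ h.live := by
        intro hm
        have : z ∈ liveSet (h.splitOff i s w τ t).cls.steps (h.splitOff i s w τ t).live := by
          rw [hset]; exact hm
        exact h1 this
      have hne : regionOf h.cls.steps z.1 ≠ i := fun he => hz (he ▸ hi)
      refine ⟨hz, ?_⟩
      simp only [Alg.Hyp.splitOff, regionOf] at h2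
      rwa [if_neg (fun hc => hne hc.1), Function.update_of_ne (hnew _),
        Function.update_of_ne hne] at h2
    rw [hset]
    exact (measureReal_mono hfr).trans hs.frozen
  · rw [hset]
    have h1 := potential_cut_le D hs.nodup hi hnew hnl hpos
    have h2 := hs.potential_le
    change potential D (Step.cut i w τ t h.next :: h.cls.steps) (h.next :: h.live) + _ ≤ _
    linarith

theorem merge (hs : Sound D σ ζ ε u h c) {i j : ℕ} (hi : i ∈ h.live) (hj : j ∈ h.live)
    (hij : i ≠ j) (s : Bool) {c' : ℝ}
    (hc : min (D.real (region h.cls.steps i)) (D.real (region h.cls.steps j)) *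
      (D.real (atom h.cls.steps i (!s)) / D.real (region h.cls.steps i) -
        D.real (atom h.cls.steps j (!s)) / D.real (region h.cls.steps j)) ^ 2 ≤ c') :
    Sound D σ ζ ε u { h with
      cls := { h.cls with steps := Step.merge i j :: h.cls.steps }
      live := h.live.erase j } (c + c') := by
  have hset : liveSet (Step.merge i j :: h.cls.steps) (h.live.erase j) =
      liveSet h.cls.steps h.live := liveSet_merge hs.nodup hi hj hij
  refine ⟨fun x => ?_, fun j' hj' => hs.live_lt j' (List.mem_of_mem_erase hj'),
    hs.nodup.erase j, ?_, ?_⟩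
  · simp only [regionOf]
    split_ifs
    · exact hs.live_lt i hi
    · exact hs.region_lt x
  · have hfr : frozenErr ({ h with
      cls := { h.cls with steps := Step.merge i j :: h.cls.steps }
      live := h.live.erase j } : Alg.Hyp d) ⊆ frozenErr h := by
      rintro z ⟨h1, h2⟩
      have hz : regionOf h.cls.steps z.1 ∉ h.live := by
        intro hm
        have : z ∈ liveSet (Step.merge i j :: h.cls.steps) (h.live.erase j) := by
          rw [hset]; exact hm
        exact h1 this
      have hne : regionOf h.cls.steps z.1 ≠ j := fun he => hz (he ▸ hj)
      refine ⟨hz, ?_⟩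
      simp only [regionOf] at h2
      rwa [if_neg hne] at h2
    simp only
    rw [hset]
    exact (measureReal_mono hfr).trans hs.frozen
  · simp only
    rw [hset]
    have h1 := potential_merge_le D (p := h.cls.steps) hs.nodup hi hj hij s hc
    have h2 := hs.potential_le
    linarith

end Sound

/-- A bound for the number of live regions. -/
noncomputable def liveBound (K : Constants) (P : Params) : ℕ := 2 * (⌊1 / P.coarse K⌋₊ + 1)

theorem Regime.coarse_mul_liveBound_le {K : Constants} {P : Params} (h : Regime K P) :
    P.coarse K * liveBound K P ≤ 4 := by
  have h1 := h.coarse_pos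
  have h2 : (⌊1 / P.coarse K⌋₊ : ℝ) ≤ 1 / P.coarse K := Nat.floor_le (by positivity)
  have h3 : P.coarse K ≤ 1 := h.coarse_le.trans
    (pow_le_one₀ h.scale_pos.le (h.scale_le.trans (by norm_num)))
  have h4 := mul_le_mul_of_nonneg_left h2 h1.le
  have h5 : P.coarse K * (1 / P.coarse K) = 1 := by field_simp
  unfold liveBound
  push_cast
  linarith

section Live

variable {K : Constants} {P : Params} {D : Measure (Example d)} [IsProbabilityMeasure D]
  {u : Pt d} {I : ℕ} {p : (ℕ → Example d) → List (Step d)} {n : ℕ} {ω : ℕ → Example d}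

theorem abs_hits_liveSet_sub_le {pos m : ℕ} {α : ℝ} {p : List (Step d)} {l : List ℕ}
    (hl : l.Nodup) (hacc : ∀ i ∈ l, ∀ b, Accurate D ω pos m α (atom p i b)) :
    |hits ω pos m (liveSet p l) - m * D.real (liveSet p l)| ≤ l.length * (m * (2 * α)) := by
  induction l with
  | nil =>
    have : liveSet p [] = ∅ := by ext z; simp [liveSet]
    simp [this, hits]
  | cons i l ih =>
    rw [List.nodup_cons] at hl
    have hd := disjoint_region_liveSet p hl.1
    have h1 := abs_le.1 (ih hl.2 fun i' hi' => hacc i' (List.mem_cons_of_mem _ hi'))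
    have h2 := abs_le.1 (Accurate.region (hacc i List.mem_cons_self))
    rw [liveSet_cons, hits_union _ _ _ hd, measureReal_union hd (measurableSet_liveSet p l),
      List.length_cons, abs_le]
    push_cast
    constructor <;> linarith [h1.1, h1.2, h2.1, h2.2]

/-- When the main loop stops as the live regions have little estimated mass, they have little
mass. -/
theorem RoundGood.real_liveSet_le (h : Regime K P) (hg : RoundGood K P D u I P.acc p n ω)
    {H : Alg.Hyp d} (hp : H.cls.steps = p ω) (hl : H.live.Nodup) (hI : ∀ i ∈ H.live, i < I)
    (hB : H.live.length ≤ liveBound K P) (hmass : Alg.liveMass K P ω H n ≤ P.ε) :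
    D.real (liveSet H.cls.steps H.live) ≤ 2 * P.ε := by
  have hmpos := h.batch_pos'
  have h1 := abs_le.1 (abs_hits_liveSet_sub_le (D := D) (ω := ω) (pos := n) (m := P.batch K)
    (α := P.acc) (p := H.cls.steps) hl fun i hi b => by
      have := hg.atoms i (hI i hi) 0 (by omega) b
      rw [zero_mul, add_zero] at this
      rw [hp]; exact this)
  rw [liveMass_eq, div_le_iff₀ hmpos] at hmass
  have h2 : (H.live.length : ℝ) ≤ liveBound K P := by exact_mod_cast hB
  have h3 : (liveBound K P : ℝ) * P.acc ≤ P.ε / 2 := by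
    have e1 : P.acc ≤ P.coarse K * (P.ε * (1 / 100) ^ 4) := by
      refine (h.acc_le_pow (k := 16) (by norm_num)).trans ?_
      rw [pow_succ, mul_assoc]
      have := h.le_coarse
      have := h.scale_le_ε
      have := h.scale_pos
      have := h.coarse_pos
      gcongr
    have e2 : (liveBound K P : ℝ) * P.acc ≤
        liveBound K P * (P.coarse K * (P.ε * (1 / 100) ^ 4)) := by gcongr
    have e3 := mul_le_mul_of_nonneg_right h.coarse_mul_liveBound_le
      (by have := h.ε_pos; positivity : 0 ≤ P.ε * (1 / 100) ^ 4)
    have := h.ε_pos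
    linarith
  have h4 : H.live.length * (P.batch K * (2 * P.acc)) ≤ P.batch K * P.ε := by
    have e1 : (H.live.length : ℝ) * P.acc ≤ liveBound K P * P.acc := by
      have := h.acc_pos; gcongr
    have e2 := mul_le_mul_of_nonneg_left (e1.trans h3) hmpos.le
    linarith
  refine le_of_mul_le_mul_left ?_ hmpos
  linarith [h1.1]

/-- The live region with the largest estimated mass is not too light. -/
theorem RoundGood.le_real_region (h : Regime K P) (hg : RoundGood K P D u I P.acc p n ω)
    {H : Alg.Hyp d} (hp : H.cls.steps = p ω) (hl : H.live.Nodup) (hI : ∀ i ∈ H.live, i < I)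
    (hB : H.live.length ≤ liveBound K P) (hmass : P.ε < Alg.liveMass K P ω H n) {i : ℕ}
    (hi : i ∈ H.live) (hmax : ∀ j ∈ H.live, Alg.regionCount K P ω H (n + P.batch K) j ≤
      Alg.regionCount K P ω H (n + P.batch K) i) :
    P.scale ^ 2 * P.coarse K ≤ D.real (region (p ω) i) := by
  have hmpos := h.batch_pos'
  have hε := h.ε_pos
  set m := P.batch K with hm
  rw [liveMass_eq, lt_div_iff₀ hmpos, hits_liveSet _ _ _ _ hl] at hmass
  have hB0 : (0 : ℝ) < liveBound K P := by unfold liveBound; positivity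
  have hB' : (H.live.length : ℝ) ≤ liveBound K P := by exact_mod_cast hB
  obtain ⟨j, hj, hjm⟩ : ∃ j ∈ H.live, P.ε * m / liveBound K P ≤
      hits ω n m (region H.cls.steps j) := by
    by_contra hcon
    push Not at hcon
    have := List.sum_le_card_nsmul (H.live.map fun i => hits ω n m (region H.cls.steps i))
      (P.ε * m / liveBound K P) (fun x hx => by
        obtain ⟨j, hj, rfl⟩ := List.mem_map.1 hx
        exact (hcon j hj).le)
    rw [List.length_map, nsmul_eq_mul] at this
    have h2 : (H.live.length : ℝ) * (P.ε * m / liveBound K P) ≤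
        liveBound K P * (P.ε * m / liveBound K P) := by gcongr
    have h3 : (liveBound K P : ℝ) * (P.ε * m / liveBound K P) = P.ε * m := by field_simp
    linarith
  have acc0 : ∀ i ∈ H.live, Accurate D ω n m (2 * P.acc) (region (p ω) i) := fun i hi =>
    Accurate.region fun b => by
      have := hg.atoms i (hI i hi) 0 (by omega) b
      rwa [zero_mul, add_zero] at this
  have acc1 : ∀ i ∈ H.live, Accurate D ω (n + m) m (2 * P.acc) (region (p ω) i) := fun i hi =>
    Accurate.region fun b => by
      have := hg.atoms i (hI i hi) 1 (by omega) b
      rwa [one_mul] at this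
  have hmax' : hits ω (n + m) m (region (p ω) j) ≤ hits ω (n + m) m (region (p ω) i) := by
    have := hmax j hj
    rw [← Nat.cast_le (α := ℝ), regionCount_eq, regionCount_eq, hp] at this
    exact this
  rw [hp] at hjm
  have e1 := (abs_le.1 (acc0 j hj)).2
  have e2 := (abs_le.1 (acc1 j hj)).1
  have e3 := (abs_le.1 (acc1 i hi)).2
  have e4 : P.ε * m / liveBound K P ≥ m * (P.ε * P.coarse K / 4) := by
    rw [ge_iff_le, le_div_iff₀ hB0]
    have := mul_le_mul_of_nonneg_left h.coarse_mul_liveBound_le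
      (by positivity : 0 ≤ m * P.ε / 4)
    linarith
  have e5 : 100 * (P.scale ^ 2 * P.coarse K) ≤ P.ε * P.coarse K := by
    have g1 : 100 * P.scale ^ 2 ≤ P.ε := by
      have := h.scale_pow_le 1 1
      have := h.scale_le_ε
      linarith
    have := mul_le_mul_of_nonneg_right g1 h.coarse_pos.le
    linarith
  have e6 : 6 * P.acc ≤ P.scale ^ 2 * P.coarse K := by
    have g1 := h.acc_le_pow (k := 17) (by norm_num)
    have g2 : P.scale ^ 17 ≤ P.scale ^ 2 * P.coarse K := by
      rw [show 17 = 2 + 15 from rfl, pow_add]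
      exact mul_le_mul_of_nonneg_left h.le_coarse (sq_nonneg _)
    have := pow_pos h.scale_pos 17
    linarith
  have e7 : 0 < P.scale ^ 2 * P.coarse K := mul_pos (pow_pos h.scale_pos _) h.coarse_pos
  refine le_of_mul_le_mul_left (a := (m : ℝ)) ?_ hmpos
  have e8 := mul_le_mul_of_nonneg_left e5 hmpos.le
  have e9 := mul_le_mul_of_nonneg_left e6 hmpos.le
  have e10 := mul_pos hmpos e7
  linarith

end Live

/-! ### The rounds of a good run -/

section Run

variable {K : Constants} {P : Params} {D : Measure (Example d)} [IsProbabilityMeasure D]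
  {σ : ℝ → ℝ} {u : Pt d} {ω : ℕ → Example d}

variable (K P D u) in
/-- All estimates are accurate, in all rounds, whatever decisions are made. -/
structure GoodRun (ω : ℕ → Example d) : Prop where
  rounds : ∀ l : List (Decision K P (P.rounds K + 2)), l.length ≤ P.rounds K →
    RoundGood K P D u (P.rounds K + 2) P.acc (trace K P l).1 (trace (d := d) K P l).2 ω
  bounded : ∀ j, ‖(ω j).1‖ ≤ 1

/-- A merge of two regions with similar estimated errors raises the potential only a little. -/
theorem merge_loss_le (h : Regime K P) {q : List (Step d)} {pos i j : ℕ}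
    (hi : ∀ b, Accurate D ω pos (P.batch K) P.acc (atom q i b))
    (hj : ∀ b, Accurate D ω pos (P.batch K) P.acc (atom q j b)) (s : Bool)
    (hij : |hits ω pos (P.batch K) (atom q i (!s)) / hits ω pos (P.batch K) (region q i) -
      hits ω pos (P.batch K) (atom q j (!s)) / hits ω pos (P.batch K) (region q j)| ≤
      P.coarse K) :
    min (D.real (region q i)) (D.real (region q j)) *
      (D.real (atom q i (!s)) / D.real (region q i) -
        D.real (atom q j (!s)) / D.real (region q j)) ^ 2 ≤ 3 * P.coarse K ^ 2 := by
  set υ := P.coarse K with hυdef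
  set m := P.batch K with hm
  have hmpos : (0 : ℝ) < m := h.batch_pos'
  have hυ : 0 < υ := h.coarse_pos
  have hsub : ∀ i, D.real (atom q i (!s)) ≤ D.real (region q i) := fun i => by
    rw [real_region D q i s]
    linarith [measureReal_nonneg (μ := D) (s := atom q i s)]
  have hfrac0 : ∀ i, 0 ≤ D.real (atom q i (!s)) / D.real (region q i) := fun i =>
    div_nonneg measureReal_nonneg measureReal_nonneg
  have hfrac1 : ∀ i, D.real (atom q i (!s)) / D.real (region q i) ≤ 1 := fun i =>
    div_le_one_of_le₀ (hsub i) measureReal_nonneg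
  by_cases hbig : υ ^ 2 ≤ min (D.real (region q i)) (D.real (region q j))
  · have hest : ∀ i, (∀ b, Accurate D ω pos m P.acc (atom q i b)) → υ ^ 2 ≤ D.real (region q i) →
        |hits ω pos m (atom q i (!s)) / hits ω pos m (region q i) -
          D.real (atom q i (!s)) / D.real (region q i)| ≤ υ / 10 := by
      intro i hi hM
      have hR : Accurate D ω pos m (2 * P.acc) (region q i) := Accurate.region hi
      have hM0 : 0 < D.real (region q i) := lt_of_lt_of_le (by positivity) hM
      have a1 : P.acc ≤ υ ^ 3 * (1 / 100) ^ 4 := by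
        refine (h.acc_le_pow (k := 45) (by norm_num)).trans ?_
        have := pow_le_pow_left₀ (pow_nonneg h.scale_pos.le 15) h.le_coarse 3
        rw [← pow_mul] at this
        gcongr
      have a2 : P.acc ≤ υ ^ 2 * (1 / 100) ^ 4 := by
        refine a1.trans ?_
        have : υ ≤ 1 := h.coarse_le.trans
          (pow_le_one₀ h.scale_pos.le (h.scale_le.trans (by norm_num)))
        have : υ ^ 3 ≤ υ ^ 2 := pow_le_pow_of_le_one hυ.le this (by norm_num)
        gcongr
      have a3 : m * P.acc ≤ m * (υ ^ 3 * (1 / 100) ^ 4) := by gcongr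
      have a4 : m * P.acc ≤ m * (υ ^ 2 * (1 / 100) ^ 4) := by gcongr
      have a5 := mul_le_mul_of_nonneg_left hM hmpos.le
      have a6 : 0 < m * υ ^ 2 := by positivity
      have a7 : m * υ ^ 2 * (9 / 10) ≤ hits ω pos m (region q i) := by
        linarith [(abs_le.1 hR).1]
      rw [← mul_div_mul_left (D.real (atom q i (!s))) (D.real (region q i)) hmpos.ne']
      refine abs_div_sub_div_le ((hi _).trans ?_) hR (mul_nonneg hmpos.le measureReal_nonneg)
        (mul_le_mul_of_nonneg_left (hsub i) hmpos.le) (mul_pos hmpos hM0)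
        (lt_of_lt_of_le (by positivity) a7) ?_
      · have := mul_nonneg hmpos.le h.acc_pos.le
        linarith
      · have := mul_le_mul_of_nonneg_left a7 (by positivity : 0 ≤ υ / 10)
        have a8 : 0 < m * υ ^ 3 := by positivity
        linarith
    have e1 := abs_le.1 (hest i hi (hbig.trans (min_le_left _ _)))
    have e2 := abs_le.1 (hest j hj (hbig.trans (min_le_right _ _)))
    have e3 := abs_le.1 hij
    have e4 : |D.real (atom q i (!s)) / D.real (region q i) -
        D.real (atom q j (!s)) / D.real (region q j)| ≤ 12 / 10 * υ := by
      rw [abs_le]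
      constructor <;> linarith [e1.1, e1.2, e2.1, e2.2, e3.1, e3.2]
    have e5 := pow_le_pow_left₀ (abs_nonneg _) e4 2
    rw [sq_abs] at e5
    have e6 : min (D.real (region q i)) (D.real (region q j)) ≤ 1 :=
      (min_le_left _ _).trans measureReal_le_one
    refine (mul_le_mul e6 e5 (sq_nonneg _) zero_le_one).trans ?_
    nlinarith [sq_nonneg υ]
  · have e1 : (D.real (atom q i (!s)) / D.real (region q i) -
        D.real (atom q j (!s)) / D.real (region q j)) ^ 2 ≤ 1 := by
      rw [sq_le_one_iff_abs_le_one, abs_le]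
      constructor <;> linarith [hfrac0 i, hfrac0 j, hfrac1 i, hfrac1 j]
    refine (mul_le_mul (not_le.1 hbig).le e1 (sq_nonneg _) (sq_nonneg _)).trans ?_
    nlinarith [sq_nonneg υ]

variable (K P D σ u ω) in
/-- The invariant of the main loop, after `j` rounds. -/
structure Invariant (h : Alg.Hyp d) (n j : ℕ) : Prop where
  trace : ∃ l : List (Decision K P (P.rounds K + 2)), l.length = j ∧
    h.cls.steps = (trace K P l).1 ω ∧ n = (_root_.trace (d := d) K P l).2
  next_le : h.next ≤ j + 1
  length_live_le : h.live.length ≤ liveBound K P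
  sound : Sound D σ P.ζ P.ε u h (5 / 4 - j * (P.scale ^ 9 * P.coarse K))

theorem liveErr_mem_unit (q : Classifier d) (n i : ℕ) :
    0 ≤ Alg.liveErr K P ω q n i ∧ Alg.liveErr K P ω q n i ≤ 1 := by
  rw [liveErr_eq]
  refine ⟨div_nonneg (hits_nonneg _ _ _ _) (hits_nonneg _ _ _ _),
    div_le_one_of_le₀ ?_ (hits_nonneg _ _ _ _)⟩
  rw [hits_region ω n _ q.steps i (q.label i)]
  linarith [hits_nonneg ω n (P.batch K) (atom q.steps i (q.label i))]

/-- Every round uses up a fixed amount of the potential plus the live mass: freezing removes the mass of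
a region that is not too light, splitting lowers the variance of the labels, and merging regains
only a small part of that. -/
theorem Invariant.step (hR : Regime K P) (hσ : IsLink P.L σ) (hu : ‖u‖ ≤ 1)
    (hmod : IsMisspecifiedGLM P.ζ σ u D) (hg : GoodRun K P D u ω) {h h' : Alg.Hyp d} {n n' j : ℕ}
    (hinv : Invariant K P D σ u ω h n j) (hj : j < P.rounds K)
    (hout : Alg.RoundOutcome K P ω h n h' n') : Invariant K P D σ u ω h' n' (j + 1) := by
  obtain ⟨⟨l, hl, hsteps, hn⟩, hnext, hlen, hs⟩ := hinv
  have hgood := hg.rounds l (by omega)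
  have hI : ∀ i ∈ h.live, i < P.rounds K + 2 := fun i hi => by
    have := hs.live_lt i hi
    omega
  obtain ⟨hmass, i, hi, hmax, s, e, out, n₁, hsplit, he1, he, hcase⟩ := hout
  subst hn
  have hM2 := hgood.le_real_region hR hsteps hs.nodup hI hlen hmass hi hmax
  have hM : P.scale ^ 17 ≤ D.real (region ((_root_.trace K P l).1 ω) i) := by
    refine le_trans ?_ hM2
    rw [show 17 = 2 + 15 from rfl, pow_add]
    exact mul_le_mul_of_nonneg_left hR.le_coarse (sq_nonneg _)
  have hy := hR.scale_pos
  have hyle := hR.scale_le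
  have hυ := hR.coarse_pos
  have hsound : ∀ x y : ℝ, x + P.scale ^ 9 * P.coarse K ≤ y →
      5 / 4 - j * (P.scale ^ 9 * P.coarse K) - y + x ≤
        5 / 4 - ((j + 1 : ℕ) : ℝ) * (P.scale ^ 9 * P.coarse K) := fun x y hxy => by
    push_cast
    linarith
  rcases hcase with ⟨rfl, rfl, rfl⟩ | ⟨w, τ, t, rfl, hmerge, rfl⟩
  · -- the region is frozen
    have hle : D.real (atom h.cls.steps i (!s)) ≤
        ∫ z in region h.cls.steps i, optErr σ P.ζ u z ∂D +
          5 * P.ε * D.real (region h.cls.steps i) := by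
      rw [hsteps] at hsplit he ⊢
      exact hgood.freeze_le hR hσ hu hmod hg.bounded (hI i hi) hM he1 he hsplit
    have hs' := hs.freeze hσ hi s hle
    refine ⟨?_, Nat.le_succ_of_le hnext, (List.length_erase_le).trans hlen, hs'.mono ?_⟩
    · rcases hsplit with ⟨-, hn₁, -⟩ | ⟨-, -, -, -, -, hn₁, -⟩
      · refine ⟨Sum.inl false :: l, by simp [hl], hsteps, ?_⟩
        rw [hn₁]
        simp only [_root_.trace]
        ring
      · refine ⟨Sum.inl true :: l, by simp [hl], hsteps, ?_⟩
        rw [hn₁]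
        simp only [_root_.trace]
        ring
    · rw [hsteps]
      have h1 := hsound 0 (D.real (region ((_root_.trace K P l).1 ω) i)) (by
        refine le_trans ?_ hM2
        have : P.scale ^ 9 ≤ P.scale ^ 2 := pow_le_pow_of_le_one hy.le
          (hyle.trans (by norm_num)) (by norm_num)
        rw [zero_add]
        gcongr)
      linarith
  · -- a side of an annulus is split off
    have hsplit' := hsplit
    rw [hsteps] at hsplit' he
    obtain ⟨k, hk, a, ha, hw, hτ, hn₁, hq, hdiff⟩ :=
      hgood.split_le hR (hI i hi) hM he1 he hsplit'
    rw [← hsteps] at hq hdiff hM2 hM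
    have hM0 : 0 < D.real (region h.cls.steps i) := lt_of_lt_of_le (by positivity) hM
    have hq0 : 0 < D.real (sideRegion h.cls.steps i w τ t) := lt_of_lt_of_le (by positivity) hq
    have hs' := hs.splitOff hi s (t := t) hq0
    have hnextI : h.next < P.rounds K + 2 := by omega
    have hgain : 3 * P.coarse K ^ 2 + P.scale ^ 9 * P.coarse K ≤
        D.real (sideRegion h.cls.steps i w τ t) *
        (D.real (sideAtom h.cls.steps i w τ t (!t)) / D.real (sideRegion h.cls.steps i w τ t) -
          D.real (atom h.cls.steps i (!t)) / D.real (region h.cls.steps i)) ^ 2 := by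
      have g1 : (P.scale / 2) ^ 2 ≤
          (D.real (sideAtom h.cls.steps i w τ t (!t)) / D.real (sideRegion h.cls.steps i w τ t) -
          D.real (atom h.cls.steps i (!t)) / D.real (region h.cls.steps i)) ^ 2 := by
        rw [← sq_abs (_ - _)]
        refine pow_le_pow_left₀ (by positivity) ?_ 2
        rw [le_abs]
        right
        have := hR.scale_le_ε
        linarith
      have g2 : 98 / 100 * P.scale ^ 4 * (P.scale ^ 2 * P.coarse K) ≤
          D.real (sideRegion h.cls.steps i w τ t) := le_trans (by gcongr) hq
      refine le_trans ?_ (mul_le_mul g2 g1 (by positivity) hq0.le)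
      have g3 : P.scale ^ 9 ≤ P.scale ^ 8 * (1 / 100) ^ 1 := hR.scale_pow_le 8 1
      have g4 : P.coarse K ^ 2 ≤ P.coarse K * (P.scale ^ 8 * (1 / 100) ^ 2) := by
        rw [sq]
        have := hR.coarse_le.trans (hR.scale_pow_le 8 2)
        gcongr
      have g5 : P.scale ^ 9 * P.coarse K ≤ P.scale ^ 8 * (1 / 100) ^ 1 * P.coarse K := by gcongr
      have g6 : 98 / 100 * P.scale ^ 4 * (P.scale ^ 2 * P.coarse K) * (P.scale / 2) ^ 2 =
          P.scale ^ 8 * P.coarse K * (98 / 400) := by ring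
      have g7 : 0 < P.scale ^ 8 * P.coarse K := by positivity
      rw [g6]
      linarith
    have hcut : (h.splitOff i s w τ t).cls.steps =
        roundCut K P (_root_.trace K P l).1 (_root_.trace (d := d) K P l).2 i k a t h.next ω := by
      simp only [Alg.Hyp.splitOff, roundCut, hw, hτ, hsteps]
    have hlive' : ∀ i' ∈ (h.splitOff i s w τ t).live, i' < P.rounds K + 2 := fun i' hi' => by
      have h1 : i' < h.next + 1 := hs'.live_lt i' hi'
      omega
    have hpos : ∀ x, x = n₁ + P.batch K → x = (_root_.trace (d := d) K P l).2 +
        (P.grid + 7) * P.batch K := fun x hx => by rw [hx, hn₁]; ring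
    rcases hmerge with ⟨rfl, hsep⟩ | ⟨i', j', hsub, hlab, herr, rfl⟩
    · refine ⟨⟨Sum.inr (⟨i, hI i hi⟩, ⟨k, hk⟩, ⟨a, ha⟩, t, ⟨h.next, hnextI⟩, none) :: l,
        by simp [hl], hcut, hpos _ rfl⟩, by simp only [Alg.Hyp.splitOff]; omega, ?_, hs'.mono ?_⟩
      · exact length_le_of_separated hs'.nodup hυ
          (fun i => (liveErr_mem_unit (K := K) (P := P) (ω := ω) _ n₁ i).1)
          (fun i => (liveErr_mem_unit _ n₁ i).2) hsep
      · have h1 := hsound 0 _ (le_trans (by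
          have := sq_nonneg (P.coarse K)
          linarith) hgain)
        linarith
    · have hi' : i' ∈ (h.splitOff i s w τ t).live := hsub.subset (by simp)
      have hj' : j' ∈ (h.splitOff i s w τ t).live := hsub.subset (by simp)
      have hij : i' ≠ j' := by
        have := hsub.nodup hs'.nodup
        simpa using this
      have hacc : ∀ i' ∈ (h.splitOff i s w τ t).live, ∀ b,
          Accurate D ω n₁ (P.batch K) P.acc (atom (h.splitOff i s w τ t).cls.steps i' b) :=
        fun i' hi' b => by
          rw [hcut, hn₁]
          exact hgood.cutAtoms i (hI i hi) k hk a ha t h.next hnextI i' (hlive' i' hi') b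
      rw [liveErr_eq, liveErr_eq, hlab] at herr
      have hloss := merge_loss_le hR (hacc i' hi') (hacc j' hj')
        ((h.splitOff i s w τ t).cls.label i') herr
      have hs'' := hs'.merge hi' hj' hij ((h.splitOff i s w τ t).cls.label i') hloss
      refine ⟨⟨Sum.inr (⟨i, hI i hi⟩, ⟨k, hk⟩, ⟨a, ha⟩, t, ⟨h.next, hnextI⟩,
        some (⟨i', hlive' i' hi'⟩, ⟨j', hlive' j' hj'⟩)) :: l,
        by simp [hl], ?_, hpos _ rfl⟩, by simp only [Alg.Hyp.splitOff]; omega, ?_, hs''.mono ?_⟩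
      · simp only [hcut, _root_.trace]
      · simp only
        rw [List.length_erase_of_mem hj']
        simp only [Alg.Hyp.splitOff, List.length_cons, Nat.add_sub_cancel]
        exact hlen
      · exact hsound _ _ hgain

end Run

/-! ### Complete runs -/

namespace Alg

variable {K : Constants} {P : Params} {ω : ℕ → Example d}

theorem RoundOutcome.length_le {h h' : Hyp d} {n n' : ℕ} (hout : RoundOutcome K P ω h n h' n') :
    h'.cls.steps.length ≤ h.cls.steps.length + 2 ∧ h'.live.length ≤ h.live.length + 1 ∧
      n' ≤ n + (P.grid + 7) * P.batch K := by
  obtain ⟨-, i, -, -, s, e, out, n₁, hsplit, -, -, hcase⟩ := hout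
  have hn₁ : n₁ ≤ n + (P.grid + 6) * P.batch K := by
    rcases hsplit with ⟨-, rfl, -⟩ | ⟨-, -, -, -, -, rfl, -⟩
    · ring_nf; omega
    · ring_nf; omega
  have hn₂ : n₁ + P.batch K ≤ n + (P.grid + 7) * P.batch K := by
    calc n₁ + P.batch K ≤ n + (P.grid + 6) * P.batch K + P.batch K := by gcongr
      _ = _ := by ring
  rcases hcase with ⟨-, rfl, rfl⟩ | ⟨w, τ, t, -, hmerge, rfl⟩
  · exact ⟨Nat.le_add_right _ _, (List.length_erase_le).trans (Nat.le_succ _), by omega⟩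
  · refine ⟨?_, ?_, hn₂⟩
    · rcases hmerge with ⟨rfl, -⟩ | ⟨i', j', -, -, -, rfl⟩ <;> simp [Hyp.splitOff]
    · rcases hmerge with ⟨rfl, -⟩ | ⟨i', j', -, -, -, rfl⟩
      · simp [Hyp.splitOff]
      · exact (List.length_erase_le).trans (by simp [Hyp.splitOff])

/-- The state in which the main loop starts. -/
def Hyp.init (s : Bool) : Hyp d where
  cls := { steps := [], label := fun _ => s }
  live := [0]
  next := 1

/-- The main loop stops in a state `h` that is reached after `j` rounds, at position `n`. -/
def Stops (K : Constants) (P : Params) (ω : ℕ → Example d) (h : Hyp d) (n j : ℕ) : Prop :=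
  j = P.rounds K ∨ j < P.rounds K ∧ (liveMass K P ω h n ≤ P.ε ∨ h.live = [])

/-- Every invariant of the rounds holds when the main loop stops. -/
theorem Eval.mainLoop {I : Hyp d → ℕ → ℕ → Prop}
    (hI : ∀ h n h' n' j, I h n j → j < P.rounds K → RoundOutcome K P ω h n h' n' →
      I h' n' (j + 1)) :
    ∀ (r j : ℕ) (h : Hyp d) (n : ℕ), j + r = P.rounds K → h.cls.steps.length ≤ 2 * j →
      h.live.length ≤ j + 1 → I h n j →
      ∃ h' n' j', I h' n' j' ∧ Stops K P ω h' n' j' ∧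
        ∃ n'' ≤ n + r * ((P.grid + 7) * P.batch K) + 2 * P.batch K,
          Eval (Alg.mainLoop K P r h) ω n h'.cls n'' (r * roundCost d K P (2 * P.rounds K + 3)) := by
  intro r
  induction r with
  | zero =>
    intro j h n hj _ _ hinv
    exact ⟨h, n, j, hinv, Or.inl hj, n, by omega, (Eval.ret _).mono (Nat.zero_le _)⟩
  | succ r ih =>
    intro j h n hj hs hl hinv
    rcases Eval.mainLoop_succ (ω := ω) (n := n) K P r h (Λ := 2 * P.rounds K + 3) (by omega)
      (by omega) with ⟨T, hT, n', hn', hev, hfin⟩ | ⟨h', n', hout, hev⟩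
    · refine ⟨h, n, j, hinv, Or.inr ⟨by omega, hfin⟩, n', by omega, hev.mono (hT.trans ?_)⟩
      exact Nat.le_mul_of_pos_left _ (Nat.succ_pos r)
    · obtain ⟨g1, g2, g3⟩ := hout.length_le
      obtain ⟨h₁, n₁, j₁, k1, k2, n'', hn'', k3⟩ := ih (j + 1) h' n' (by omega) (by omega)
        (by omega) (hI h n h' n' j hinv (by omega) hout)
      refine ⟨h₁, n₁, j₁, k1, k2, n'', ?_, (hev _ _ _ k3).mono (by ring_nf; omega)⟩
      calc n'' ≤ n' + r * ((P.grid + 7) * P.batch K) + 2 * P.batch K := hn''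
        _ ≤ n + (P.grid + 7) * P.batch K + r * ((P.grid + 7) * P.batch K) + 2 * P.batch K := by
          gcongr
        _ = _ := by ring

/-- A bound for the number of examples drawn. -/
noncomputable def sampleBound (K : Constants) (P : Params) : ℕ :=
  P.batch K * (P.rounds K * (P.grid + 7) + 3)

/-- A bound for the number of steps. -/
noncomputable def timeBound (d : ℕ) (K : Constants) (P : Params) : ℕ :=
  K.cBatch + K.cMerge + K.cRounds + P.batch K + P.rounds K + P.grid + 20 +
    (P.batch K * (d + 9) + 5) + P.rounds K * roundCost d K P (2 * P.rounds K + 3)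

theorem Eval.learnMisspecGLM {I : Hyp d → ℕ → ℕ → Prop}
    (hI : ∀ h n h' n' j, I h n j → j < P.rounds K → RoundOutcome K P ω h n h' n' →
      I h' n' (j + 1)) (h₀ : ∀ s, I (Hyp.init s) (P.batch K) 0) :
    ∃ h n j, I h n j ∧ Stops K P ω h n j ∧ ∃ n' ≤ sampleBound K P,
      Eval (Alg.learnMisspecGLM K P) ω 0 h.cls n' (timeBound d K P) := by
  set Y := (batch ω 0 (P.batch K)).map fun z => z.2 with hY
  set s : Bool := decide (errFrac true Y ≤ errFrac false Y) with hs
  obtain ⟨h, n, j, h1, h2, n', hn', h3⟩ := Eval.mainLoop hI (P.rounds K) 0 (Hyp.init s)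
    (P.batch K) (by omega) (by simp [Hyp.init]) (by simp [Hyp.init]) (h₀ s)
  refine ⟨h, n, j, h1, h2, n', hn'.trans (by unfold sampleBound; ring_nf; omega), ?_⟩
  have hlen : Y.length = P.batch K := by simp [hY]
  have d1 : Eval (Alg.draw (P.batch K) : Alg d _) ω 0 (batch ω 0 (P.batch K)) (P.batch K)
      (P.batch K * (d + 2)) := by simpa using Eval.draw (ω := ω) (P.batch K) 0
  have d2 : Eval (Alg.each (fun z : Example d => pure z.2) (batch ω 0 (P.batch K))) ω (P.batch K)
      Y (P.batch K) (P.batch K * 1) :=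
    (Eval.each (c := 0) fun z _ => Eval.ret z.2).mono (by simp)
  have d3 := Eval.constErr (d := d) (ω := ω) (n := P.batch K) true Y
  have d4 := Eval.constErr (d := d) (ω := ω) (n := P.batch K) false Y
  rw [hlen] at d3 d4
  rw [Alg.learnMisspecGLM]
  refine ((Eval.tick _).bind (d1.bind (d2.bind (d3.bind (d4.bind ((Eval.tick 3).bind h3)))))).mono ?_
  unfold timeBound
  ring_nf
  omega

theorem Eval.output_eq {c : Classifier d} {n T : ℕ}
    (h : Eval (Alg.learnMisspecGLM K P) ω 0 c n T) : glmOutput K P ω = c := by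
  obtain ⟨t, -, h⟩ := h 0
  rw [glmOutput, h]

theorem Eval.samples_eq {c : Classifier d} {n T : ℕ}
    (h : Eval (Alg.learnMisspecGLM K P) ω 0 c n T) : glmSamples K P ω = n := by
  obtain ⟨t, -, h⟩ := h 0
  rw [glmSamples, h]

theorem Eval.time_le {c : Classifier d} {n T : ℕ}
    (h : Eval (Alg.learnMisspecGLM K P) ω 0 c n T) : glmTime K P ω ≤ T := by
  obtain ⟨t, ht, h⟩ := h 0
  rw [glmTime, h]
  simpa using ht

end Alg

theorem glmSamples_le_and_glmTime_le (K : Constants) (P : Params) (ω : ℕ → Example d) :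
    glmSamples K P ω ≤ Alg.sampleBound K P ∧ glmTime K P ω ≤ Alg.timeBound d K P := by
  obtain ⟨h, n, j, -, -, n', hn', hev⟩ := Alg.Eval.learnMisspecGLM (K := K) (P := P) (ω := ω)
    (I := fun _ _ _ => True) (fun _ _ _ _ _ _ _ _ => trivial) (fun _ => trivial)
  exact ⟨hev.samples_eq.trans_le hn', hev.time_le⟩

/-! ### The error on a good run -/

section Error

variable {K : Constants} {P : Params} {D : Measure (Example d)} [IsProbabilityMeasure D]
  {σ : ℝ → ℝ} {u : Pt d} {ω : ℕ → Example d}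

/-- Initially the potential is at most `1 / 4` and the live mass is `1`. -/
theorem invariant_init (s : Bool) :
    Invariant K P D σ u ω (Alg.Hyp.init s) (P.batch K) 0 := by
  have hlive : liveSet (Alg.Hyp.init (d := d) s).cls.steps (Alg.Hyp.init (d := d) s).live =
      Set.univ := by
    ext z
    simp [liveSet, Alg.Hyp.init, regionOf]
  refine ⟨⟨[], rfl, rfl, rfl⟩, le_rfl, ?_, fun x => ?_, fun i hi => ?_, ?_, ?_, ?_⟩
  · simp only [Alg.Hyp.init, List.length_singleton, liveBound]
    omega
  · simp [Alg.Hyp.init, regionOf]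
  · simpa [Alg.Hyp.init] using hi
  · simp [Alg.Hyp.init]
  · have : frozenErr (Alg.Hyp.init (d := d) s) = ∅ := by
      ext z
      simp [frozenErr, Alg.Hyp.init, regionOf]
    rw [hlive, this]
    simp
  · rw [hlive, probReal_univ]
    have h1 := labelVar_le (measureReal_nonneg (μ := D) (s := atom (d := d) [] 0 true))
      (measureReal_nonneg (μ := D) (s := atom [] 0 false))
    have h2 := real_region D (d := d) [] 0 true
    have h3 : D.real (region (d := d) [] 0) ≤ 1 := measureReal_le_one
    simp only [Bool.not_true] at h2
    simp only [potential, Alg.Hyp.init, List.map_cons, List.map_nil, List.sum_cons, List.sum_nil]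
    push_cast
    linarith

theorem setIntegral_optErr_le {L : ℝ≥0} {ζ : ℝ} (hσ : IsLink L σ) (hζ : 0 ≤ ζ)
    (s : Set (Example d)) :
    ∫ z in s, optErr σ ζ u z ∂D ≤ (1 - ∫ z, σ |inner ℝ u z.1| ∂D) / 2 + ζ := by
  have h1 : ∫ z, optErr σ ζ u z ∂D = (1 - ∫ z, σ |inner ℝ u z.1| ∂D) / 2 + ζ := by
    have e1 : Integrable (fun z : Example d => (1 - σ |inner ℝ u z.1|) / 2) D :=
      ((integrable_const 1).sub (hσ.integrable_comp u)).div_const 2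
    unfold optErr
    rw [integral_add e1 (integrable_const ζ), integral_div,
      integral_sub (integrable_const 1) (hσ.integrable_comp u)]
    simp
  rw [← h1]
  exact setIntegral_le_integral (hσ.integrable_optErr u)
    (Filter.Eventually.of_forall fun z => hσ.optErr_nonneg hζ u z)

/-- The error is at most the error on the frozen regions plus the mass of the live ones. -/
theorem Sound.zeroOneErr_le {L : ℝ≥0} {ζ ε c : ℝ} {h : Alg.Hyp d} (hs : Sound D σ ζ ε u h c)
    (hσ : IsLink L σ) (hζ : 0 ≤ ζ) (hε : 0 ≤ ε)
    (hlive : D.real (liveSet h.cls.steps h.live) ≤ 2 * ε) :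
    zeroOneErr D h.cls.predict ≤ (1 - ∫ z, σ |inner ℝ u z.1| ∂D) / 2 + ζ + 100 * ε := by
  have hsub : {z : Example d | h.cls.predict z.1 ≠ z.2} ⊆
      frozenErr h ∪ liveSet h.cls.steps h.live := by
    intro z hz
    by_cases hl : regionOf h.cls.steps z.1 ∈ h.live
    · exact Or.inr hl
    · exact Or.inl ⟨hl, hz⟩
  have h1 : zeroOneErr D h.cls.predict ≤
      D.real (frozenErr h) + D.real (liveSet h.cls.steps h.live) :=
    (measureReal_mono hsub).trans (measureReal_union_le _ _)
  have h2 := setIntegral_optErr_le (D := D) (u := u) hσ hζ (liveSet h.cls.steps h.live)ᶜ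
  have h3 : ε * D.real (liveSet h.cls.steps h.live)ᶜ ≤ ε * 1 := by
    gcongr
    exact measureReal_le_one
  linarith [hs.frozen]

/-- On a good run the classifier is nearly optimal: when the loop runs out of rounds, the
potential has been used up, so that no live mass is left. -/
theorem GoodRun.zeroOneErr_le (hR : Regime K P) (hcR : K.cRounds = 25) (hσ : IsLink P.L σ)
    (hu : ‖u‖ ≤ 1) (hmod : IsMisspecifiedGLM P.ζ σ u D) (hg : GoodRun K P D u ω) :
    zeroOneErr D (glmOutput K P ω).predict ≤
      (1 - ∫ z, σ |inner ℝ u z.1| ∂D) / 2 + P.ζ + 100 * P.ε := by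
  obtain ⟨h, n, j, hinv, hfin, n', -, hev⟩ := Alg.Eval.learnMisspecGLM (K := K) (P := P) (ω := ω)
    (I := Invariant K P D σ u ω) (fun h n h' n' j hinv hj hout =>
      hinv.step hR hσ hu hmod hg hj hout) invariant_init
  rw [hev.output_eq]
  obtain ⟨⟨l, hl, hsteps, hn⟩, hnext, hlen, hs⟩ := hinv
  refine hs.zeroOneErr_le hσ hR.ζ_nonneg hR.ε_pos.le ?_
  have hε := hR.ε_pos
  rcases hfin with rfl | ⟨hj, hmass | hempty⟩
  · have hy := hR.scale_pos
    -- all rounds were used: they exhaust the budget `5 / 4`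
    have h1 : 25 ≤ P.rounds K * P.scale ^ 25 := by
      have e1 : (25 : ℝ) * ((1 + P.L) / P.ε) ^ 25 ≤ P.rounds K := by
        have := Nat.le_ceil ((K.cRounds : ℝ) * ((1 + P.L) / P.ε) ^ K.cRounds)
        rw [hcR] at this
        simpa [Params.rounds, hcR] using this
      have e2 : ((1 + P.L) / P.ε : ℝ) ^ 25 * P.scale ^ 25 = 1 := by
        have : (1 + (P.L : ℝ)) ≠ 0 := by positivity
        rw [← mul_pow, Params.scale, div_mul_div_comm, mul_comm, div_self (by positivity), one_pow]
      have e3 := mul_le_mul_of_nonneg_right e1 (pow_nonneg hy.le 25)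
      rwa [mul_assoc, e2, mul_one] at e3
    have h2 : P.scale ^ 25 ≤ P.scale ^ 9 * P.coarse K := by
      have e1 : P.scale ^ 25 ≤ P.scale ^ (9 + 15) :=
        pow_le_pow_of_le_one hy.le (hR.scale_le.trans (by norm_num)) (by norm_num)
      refine e1.trans ?_
      rw [pow_add]
      have := hR.le_coarse
      gcongr
    have h3 := mul_le_mul_of_nonneg_left h2 (Nat.cast_nonneg (α := ℝ) (P.rounds K))
    have h4 := potential_nonneg D h.cls.steps h.live
    linarith [hs.potential_le]
  · subst hn
    exact (hg.rounds l (by omega)).real_liveSet_le hR hsteps hs.nodup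
      (fun i hi => by have := hs.live_lt i hi; omega) hlen hmass
  · have : liveSet h.cls.steps h.live = ∅ := by ext z; simp [liveSet, hempty]
    rw [this, measureReal_empty]
    positivity

end Error

/-! ### Most runs are good -/

theorem ae_forall_norm_le_one {D : Measure (Example d)} [IsProbabilityMeasure D]
    (hD : ∀ᵐ z ∂D, ‖z.1‖ ≤ 1) :
    ∀ᵐ ω ∂(Measure.infinitePi fun _ : ℕ => D), ∀ j, ‖(ω j).1‖ ≤ 1 :=
  ae_all_iff.2 fun j =>
    (measurePreserving_eval_infinitePi (fun _ : ℕ => D) j).quasiMeasurePreserving.ae hD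

/-- A union bound over all sequences of decisions. -/
theorem prob_not_goodRun_le {K : Constants} {P : Params} (D : Measure (Example d))
    [IsProbabilityMeasure D] (hD : ∀ᵐ z ∂D, ‖z.1‖ ≤ 1) {u : Pt d} (hu : ‖u‖ ≤ 1)
    (hα : 0 < P.acc) (hε : 0 < P.ε) (hm : 2 ≤ P.batch K) (hmα : 1 ≤ P.batch K * P.acc) :
    (Measure.infinitePi fun _ : ℕ => D) {ω | ¬ GoodRun K P D u ω} ≤
      ((P.rounds K + 1) * (Fintype.card (Decision K P (P.rounds K + 2)) + 1) ^ P.rounds K *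
        estimates K P (P.rounds K + 2) : ℕ) * failProb (P.batch K) P.acc := by
  set μ := Measure.infinitePi fun _ : ℕ => D with hμ
  set R := P.rounds K with hR
  set Dec := Decision K P (R + 2) with hDec
  have h1 : μ {ω | ¬ ∀ j, ‖(ω j).1‖ ≤ 1} = 0 := ae_iff.1 (ae_forall_norm_le_one hD)
  have h2 : μ {ω | ∃ x : Σ r : Fin (R + 1), Fin r → Dec,
      ¬ RoundGood K P D u (R + 2) P.acc (trace K P (List.ofFn x.2)).1
        (trace (d := d) K P (List.ofFn x.2)).2 ω} ≤ _ :=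
    measure_exists_le fun x => prob_not_roundGood_le D hD hu (by omega) hα hε hm hmα
      (predictable_trace (List.ofFn x.2))
  have hcard : Fintype.card (Σ r : Fin (R + 1), Fin r → Dec) ≤
      (R + 1) * (Fintype.card Dec + 1) ^ R := by
    rw [Fintype.card_sigma]
    refine (Finset.sum_le_card_nsmul _ _ ((Fintype.card Dec + 1) ^ R) fun r _ => ?_).trans ?_
    · rw [Fintype.card_fun, Fintype.card_fin]
      calc Fintype.card Dec ^ (r : ℕ) ≤ (Fintype.card Dec + 1) ^ (r : ℕ) := by gcongr; omega
        _ ≤ (Fintype.card Dec + 1) ^ R := by gcongr <;> omega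
    · simp
  have hsub : {ω | ¬ GoodRun K P D u ω} ⊆ {ω | ¬ ∀ j, ‖(ω j).1‖ ≤ 1} ∪
      {ω | ∃ x : Σ r : Fin (R + 1), Fin r → Dec,
        ¬ RoundGood K P D u (R + 2) P.acc (trace K P (List.ofFn x.2)).1
          (trace (d := d) K P (List.ofFn x.2)).2 ω} := by
    intro ω hω
    by_contra hcon
    simp only [Set.mem_union, Set.mem_ofPred_eq, not_or, not_not, not_exists] at hcon
    refine hω ⟨fun l hl => ?_, hcon.1⟩
    have := hcon.2 ⟨⟨l.length, by omega⟩, fun i => l.get i⟩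
    simpa only [List.ofFn_get] using this
  refine (measure_mono hsub).trans ((measure_union_le_add h1.le h2).trans ?_)
  rw [zero_add, ← mul_assoc]
  gcongr
  rw [Nat.cast_mul]
  gcongr

/-- The number of events in the union bound, in terms of the size `m` of a batch. -/
theorem events_le {m R g : ℕ} {Y : ℝ} (hY : 100 ≤ Y) (hm : 1 ≤ m) (hR : (R : ℝ) ≤ 26 * Y ^ 25)
    (hg : (g : ℝ) ≤ 2 * Y) :
    (((R + 1) * (2 + (R + 2) * ((g + 1) * (m * (2 * ((R + 2) * ((R + 2) * (R + 2) + 1))))) + 1) ^ R *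
      (17 * ((R + 2) ^ 4 * (g + 6) * m)) : ℕ) : ℝ) * 2 ≤ (m * Y ^ 110) ^ (R + 2) := by
  have hm' : (1 : ℝ) ≤ m := by exact_mod_cast hm
  have hY0 : 0 < Y := by linarith
  have hY1 : 1 ≤ Y := by linarith
  have hI : (R : ℝ) + 2 ≤ Y ^ 26 := by
    have h1 : 1 ≤ Y ^ 25 := one_le_pow₀ hY1
    have h2 : 100 * Y ^ 25 ≤ Y * Y ^ 25 := by gcongr
    rw [pow_succ']
    linarith
  have hg1 : (g : ℝ) + 6 ≤ 3 * Y := by linarith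
  have hbig : ∀ k ≤ 5, (1 : ℝ) ≤ Y ^ k := fun k _ => one_le_pow₀ hY1
  have e0 : (1 : ℝ) ≤ Y ^ 104 := one_le_pow₀ hY1
  have eY : Y ^ 110 = Y ^ 104 * Y * (Y * Y ^ 4) := by ring
  have e4 : 100 * 1 ≤ Y * Y ^ 4 := mul_le_mul hY (hbig 4 (by norm_num)) zero_le_one hY0.le
  have e5 : Y ^ 104 * Y * 100 ≤ Y ^ 110 := by
    rw [eY]; gcongr; linarith
  have hI4 : ((R : ℝ) + 2) ^ 4 ≤ Y ^ 104 := by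
    calc ((R : ℝ) + 2) ^ 4 ≤ (Y ^ 26) ^ 4 := by gcongr
      _ = Y ^ 104 := by ring
  have hI1 : (1 : ℝ) ≤ R + 2 := by have : (0 : ℝ) ≤ R := Nat.cast_nonneg R; linarith
  have hI2 : ((R : ℝ) + 2) ^ 2 ≤ (R + 2) ^ 4 := pow_le_pow_right₀ hI1 (by norm_num)
  have b1 : ((R : ℝ) + 1) ≤ m * Y ^ 110 := by
    have h1 : Y ^ 26 ≤ Y ^ 110 := pow_le_pow_right₀ hY1 (by norm_num)
    have h2 : 1 * Y ^ 110 ≤ m * Y ^ 110 := by gcongr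
    linarith
  have b2 : (2 + ((R : ℝ) + 2) * ((g + 1) * (m * (2 * ((R + 2) * ((R + 2) * (R + 2) + 1))))) + 1)
      ≤ m * Y ^ 110 := by
    calc (2 + ((R : ℝ) + 2) * ((g + 1) * (m * (2 * ((R + 2) * ((R + 2) * (R + 2) + 1))))) + 1)
        = 3 + m * ((g + 1) * (2 * ((R + 2) ^ 4 + (R + 2) ^ 2))) := by ring
      _ ≤ 3 * (m * (Y ^ 104 * Y)) + m * ((3 * Y) * (2 * (Y ^ 104 + Y ^ 104))) := by
        have h1 : 1 * (1 * 1) ≤ m * (Y ^ 104 * Y) := by gcongr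
        gcongr
        · linarith
        · linarith
        · exact hI2.trans hI4
      _ = m * (Y ^ 104 * Y * 15) := by ring
      _ ≤ m * Y ^ 110 := by
        gcongr
        refine le_trans ?_ e5
        gcongr
        norm_num
  have b3 : 17 * (((R : ℝ) + 2) ^ 4 * (g + 6) * m) * 2 ≤ m * Y ^ 110 := by
    calc 17 * (((R : ℝ) + 2) ^ 4 * (g + 6) * m) * 2 ≤ 17 * (Y ^ 104 * (3 * Y) * m) * 2 := by gcongr
      _ = m * (Y ^ 104 * Y * 102) := by ring
      _ ≤ m * Y ^ 110 := by
        gcongr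
        rw [eY]
        gcongr
        have : 100 * 100 ≤ Y * Y ^ 4 := mul_le_mul hY
          (hY.trans (le_self_pow₀ hY1 (by norm_num))) (by norm_num) hY0.le
        linarith
  push_cast
  calc ((R : ℝ) + 1) * (2 + (R + 2) * ((g + 1) * (m * (2 * ((R + 2) * ((R + 2) * (R + 2) + 1))))) + 1)
        ^ R * (17 * ((R + 2) ^ 4 * (g + 6) * m)) * 2
      = (R + 1) * (2 + (R + 2) * ((g + 1) * (m * (2 * ((R + 2) * ((R + 2) * (R + 2) + 1))))) + 1)
        ^ R * (17 * ((R + 2) ^ 4 * (g + 6) * m) * 2) := by ring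
    _ ≤ (m * Y ^ 110) * (m * Y ^ 110) ^ R * (m * Y ^ 110) := by gcongr
    _ = _ := by ring

/-- The batches are large enough for the union bound. -/
theorem pow_mul_exp_le {m R : ℕ} {Y ℓ : ℝ} (hY : 100 ≤ Y) (hℓ : 1 / 2 ≤ ℓ)
    (hm : 300 * Y ^ 300 * ℓ ≤ m) (hR : (R : ℝ) ≤ 26 * Y ^ 25) :
    (m * Y ^ 110) ^ (R + 2) * Real.exp (-(m * ((1 / Y) ^ 50) ^ 2 / 4)) ≤ Real.exp (-ℓ) := by
  have hY0 : 0 < Y := by linarith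
  have hY1 : 1 ≤ Y := by linarith
  have hmpos : (0 : ℝ) < m := lt_of_lt_of_le (by positivity) hm
  have hI : (R : ℝ) + 2 ≤ Y ^ 26 := by
    have h1 : 1 ≤ Y ^ 25 := one_le_pow₀ hY1
    have h2 : 100 * Y ^ 25 ≤ Y * Y ^ 25 := by gcongr
    rw [pow_succ']
    linarith
  have hexp : (m * Y ^ 110) ^ (R + 2) = Real.exp ((R + 2) * Real.log (m * Y ^ 110)) := by
    rw [← Real.exp_log (show 0 < (m * Y ^ 110) ^ (R + 2) by positivity), Real.log_pow]
    push_cast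
    rfl
  rw [hexp, ← Real.exp_add, Real.exp_le_exp]
  -- the logarithm of the number of events is small compared with `m`, because `log m ≤ 2 √m`
  have hlog : Real.log (m * Y ^ 110) ≤ 2 * Real.sqrt m + 110 * Y := by
    rw [Real.log_mul (by positivity) (by positivity), Real.log_pow]
    have h1 : Real.log m = 2 * Real.log (Real.sqrt m) := by rw [Real.log_sqrt hmpos.le]; ring
    have h2 := Real.log_le_sub_one_of_pos (Real.sqrt_pos.2 hmpos)
    have h3 := Real.log_le_sub_one_of_pos hY0
    push_cast
    linarith
  have hm1 : Y ^ 300 ≤ m := by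
    refine le_trans ?_ hm
    have := mul_le_mul_of_nonneg_left hℓ (by positivity : 0 ≤ 300 * Y ^ 300)
    have h0 : 0 < Y ^ 300 := by positivity
    linarith
  have hsq : 24 * Y ^ 126 ≤ Real.sqrt m := by
    refine Real.le_sqrt_of_sq_le (le_trans ?_ hm1)
    calc (24 * Y ^ 126) ^ 2 = 576 * Y ^ 252 := by ring
      _ ≤ (100 * 100) * Y ^ 252 := by gcongr; norm_num
      _ ≤ (Y * Y) * Y ^ 252 := by gcongr
      _ = Y ^ 254 := by ring
      _ ≤ Y ^ 300 := pow_le_pow_right₀ hY1 (by norm_num)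
  set x := m * ((1 / Y) ^ 50) ^ 2 with hx
  have hxY : x * Y ^ 100 = m := by
    rw [hx]; field_simp
  have hYY : 0 < Y ^ 100 := by positivity
  have b1 : Y ^ 26 * (2 * Real.sqrt m) ≤ x / 12 := by
    refine le_of_mul_le_mul_right ?_ hYY
    have h1 : Real.sqrt m * (24 * Y ^ 126) ≤ Real.sqrt m * Real.sqrt m := by gcongr
    rw [Real.mul_self_sqrt hmpos.le] at h1
    have h2 : Y ^ 126 = Y ^ 26 * Y ^ 100 := by ring
    rw [h2] at h1
    linarith
  have b2 : Y ^ 26 * (110 * Y) ≤ x / 12 := by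
    refine le_of_mul_le_mul_right ?_ hYY
    have h1 : 1320 * Y ^ 127 ≤ m := by
      refine le_trans ?_ hm1
      calc 1320 * Y ^ 127 ≤ (100 * 100) * Y ^ 127 := by gcongr; norm_num
        _ ≤ (Y * Y) * Y ^ 127 := by gcongr
        _ = Y ^ 129 := by ring
        _ ≤ Y ^ 300 := pow_le_pow_right₀ hY1 (by norm_num)
    rw [← hxY] at h1
    have h2 : Y ^ 127 = Y ^ 26 * Y * Y ^ 100 := by ring
    rw [h2] at h1
    linarith
  have b3 : ℓ ≤ x / 12 := by
    refine le_of_mul_le_mul_right ?_ hYY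
    have h1 : Y ^ 100 ≤ Y ^ 300 := pow_le_pow_right₀ hY1 (by norm_num)
    have h2 : 300 * Y ^ 100 * ℓ ≤ m := le_trans (by gcongr) hm
    rw [← hxY] at h2
    have h3 : 0 ≤ Y ^ 100 * ℓ := by positivity
    linarith
  have b4 : ((R : ℝ) + 2) * Real.log (m * Y ^ 110) ≤ Y ^ 26 * (2 * Real.sqrt m + 110 * Y) := by
    have h0 : 0 ≤ (R : ℝ) + 2 := by positivity
    have h1 : 0 ≤ 2 * Real.sqrt m + 110 * Y := by positivity
    exact (mul_le_mul_of_nonneg_left hlog h0).trans (mul_le_mul_of_nonneg_right hI h1)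
  linarith

theorem one_le_mul_pow {m Y ℓ : ℝ} (hY : 100 ≤ Y) (hℓ : 1 / 2 ≤ ℓ) (hm : 300 * Y ^ 300 * ℓ ≤ m) :
    1 ≤ m * ((1 / Y) ^ 50) ^ 2 := by
  have hY0 : 0 < Y := by linarith
  have hm1 : Y ^ 100 ≤ m := by
    refine le_trans ?_ hm
    have h1 : Y ^ 100 ≤ Y ^ 300 := pow_le_pow_right₀ (by linarith) (by norm_num)
    have := mul_le_mul_of_nonneg_left hℓ (by positivity : 0 ≤ 300 * Y ^ 300)
    have h0 : 0 < Y ^ 300 := by positivity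
    linarith
  have h2 : Y ^ 100 * ((1 / Y) ^ 50) ^ 2 = 1 := by
    rw [← pow_mul, ← mul_pow, mul_one_div_cancel hY0.ne', one_pow]
  calc (1 : ℝ) = Y ^ 100 * ((1 / Y) ^ 50) ^ 2 := h2.symm
    _ ≤ _ := by gcongr

theorem two_le_of_le {m Y ℓ : ℝ} (hY : 100 ≤ Y) (hℓ : 1 / 2 ≤ ℓ) (hm : 300 * Y ^ 300 * ℓ ≤ m) :
    2 ≤ m := by
  refine le_trans ?_ hm
  have h0 : 1 ≤ Y ^ 300 := one_le_pow₀ (by linarith)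
  have := mul_le_mul_of_nonneg_left hℓ (by positivity : 0 ≤ 300 * Y ^ 300)
  linarith

theorem natCast_mul_failProb (n m : ℕ) (α : ℝ) :
    (n : ENNReal) * failProb m α = ENNReal.ofReal (n * 2 * Real.exp (-(m * α ^ 2 / 4))) := by
  rw [failProb, ENNReal.ofReal_mul (by positivity), ENNReal.ofReal_mul (by positivity), mul_assoc]
  simp

section Constants

/-- Constants for which the analysis works. -/
def theConstants : Constants := ⟨300, 10, 40, 25⟩

variable {L : ℝ≥0} {ζ ε δ : ℝ}

theorem half_le_log_two_div (hδ : 0 < δ) (hδ1 : δ < 1) : 1 / 2 ≤ Real.log (2 / δ) := by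
  have h1 : (2 : ℝ) ≤ 2 / δ := by rw [le_div_iff₀ hδ]; linarith
  have := Real.log_le_log (by norm_num) h1
  linarith [Real.log_two_gt_d9]

theorem le_batch : 300 * ((1 + L) / ε) ^ 300 * Real.log (2 / δ) ≤
    (Params.batch ⟨L, ζ, ε, δ⟩ theConstants : ℝ) := by
  simpa [Params.batch, theConstants] using
    Nat.le_ceil ((300 : ℝ) * ((1 + L) / ε) ^ 300 * Real.log (2 / δ))

theorem hundred_le (hε : 0 < ε) (hε1 : ε ≤ 1 / 100) : 100 ≤ (1 + (L : ℝ)) / ε := by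
  rw [le_div_iff₀ hε]
  have : (0 : ℝ) ≤ L := L.2
  linarith

theorem rounds_le (hε : 0 < ε) (hε1 : ε ≤ 1 / 100) :
    (Params.rounds ⟨L, ζ, ε, δ⟩ theConstants : ℝ) ≤ 26 * ((1 + L) / ε) ^ 25 := by
  have h1 : (1 : ℝ) ≤ ((1 + L) / ε) ^ 25 :=
    one_le_pow₀ ((by norm_num : (1 : ℝ) ≤ 100).trans (hundred_le hε hε1))
  have h2 := Nat.ceil_lt_add_one (a := (25 : ℝ) * ((1 + L) / ε) ^ 25) (by positivity)
  have h3 : (Params.rounds ⟨L, ζ, ε, δ⟩ theConstants : ℝ) =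
      ⌈(25 : ℝ) * ((1 + L) / ε) ^ 25⌉₊ := by
    simp [Params.rounds, theConstants]
  rw [h3]
  linarith

theorem le_batch_mul_acc_sq (hε : 0 < ε) (hε1 : ε ≤ 1 / 100) (hδ : 0 < δ) (hδ1 : δ < 1) :
    1 ≤ (Params.batch ⟨L, ζ, ε, δ⟩ theConstants : ℝ) * Params.acc ⟨L, ζ, ε, δ⟩ ^ 2 := by
  have hacc : Params.acc ⟨L, ζ, ε, δ⟩ = (1 / ((1 + (L : ℝ)) / ε)) ^ 50 := by
    rw [Params.acc, Params.scale, one_div_div]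
  rw [hacc]
  exact one_le_mul_pow (hundred_le hε hε1) (half_le_log_two_div hδ hδ1) le_batch

theorem regime (hζ : 0 ≤ ζ) (hε : 0 < ε) (hε1 : ε ≤ 1 / 100) (hδ : 0 < δ) (hδ1 : δ < 1) :
    Regime theConstants ⟨L, ζ, ε, δ⟩ :=
  ⟨hε, hε1, hζ, rfl, rfl, le_batch_mul_acc_sq hε hε1 hδ hδ1⟩

/-- With probability at least `1 - δ` a run is good. -/
theorem prob_not_goodRun_le_delta (hζ : 0 ≤ ζ) (hε : 0 < ε) (hε1 : ε ≤ 1 / 100) (hδ : 0 < δ)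
    (hδ1 : δ < 1) (D : Measure (Example d)) [IsProbabilityMeasure D] (hD : ∀ᵐ z ∂D, ‖z.1‖ ≤ 1)
    {u : Pt d} (hu : ‖u‖ ≤ 1) :
    (Measure.infinitePi fun _ : ℕ => D) {ω | ¬ GoodRun theConstants ⟨L, ζ, ε, δ⟩ D u ω} ≤
      ENNReal.ofReal δ := by
  set P : Params := ⟨L, ζ, ε, δ⟩ with hP
  have hR : Regime theConstants P := regime hζ hε hε1 hδ hδ1
  have hY := hundred_le (L := L) hε hε1
  have hℓ := half_le_log_two_div hδ hδ1
  have hm := le_batch (L := L) (ζ := ζ) (ε := ε) (δ := δ)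
  have hrounds := rounds_le (L := L) (ζ := ζ) (δ := δ) hε hε1
  rw [← hP] at hm hrounds
  set Y := (1 + (L : ℝ)) / ε with hYdef
  have hacc : P.acc = (1 / Y) ^ 50 := by
    rw [Params.acc, Params.scale, hYdef, one_div_div]
  have hacc1 : P.acc ≤ 1 := pow_le_one₀ hR.scale_pos.le (hR.scale_le.trans (by norm_num))
  have hmα : 1 ≤ P.batch theConstants * P.acc := by
    refine hR.batch.trans ?_
    have := hR.acc_pos
    gcongr
    nlinarith
  have hm2 : 2 ≤ P.batch theConstants := by
    have h1 : (2 : ℝ) ≤ P.batch theConstants := two_le_of_le hY hℓ hm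
    exact_mod_cast h1
  have hg : (P.grid : ℝ) ≤ 2 * Y := by
    have h1 : (P.grid : ℝ) ≤ 2 / ε := Nat.floor_le (by positivity)
    refine h1.trans ?_
    rw [hYdef, mul_div_assoc', div_le_div_iff_of_pos_right hε]
    have : (0 : ℝ) ≤ L := L.2
    linarith
  refine (prob_not_goodRun_le D hD hu hR.acc_pos hε hm2 hmα).trans ?_
  have hcard : Fintype.card (Decision theConstants P (P.rounds theConstants + 2)) =
      2 + (P.rounds theConstants + 2) * ((P.grid + 1) * (P.batch theConstants *
        (2 * ((P.rounds theConstants + 2) *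
          ((P.rounds theConstants + 2) * (P.rounds theConstants + 2) + 1))))) := by
    simp [Fintype.card_sum, Fintype.card_prod, Fintype.card_option]
  rw [hcard, estimates, natCast_mul_failProb, hacc]
  refine ENNReal.ofReal_le_ofReal ((mul_le_mul_of_nonneg_right
    (events_le hY (by omega) hrounds hg) (Real.exp_pos _).le).trans
    ((pow_mul_exp_le hY hℓ hm hrounds).trans ?_))
  rw [← Real.log_inv, Real.exp_log (by positivity), inv_div]
  linarith

end Constants

/-! ### Samples and time -/

/-- The number of steps is polynomial in any bound for the batch size, the number of rounds and the
size of the grid. -/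
theorem timeBound_le {K : Constants} {P : Params} {N : ℝ} (hd : 0 < d) (hN : 1 ≤ N)
    (hK : K.cBatch + K.cMerge + K.cRounds ≤ 400) (hm : (P.batch K : ℝ) ≤ N)
    (hR : (P.rounds K : ℝ) ≤ N) (hg : (P.grid : ℝ) ≤ N) :
    (Alg.timeBound d K P : ℝ) ≤ d * (5000 * N ^ 4) := by
  have hd' : (1 : ℝ) ≤ d := by exact_mod_cast hd
  have hK' : (K.cBatch + K.cMerge + K.cRounds : ℝ) ≤ 400 := by exact_mod_cast hK
  have hΛ : ((2 * P.rounds K + 3 : ℕ) : ℝ) ≤ 5 * N := by push_cast; linarith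
  have hN0 : 0 < N := by linarith
  set Λ := 2 * P.rounds K + 3
  set m := P.batch K
  set R := P.rounds K
  set g := P.grid
  have hdN : 1 * 1 ≤ d * N := by gcongr
  have h1 : (Λ * (2 * d + 20) + 12 * d + 80 + m * 9 : ℝ) ≤ 211 * (d * N) := by
    have e1 : (Λ : ℝ) * (2 * d + 20) ≤ 5 * N * (22 * d) := by gcongr; linarith
    have e2 : (d : ℝ) * 1 ≤ d * N := by gcongr
    have e3 : 1 * N ≤ d * N := by gcongr
    linarith
  have h2 : (m * (Λ * (2 * d + 20) + 12 * d + 80 + m * 9) + 12 * d + 60 : ℝ) ≤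
      283 * (d * N ^ 2) := by
    have e1 : (m : ℝ) * (Λ * (2 * d + 20) + 12 * d + 80 + m * 9) ≤ N * (211 * (d * N)) := by gcongr
    have e2 : (d : ℝ) * 1 ≤ d * N ^ 2 := by gcongr; exact one_le_pow₀ hN
    linarith
  have h3 : (Alg.roundCost d K P Λ : ℝ) ≤ 3600 * (d * N ^ 3) := by
    have e1 : ((g : ℝ) + 10) * (m * (Λ * (2 * d + 20) + 12 * d + 80 + m * 9) + 12 * d + 60) ≤
        (11 * N) * (283 * (d * N ^ 2)) := by gcongr; linarith
    have e2 : ((Λ : ℝ) + 3) * (Λ * 6 + 20) ≤ (8 * N) * (50 * N) := by gcongr <;> linarith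
    have e3 : 1 * N ^ 2 ≤ d * N ^ 3 := by gcongr; norm_num
    have e4 : Alg.roundCost d K P Λ =
        (g + 10) * (m * (Λ * (2 * d + 20) + 12 * d + 80 + m * 9) + 12 * d + 60) +
          (Λ + 3) * (Λ * 6 + 20) := rfl
    have e5 : 0 ≤ d * N ^ 3 := by positivity
    rw [e4]
    push_cast
    linarith
  have h4 : (R : ℝ) * Alg.roundCost d K P Λ ≤ N * (3600 * (d * N ^ 3)) := by gcongr
  have h5 : (m : ℝ) * (d + 9) ≤ N * (10 * d) := by gcongr; linarith
  have h6 : 1 * N ≤ d * N ^ 4 := by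
    have : N ≤ N ^ 4 := le_self_pow₀ hN (by norm_num)
    gcongr
  have h7 : d * N ≤ d * N ^ 4 := by
    have : N ≤ N ^ 4 := le_self_pow₀ hN (by norm_num)
    gcongr
  have h8 : Alg.timeBound d K P = K.cBatch + K.cMerge + K.cRounds + m + R + g + 20 +
      (m * (d + 9) + 5) + R * Alg.roundCost d K P Λ := rfl
  rw [h8]
  push_cast
  linarith

section Bounds

variable {L : ℝ≥0} {ζ ε δ : ℝ}

theorem grid_le (hε : 0 < ε) :
    (Params.grid ⟨L, ζ, ε, δ⟩ : ℝ) ≤ 2 * (1 + (1 + L) * ε⁻¹) := by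
  have h1 : (Params.grid ⟨L, ζ, ε, δ⟩ : ℝ) ≤ 2 / ε := Nat.floor_le (by positivity)
  have h2 : 0 ≤ (L : ℝ) * ε⁻¹ := by positivity
  rw [div_eq_mul_inv] at h1
  linarith

theorem rounds_le_pow (hε : 0 < ε) :
    (Params.rounds ⟨L, ζ, ε, δ⟩ theConstants : ℝ) ≤ 26 * (1 + (1 + L) * ε⁻¹) ^ 25 := by
  have h0 : 0 ≤ (1 + (L : ℝ)) * ε⁻¹ := by positivity
  have h1 : (1 : ℝ) ≤ (1 + (1 + L) * ε⁻¹) ^ 25 := one_le_pow₀ (by linarith)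
  have h2 : ((1 + (L : ℝ)) * ε⁻¹) ^ 25 ≤ (1 + (1 + L) * ε⁻¹) ^ 25 := by gcongr; linarith
  have h3 : (Params.rounds ⟨L, ζ, ε, δ⟩ theConstants : ℝ) =
      ⌈(25 : ℝ) * ((1 + L) * ε⁻¹) ^ 25⌉₊ := by
    simp [Params.rounds, theConstants, div_eq_mul_inv]
  have h4 := Nat.ceil_lt_add_one (a := (25 : ℝ) * ((1 + L) * ε⁻¹) ^ 25) (by positivity)
  rw [h3]
  generalize (1 + (1 + L) * ε⁻¹) ^ 25 = V at *
  linarith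

theorem batch_le (hε : 0 < ε) (hδ : 0 < δ) (hδ1 : δ < 1) :
    (Params.batch ⟨L, ζ, ε, δ⟩ theConstants : ℝ) ≤
      302 * ((1 + (1 + L) * ε⁻¹) ^ 300 * Real.log (2 / δ)) := by
  have hℓ := half_le_log_two_div hδ hδ1
  have h3 : (Params.batch ⟨L, ζ, ε, δ⟩ theConstants : ℝ) =
      ⌈(300 : ℝ) * ((1 + L) * ε⁻¹) ^ 300 * Real.log (2 / δ)⌉₊ := by
    simp [Params.batch, theConstants, div_eq_mul_inv]
  rw [h3]
  generalize Real.log (2 / δ) = ℓ at hℓ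
  have h0 : 0 ≤ (1 + (L : ℝ)) * ε⁻¹ := by positivity
  generalize (1 + (L : ℝ)) * ε⁻¹ = Y at h0
  have hℓ0 : 0 < ℓ := by linarith
  have hpow : ∀ k : ℕ, 1 ≤ (1 + Y) ^ k ∧ 0 ≤ Y ^ k ∧ Y ^ k ≤ (1 + Y) ^ k := fun k =>
    ⟨one_le_pow₀ (by linarith), pow_nonneg h0 k, pow_le_pow_left₀ h0 (by linarith) k⟩
  obtain ⟨h1, h7, h2⟩ := hpow 300
  generalize (1 + Y) ^ 300 = V at *
  generalize Y ^ 300 = W at *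
  have h4 := Nat.ceil_lt_add_one (a := (300 : ℝ) * W * ℓ) (by positivity)
  have h5 := mul_le_mul_of_nonneg_right h2 hℓ0.le
  have h6 := mul_le_mul_of_nonneg_right h1 hℓ0.le
  linarith

theorem samples_le_of_le {V ℓ m R g : ℝ} (hV : 1 ≤ V) (hℓ : 1 / 2 ≤ ℓ) (hR0 : 0 ≤ R) (hg0 : 0 ≤ g)
    (hm : m ≤ 302 * (V ^ 300 * ℓ)) (hR : R ≤ 26 * V ^ 25) (hg : g ≤ 2 * V) :
    m * (R * (g + 7) + 3) ≤ 100000 * V ^ 326 * ℓ := by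
  have hℓ0 : 0 < ℓ := by linarith
  have hV0 : 0 < V := by linarith
  have hpow : ∀ k : ℕ, 1 ≤ V ^ k := fun k => one_le_pow₀ hV
  have h4 : (1 : ℝ) ≤ V ^ 25 * V := by
    rw [← pow_succ]
    exact hpow 26
  have h5 : V ^ 326 = V ^ 300 * (V ^ 25 * V) := by rw [← pow_succ, ← pow_add]
  have h6 := hpow 300
  have h8 := hpow 25
  rw [h5]
  generalize V ^ 300 = A at *
  generalize V ^ 25 = B at *
  have hA0 : 0 < A := by linarith
  have hB0 : 0 < B := by linarith
  calc m * (R * (g + 7) + 3) ≤ 302 * (A * ℓ) * (26 * B * (9 * V) + 3 * (B * V)) := by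
        gcongr <;> linarith
    _ = 71574 * (A * (B * V) * ℓ) := by ring
    _ ≤ _ := by
        have : 0 ≤ A * (B * V) * ℓ := by positivity
        linarith

theorem le_of_le_pow {V ℓ m R g : ℝ} (hV : 1 ≤ V) (hℓ : 1 / 2 ≤ ℓ)
    (hm : m ≤ 302 * (V ^ 300 * ℓ)) (hR : R ≤ 26 * V ^ 25) (hg : g ≤ 2 * V) :
    1 ≤ 100000 * V ^ 326 * ℓ ∧ m ≤ 100000 * V ^ 326 * ℓ ∧ R ≤ 100000 * V ^ 326 * ℓ ∧
      g ≤ 100000 * V ^ 326 * ℓ := by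
  have hℓ0 : 0 < ℓ := by linarith
  have hpow : ∀ k n : ℕ, k ≤ n → V ^ k ≤ V ^ n := fun k n hk => pow_le_pow_right₀ hV hk
  have k0 := hpow 0 326 (by norm_num)
  have k1 := hpow 1 326 (by norm_num)
  have k2 := hpow 25 326 (by norm_num)
  have k3 := hpow 300 326 (by norm_num)
  rw [pow_zero] at k0
  rw [pow_one] at k1
  generalize V ^ 326 = A at *
  generalize V ^ 300 = A' at *
  generalize V ^ 25 = B at *
  have k4 := mul_le_mul_of_nonneg_right k3 hℓ0.le
  have k5 := mul_le_mul_of_nonneg_left hℓ (zero_le_one.trans k0)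
  exact ⟨by linarith, by linarith, by linarith, by linarith⟩

theorem samples_and_time_le {N : ℝ} (hd : 0 < d) (hε : 0 < ε) (hδ : 0 < δ) (hδ1 : δ < 1)
    (hN : N = 100000 * (1 + (1 + L) * ε⁻¹) ^ 326 * Real.log (2 / δ)) (ω : ℕ → Example d) :
    (glmSamples theConstants ⟨L, ζ, ε, δ⟩ ω : ℝ) ≤ N ∧
      (glmTime theConstants ⟨L, ζ, ε, δ⟩ ω : ℝ) ≤ d * (5000 * N ^ 4) := by
  obtain ⟨g1, g2⟩ := glmSamples_le_and_glmTime_le theConstants ⟨L, ζ, ε, δ⟩ ω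
  have hℓ := half_le_log_two_div hδ hδ1
  have h1 := batch_le (L := L) (ζ := ζ) hε hδ hδ1
  have h2 := rounds_le_pow (L := L) (ζ := ζ) (δ := δ) hε
  have h3 := grid_le (L := L) (ζ := ζ) (δ := δ) hε
  have h0 : 0 ≤ (1 + (L : ℝ)) * ε⁻¹ := by positivity
  have hV : 1 ≤ 1 + (1 + (L : ℝ)) * ε⁻¹ := le_add_of_nonneg_right h0
  have hs := samples_le_of_le hV hℓ (Nat.cast_nonneg _) (Nat.cast_nonneg _) h1 h2 h3
  obtain ⟨k0, k1, k2, k3⟩ := le_of_le_pow hV hℓ h1 h2 h3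
  rw [← hN] at hs k0 k1 k2 k3
  refine ⟨(Nat.cast_le.2 g1).trans (le_trans (le_of_eq ?_) hs), (Nat.cast_le.2 g2).trans
    (timeBound_le hd k0 (by norm_num [theConstants]) k1 k2 k3)⟩
  rw [Alg.sampleBound]
  push_cast
  rfl

end Bounds

theorem zeroOneErr_le_one (D : Measure (Example d)) [IsProbabilityMeasure D] (h : Pt d → Bool) :
    zeroOneErr D h ≤ 1 := measureReal_le_one

theorem IsLink.integral_le_one {L : ℝ≥0} {σ : ℝ → ℝ} (hσ : IsLink L σ) (w : Pt d)
    (D : Measure (Example d)) [IsProbabilityMeasure D] : ∫ z, σ |inner ℝ w z.1| ∂D ≤ 1 := by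
  calc ∫ z, σ |inner ℝ w z.1| ∂D ≤ ∫ _z : Example d, (1 : ℝ) ∂D :=
        integral_mono (hσ.integrable_comp w) (integrable_const 1)
          fun z => (abs_le.1 (hσ.bound _)).2
    _ = 1 := by simp

theorem mainTheorem4 :
    ∃ (K : Constants) (C : ℝ) (p : MvPolynomial (Fin 3) ℝ) (q : Polynomial ℝ),
      ∀ (d : ℕ) (L : ℝ≥0) (ζ ε δ : ℝ), 0 < d → 0 ≤ ζ → ζ < 1 / 2 → 0 < ε → 0 < δ → δ < 1 →
        -- sample complexity and running time, on every stream of examples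
        (∀ (N : ℝ), N = MvPolynomial.eval ![(L : ℝ), ε⁻¹, (max ζ ε)⁻¹] p * Real.log (2 / δ) →
          ∀ ω : ℕ → Example d,
            (glmSamples K ⟨L, ζ, ε, δ⟩ ω : ℝ) ≤ N ∧
            (glmTime K ⟨L, ζ, ε, δ⟩ ω : ℝ) ≤ d * q.eval N) ∧
        -- error guarantee, with probability at least `1 - δ` over i.i.d. examples
        (∀ (σ : ℝ → ℝ) (w : Pt d) (D : Measure (Example d)) [IsProbabilityMeasure D],
          IsLink L σ → ‖w‖ ≤ 1 → IsMisspecifiedGLM ζ σ w D →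
          (Measure.infinitePi fun _ : ℕ => D)
            {ω | ¬ zeroOneErr D (glmOutput K ⟨L, ζ, ε, δ⟩ ω).predict ≤
              (1 - ∫ z, σ |inner ℝ w z.1| ∂D) / 2 + ζ + C * ε} ≤ ENNReal.ofReal δ) := by
  refine ⟨theConstants, 100,
    MvPolynomial.C 100000 * (1 + (1 + MvPolynomial.X 0) * MvPolynomial.X 1) ^ 326,
    Polynomial.C 5000 * Polynomial.X ^ 4, fun d L ζ ε δ hd hζ _ hε hδ hδ1 => ⟨?_, ?_⟩⟩
  · intro N hN ω
    have hN' : N = 100000 * (1 + (1 + L) * ε⁻¹) ^ 326 * Real.log (2 / δ) := by simpa using hN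
    simpa using samples_and_time_le (ζ := ζ) hd hε hδ hδ1 hN' ω
  · intro σ w D _ hσ hw hmod
    rcases le_or_gt ε (1 / 100) with hε1 | hε1
    · refine (measure_mono fun ω hω => ?_).trans
        (prob_not_goodRun_le_delta (L := L) hζ hε hε1 hδ hδ1 D hmod.support hw)
      exact fun hg => hω (GoodRun.zeroOneErr_le (regime hζ hε hε1 hδ hδ1) rfl hσ hw hmod hg)
    · -- for large `ε` the bound on the error exceeds `1`
      have h0 : ∀ ω, zeroOneErr D (glmOutput theConstants ⟨L, ζ, ε, δ⟩ ω).predict ≤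
          (1 - ∫ z, σ |inner ℝ w z.1| ∂D) / 2 + ζ + 100 * ε := fun ω => by
        have h1 := zeroOneErr_le_one D (glmOutput theConstants ⟨L, ζ, ε, δ⟩ ω).predict
        have h2 := hσ.integral_le_one w D
        linarith
      simp [h0]
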